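/- **Setting.** Let $M$ be a smooth manifold of dimension $m+1$, $m\ge 1$, with a smooth family of symmetric, nonnegative bilinear forms $\langle\cdot,\cdot\rangle^*$ on the cotangent spaces (a subriemannian metric), and let $dv_M$ be a smooth nowhere vanishing $(m+1)$-form on $M$. Put $|\omega|_*=(\langle\omega,\omega\rangle^*)^{1/2}$, define $G:T^*M\to TM$ by $\omega(G(\eta))=\langle\omega,\eta\rangle^*$, and let $\xi=\mathrm{Range}(G)$. For a $1$-form $\omega$ let $\omega\lrcorner dv_M$ be the $m$-form with $\eta\wedge(\omega\lrcorner dv_M)=\langle\eta,\omega\rangle^*dv_M$ for every $1$-form $\eta$. For $p\ge 0$ and a smooth function $\phi$, the function $H_{\phi,p}$ is defined where $|d\phi|_*\neq 0$ by $$d\Big(\frac{d\phi}{|d\phi|_*^{1-p}}\lrcorner dv_M\Big)=H_{\phi,p}\,dv_M .$$ For smooth vector fields $X_1,\dots,X_r$ on an open set, $\pounds(X_1,\dots,X_r)$ denotes the smallest $C^\infty$-module of vector fields that contains $X_1,\dots,X_r$ and is closed under the Lie bracket; its rank at $x$ is the dimension of the span of the vectors $Z(x)$, $Z\in\pounds(X_1,\dots,X_r)$.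 For a distribution with a local basis of smooth sections $X_1,\dots,X_r$, write $\pounds$ of the distribution for $\pounds(X_1,\dots,X_r)$ (the rank does not depend on the basis). **Theorem.** Let $p_0\in M$ and suppose that, near $p_0$, $\dim\xi=m+1-l$ is constant. Let $\phi,\psi$ be smooth real functions near $p_0$ with $|d\phi|_*\ne0$ and $|d\psi|_*\neq 0$ at $p_0$, and put $\Sigma_1=\{\phi=0\}$, $\Sigma_2=\{\psi=0\}$ (hypersurfaces near $p_0$). Let $p\ge0$, and let $b(x,z,q)$ be a smooth function of $x$ near $p_0$, $z\in\mathbb R$ and $q\in T_x^*M$ with $\partial b/\partial z\le 0$. Assume that near $p_0$ $$H_{\psi,p}+b(x,\psi,d\psi)\le H_{\phi,p}+b(x,\phi,d\phi),\qquad \psi\ge\phi,$$ and that $\psi(p_0)=\phi(p_0)=0$. Then: (a) If $\mathrm{rank}\,\pounds(\xi\cap T\Sigma_1)=m$ at the points of $\Sigma_1$ near $p_0$, then $\psi=\phi=0$ on $\Sigma_1$ near $p_0$, and $\Sigma_2$ coincides with $\Sigma_1$ near $p_0$. (b) If $p>0$ and $\mathrm{rank}\,\pounds(\xi)=m+1$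 near $p_0$, then $\psi=\phi$ near $p_0$. -/

import Mathlib

open Set Filter
open scoped Topology Manifold ContDiff

noncomputable section

namespace Subriemannian

/-- For a bilinear form `B` on the dual of `ℝⁿ`, the linear map `η ↦ ∑ᵢ B(eⁱ, η) eᵢ`, i.e. the one
with `θ (raise B η) = B(θ, η)`. -/
def raise {n : ℕ} (B : LinearMap.BilinForm ℝ (EuclideanSpace ℝ (Fin n) →L[ℝ] ℝ)) :
    (EuclideanSpace ℝ (Fin n) →L[ℝ] ℝ) →ₗ[ℝ] EuclideanSpace ℝ (Fin n) :=
  ∑ i : Fin n, (B (EuclideanSpace.proj i)).smulRight (EuclideanSpace.single i (1 : ℝ))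

theorem apply_raise {n : ℕ} (B : LinearMap.BilinForm ℝ (EuclideanSpace ℝ (Fin n) →L[ℝ] ℝ))
    (θ η : EuclideanSpace ℝ (Fin n) →L[ℝ] ℝ) : θ (raise B η) = B θ η := by
  have h : θ = ∑ i : Fin n, θ (EuclideanSpace.single i (1 : ℝ)) •
      (EuclideanSpace.proj i : EuclideanSpace ℝ (Fin n) →L[ℝ] ℝ) := by
    refine ContinuousLinearMap.coe_injective
      ((EuclideanSpace.basisFun (Fin n) ℝ).toBasis.ext fun j => ?_)
    simp [PiLp.single_apply]
  have h' : B θ η = ∑ i : Fin n, θ (EuclideanSpace.single i (1 : ℝ)) *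
      B (EuclideanSpace.proj i) η := by
    conv_lhs => rw [h, map_sum, LinearMap.sum_apply]
    refine Finset.sum_congr rfl fun i _ => ?_
    rw [map_smul, LinearMap.smul_apply, smul_eq_mul]
  rw [h', raise, LinearMap.sum_apply, map_sum]
  refine Finset.sum_congr rfl fun i _ => ?_
  rw [LinearMap.smulRight_apply, map_smul, smul_eq_mul, mul_comm]

section Basics

variable {m : ℕ} {M : Type*} [TopologicalSpace M]
  [ChartedSpace (EuclideanSpace ℝ (Fin (m + 1))) M]

/-- The differential `df_x`, an element of the cotangent space `T*_x M`. -/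
abbrev differential (f : M → ℝ) (x : M) : TangentSpace (𝓡 (m + 1)) x →L[ℝ] ℝ :=
  mvfderiv (𝓡 (m + 1)) f x

/-- Smoothness of a vector field on a set, as a section of the tangent bundle. -/
def SmoothFieldOn [IsManifold (𝓡 (m + 1)) ∞ M] (U : Set M) (X : Π x : M, TangentSpace (𝓡 (m + 1)) x) : Prop :=
  ContMDiffOn (𝓡 (m + 1)) (𝓡 (m + 1)).tangent ∞
    (fun x => (⟨x, X x⟩ : TangentBundle (𝓡 (m + 1)) M)) U

/-! ### Differential forms -/

/-- A `k`-form on `M` (no smoothness is included). -/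
abbrev Form (m : ℕ) (M : Type*) [TopologicalSpace M]
    [ChartedSpace (EuclideanSpace ℝ (Fin (m + 1))) M] (k : ℕ) : Type _ :=
  Π x : M, TangentSpace (𝓡 (m + 1)) x [⋀^Fin k]→L[ℝ] ℝ

/-- The coordinate expression of a form in the preferred chart at `x₀`: its pullback under the
inverse of that chart. -/
def Form.inChart {k : ℕ} (θ : Form m M k) (x₀ : M) :
    EuclideanSpace ℝ (Fin (m + 1)) → EuclideanSpace ℝ (Fin (m + 1)) [⋀^Fin k]→L[ℝ] ℝ :=
  fun y => (θ ((extChartAt (𝓡 (m + 1)) x₀).symm y)).compContinuousLinearMap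
    (mfderiv 𝓘(ℝ, EuclideanSpace ℝ (Fin (m + 1))) (𝓡 (m + 1))
      (extChartAt (𝓡 (m + 1)) x₀).symm y)

/-- The exterior derivative on `M`: at `x`, it is computed in the preferred chart at `x`. -/
def Form.extDeriv {k : ℕ} (θ : Form m M k) : Form m M (k + 1) :=
  fun x => (_root_.extDeriv (θ.inChart x) (extChartAt (𝓡 (m + 1)) x x)).compContinuousLinearMap
    (mfderiv (𝓡 (m + 1)) 𝓘(ℝ, EuclideanSpace ℝ (Fin (m + 1))) (extChartAt (𝓡 (m + 1)) x) x)

/-- Contraction `ι_v α = α(v, ·, …, ·)` of an alternating form with a vector. -/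
def contract {x : M} {k : ℕ} (v : TangentSpace (𝓡 (m + 1)) x)
    (α : TangentSpace (𝓡 (m + 1)) x [⋀^Fin (k + 1)]→L[ℝ] ℝ) :
    TangentSpace (𝓡 (m + 1)) x [⋀^Fin k]→L[ℝ] ℝ :=
  { α.toAlternatingMap.curryLeft v with
    cont := α.cont.comp (continuous_const.finCons continuous_id) }

/-- `η ∧ (ι_v α) = η(v) α` for a `1`-form `η` and a form `α` of top degree; the left-hand side is
`(w₀, …, w_m) ↦ ∑ᵢ (-1)ⁱ η(wᵢ) (ι_v α)(w₀, …, ŵᵢ, …, w_m)`. -/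
theorem wedge_contract {x : M} (η : TangentSpace (𝓡 (m + 1)) x →L[ℝ] ℝ)
    (v : TangentSpace (𝓡 (m + 1)) x)
    (α : TangentSpace (𝓡 (m + 1)) x [⋀^Fin (m + 1)]→L[ℝ] ℝ) :
    AlternatingMap.alternatizeUncurryFin
      (η.toLinearMap.smulRight (contract v α).toAlternatingMap) = η v • α.toAlternatingMap := by
  ext w
  have key : AlternatingMap.alternatizeUncurryFin (η.toLinearMap.smulRight α.toAlternatingMap)
      (Fin.cons v w) = 0 := by
    apply AlternatingMap.map_linearDependent
    intro h
    have : Module.Finite ℝ (TangentSpace (𝓡 (m + 1)) x) :=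
      inferInstanceAs (Module.Finite ℝ (EuclideanSpace ℝ (Fin (m + 1))))
    have h1 := h.fintype_card_le_finrank
    have h2 : Module.finrank ℝ (TangentSpace (𝓡 (m + 1)) x) = m + 1 :=
      finrank_euclideanSpace_fin (𝕜 := ℝ) (n := m + 1)
    rw [h2] at h1
    simp at h1
  rw [AlternatingMap.alternatizeUncurryFin_apply, Fin.sum_univ_succ] at key
  rw [AlternatingMap.alternatizeUncurryFin_apply]
  have hc : ∀ i : Fin (m + 1), (contract v α).toAlternatingMap (i.removeNth w) =
      α.toAlternatingMap (i.succ.removeNth (Fin.cons v w : Fin (m + 2) → _)) := by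
    intro i
    have : (i.succ.removeNth (Fin.cons v w : Fin (m + 2) → TangentSpace (𝓡 (m + 1)) x)) =
        Fin.cons v (i.removeNth w) := by
      funext j
      refine Fin.cases ?_ (fun j => ?_) j <;> simp [Fin.removeNth]
    rw [this]
    rfl
  simp only [LinearMap.smulRight_apply, AlternatingMap.smul_apply, hc,
    ContinuousLinearMap.coe_coe]
  simp only [Fin.val_zero, pow_zero, one_smul, LinearMap.smulRight_apply,
    AlternatingMap.smul_apply, Fin.cons_zero, Fin.cons_succ, Fin.val_succ, pow_succ, mul_neg,
    mul_one, neg_smul, Finset.sum_neg_distrib, Fin.removeNth_zero, Fin.tail_cons,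
    ContinuousLinearMap.coe_coe] at key
  linarith [key]

/-- A background volume form: a smooth, nowhere vanishing form of top degree. -/
structure VolumeForm (m : ℕ) (M : Type*) [TopologicalSpace M]
    [ChartedSpace (EuclideanSpace ℝ (Fin (m + 1))) M] where
  form : Form m M (m + 1)
  ne_zero : ∀ x, form x ≠ 0
  smooth : ∀ x₀, ContDiffOn ℝ ∞ (form.inChart x₀) (extChartAt (𝓡 (m + 1)) x₀).target

/-! ### Subriemannian metrics -/

/-- A subriemannian metric: a smooth family of symmetric nonnegative bilinear forms on the
cotangent spaces of `M`. Smoothness means that `⟨df, dh⟩` is smooth for all smooth functions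
`f, h` given on an open set (equivalently, all `g^{ij} = ⟨dxⁱ, dxʲ⟩` are smooth in coordinates). -/
structure CoMetric (m : ℕ) (M : Type*) [TopologicalSpace M]
    [ChartedSpace (EuclideanSpace ℝ (Fin (m + 1))) M] where
  inner : Π x : M, LinearMap.BilinForm ℝ (TangentSpace (𝓡 (m + 1)) x →L[ℝ] ℝ)
  symm : ∀ x θ η, inner x θ η = inner x η θ
  nonneg : ∀ x θ, 0 ≤ inner x θ θ
  smooth : ∀ (U : Set M) (f h : M → ℝ), IsOpen U →
    ContMDiffOn (𝓡 (m + 1)) 𝓘(ℝ, ℝ) ∞ f U → ContMDiffOn (𝓡 (m + 1)) 𝓘(ℝ, ℝ) ∞ h U →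
    ContMDiffOn (𝓡 (m + 1)) 𝓘(ℝ, ℝ) ∞ (fun x => inner x (differential f x) (differential h x)) U

namespace CoMetric

variable (g : CoMetric m M)

/-- `|θ|_* = ⟨θ, θ⟩^{1/2}`. -/
def norm {x : M} (θ : TangentSpace (𝓡 (m + 1)) x →L[ℝ] ℝ) : ℝ :=
  √(g.inner x θ θ)

/-- The bundle morphism `G : T*M → TM` determined by `θ (G η) = ⟨θ, η⟩` (see `apply_G`). -/
def G (x : M) : (TangentSpace (𝓡 (m + 1)) x →L[ℝ] ℝ) →ₗ[ℝ] TangentSpace (𝓡 (m + 1)) x :=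
  raise (g.inner x)

theorem apply_G (x : M) (θ η : TangentSpace (𝓡 (m + 1)) x →L[ℝ] ℝ) :
    θ (g.G x η) = g.inner x θ η :=
  apply_raise (g.inner x) θ η

/-- The horizontal distribution `ξ = Range G`. -/
def horizontal (x : M) : Submodule ℝ (TangentSpace (𝓡 (m + 1)) x) :=
  LinearMap.range (g.G x)

/-- The interior product `θ ⌟ dv` of a `1`-form with a volume form, with respect to the metric,
i.e. the form with `η ∧ (θ ⌟ dv) = ⟨η, θ⟩ dv` for all `η` (see `wedge_interior`). -/
def interior {x : M} (θ : TangentSpace (𝓡 (m + 1)) x →L[ℝ] ℝ)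
    (α : TangentSpace (𝓡 (m + 1)) x [⋀^Fin (m + 1)]→L[ℝ] ℝ) :
    TangentSpace (𝓡 (m + 1)) x [⋀^Fin m]→L[ℝ] ℝ :=
  contract (g.G x θ) α

theorem wedge_interior {x : M} (η θ : TangentSpace (𝓡 (m + 1)) x →L[ℝ] ℝ)
    (α : TangentSpace (𝓡 (m + 1)) x [⋀^Fin (m + 1)]→L[ℝ] ℝ) :
    AlternatingMap.alternatizeUncurryFin
      (η.toLinearMap.smulRight (g.interior θ α).toAlternatingMap) =
        g.inner x η θ • α.toAlternatingMap := by
  rw [interior, wedge_contract, apply_G]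

/-- The `m`-form `(dφ / |dφ|_*^{1-p}) ⌟ dv`. -/
def areaForm (dv : VolumeForm m M) (p : ℝ) (φ : M → ℝ) : Form m M m :=
  fun x => g.interior ((g.norm (differential φ x) ^ (1 - p))⁻¹ • differential φ x) (dv.form x)

/-- The generalized mean curvature (`p`-sublaplacian) `H_{φ,p}`, i.e. the function with
`d ((dφ / |dφ|_*^{1-p}) ⌟ dv) = H_{φ,p} dv` (see `extDeriv_areaForm`): the ratio of these two forms
of top degree, evaluated on a basis. -/
def meanCurvature (dv : VolumeForm m M) (p : ℝ) (φ : M → ℝ) (x : M) : ℝ :=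
  (g.areaForm dv p φ).extDeriv x (EuclideanSpace.basisFun (Fin (m + 1)) ℝ) /
    dv.form x (EuclideanSpace.basisFun (Fin (m + 1)) ℝ)

theorem extDeriv_areaForm (dv : VolumeForm m M) (p : ℝ) (φ : M → ℝ) (x : M) :
    (g.areaForm dv p φ).extDeriv x = g.meanCurvature dv p φ x • dv.form x := by
  have key : ∀ α : EuclideanSpace ℝ (Fin (m + 1)) [⋀^Fin (m + 1)]→L[ℝ] ℝ,
      α.toAlternatingMap = α (EuclideanSpace.basisFun (Fin (m + 1)) ℝ) •
        (EuclideanSpace.basisFun (Fin (m + 1)) ℝ).toBasis.det := by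
    intro α
    simpa using α.toAlternatingMap.eq_smul_basis_det
      (EuclideanSpace.basisFun (Fin (m + 1)) ℝ).toBasis
  have key' : ∀ α β : EuclideanSpace ℝ (Fin (m + 1)) [⋀^Fin (m + 1)]→L[ℝ] ℝ, β ≠ 0 →
      α = (α (EuclideanSpace.basisFun (Fin (m + 1)) ℝ) /
        β (EuclideanSpace.basisFun (Fin (m + 1)) ℝ)) • β := by
    intro α β hβ
    have hβ' : β (EuclideanSpace.basisFun (Fin (m + 1)) ℝ) ≠ 0 := by
      intro h0
      apply hβ
      apply ContinuousAlternatingMap.toAlternatingMap_injective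
      rw [key β, h0, zero_smul]
      rfl
    apply ContinuousAlternatingMap.toAlternatingMap_injective
    rw [ContinuousAlternatingMap.toAlternatingMap_smul, key β, smul_smul,
      div_mul_cancel₀ _ hβ', key α]
  exact key' _ _ (dv.ne_zero x)

end CoMetric

/-! ### The Lie module generated by vector fields -/

/-- Membership in `£(X₁, …, X_r)` on the open set `U`: the smallest `C^∞(U)`-module of vector
fields which contains `X₁, …, X_r` and is closed under the Lie bracket. -/
inductive LieSpan (U : Set M) {r : ℕ} (X : Fin r → Π x : M, TangentSpace (𝓡 (m + 1)) x) :
    (Π x : M, TangentSpace (𝓡 (m + 1)) x) → Prop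
  | gen (i : Fin r) : LieSpan U X (X i)
  | zero : LieSpan U X 0
  | add {V W : Π x : M, TangentSpace (𝓡 (m + 1)) x} :
      LieSpan U X V → LieSpan U X W → LieSpan U X (V + W)
  | smul {V : Π x : M, TangentSpace (𝓡 (m + 1)) x} (f : M → ℝ) :
      ContMDiffOn (𝓡 (m + 1)) 𝓘(ℝ, ℝ) ∞ f U → LieSpan U X V → LieSpan U X (fun x => f x • V x)
  | bracket {V W : Π x : M, TangentSpace (𝓡 (m + 1)) x} :
      LieSpan U X V → LieSpan U X W →
        LieSpan U X (VectorField.mlieBracket (𝓡 (m + 1)) V W)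

/-- The rank of `£(X₁, …, X_r)` at `x`: the dimension of the span of all `Z x`, `Z ∈ £`. -/
def lieRank (U : Set M) {r : ℕ} (X : Fin r → Π x : M, TangentSpace (𝓡 (m + 1)) x) (x : M) : ℕ :=
  Module.finrank ℝ
    (Submodule.span ℝ {v : TangentSpace (𝓡 (m + 1)) x | ∃ Z, LieSpan U X Z ∧ Z x = v})

/-- `rank £(D) = k` along `S` near `p₀`, for a distribution `D` along `S ⊆ M`: here
`£(D) = £(X₁, …, X_r)`, where `X₁, …, X_r` are smooth vector fields near `p₀` which form a basis of
`D` at the points of `S`. If `S` is a hypersurface and `D ⊆ TS`, the restriction of `£(D)` to `S`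
depends only on the restrictions of the `Xᵢ` to `S`. -/
def HasLieRankNear [IsManifold (𝓡 (m + 1)) ∞ M] (p₀ : M) (S : Set M)
    (D : Π x : M, Submodule ℝ (TangentSpace (𝓡 (m + 1)) x)) (k : ℕ) : Prop :=
  ∃ (U : Set M) (r : ℕ) (X : Fin r → Π x : M, TangentSpace (𝓡 (m + 1)) x),
    IsOpen U ∧ p₀ ∈ U ∧ (∀ i, SmoothFieldOn U (X i)) ∧
    (∀ x ∈ U ∩ S, LinearIndependent ℝ (fun i => X i x) ∧
      Submodule.span ℝ (Set.range fun i => X i x) = D x) ∧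
    ∀ x ∈ U ∩ S, lieRank U X x = k

/-! ### Lower order terms -/

/-- Smoothness on `U` of a function `b(x, z, q)` of `x ∈ M`, `z ∈ ℝ`, `q ∈ T*_x M`: it is smooth in
all variables when written in coordinates, `q` being given by its components in a chart. -/
def SmoothLowerOrderOn (U : Set M)
    (b : Π x : M, ℝ → (TangentSpace (𝓡 (m + 1)) x →L[ℝ] ℝ) → ℝ) : Prop :=
  ∀ x₀ : M, ContDiffOn ℝ ∞
    (fun w : EuclideanSpace ℝ (Fin (m + 1)) × ℝ × (EuclideanSpace ℝ (Fin (m + 1)) →L[ℝ] ℝ) =>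
      b ((extChartAt (𝓡 (m + 1)) x₀).symm w.1) w.2.1
        (w.2.2.comp (mfderiv (𝓡 (m + 1)) 𝓘(ℝ, EuclideanSpace ℝ (Fin (m + 1)))
          (extChartAt (𝓡 (m + 1)) x₀) ((extChartAt (𝓡 (m + 1)) x₀).symm w.1))))
    (((extChartAt (𝓡 (m + 1)) x₀).target ∩ (extChartAt (𝓡 (m + 1)) x₀).symm ⁻¹' U) ×ˢ
      (Set.univ : Set (ℝ × (EuclideanSpace ℝ (Fin (m + 1)) →L[ℝ] ℝ))))

end Basics

end Subriemannian

end

open Subriemannian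

/-! ### Sets invariant under flows -/

/-! Put `u = ψ - φ ≥ 0` and work in the chart at `p₀`, where the mean curvature becomes the weighted
divergence `ρ⁻¹ div (ρ |dφ|^{p-1} A dφ)` (`meanCurvature_eq`). At a zero of `u` the differentials of
`φ` and `ψ` agree, so near `p₀` the difference of the two quasilinear operators leaves a linear
inequality `tr (a D²u) ≤ K (|Du| + |u|)` with `a = |dφ|^{p-1} (A + (p-1) |dφ|⁻² A dφ ⊗ A dφ)`
(`exists_contraction_le`). By Cauchy–Schwarz `a ≥ 0`. A null direction of `a` is orthogonal to every
`A η` if `p > 0`, and to those with `dφ (A η) = 0` if `p = 0`.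

As `a` is degenerate, the maximum principle has to be propagated along vector fields, by Bony's
method. If a ball touches the contact set `F = {u = 0}` at `x`, with normal `ν`, then Hopf's
exponential barrier gives `a(ν, ν) = 0` (`sum_eq_zero_of_normal`), so `ν` is orthogonal to the
horizontal vectors just described (`eventually_inner_eq_zero_of_normal`). A Lipschitz field
orthogonal to all such normals has a flow that preserves `F` (`TangentTo.integralCurve_mem`), and
the commutator of two such flows shows that brackets are orthogonal to the normals as well
(`TangentTo.lieBracket`). Hence all of `£` is.

For (b), `£` spans the whole tangent space. If `x` is a point of `F` nearest to `q`, then `q - x` is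
orthogonal to everything, so `q = x ∈ F`.

For (a), only horizontal fields tangent to the levels of `φ` are available. Their integral curves
starting on `F ∩ Σ₁` stay in it, so this set takes the place of `F`, and `£` spans `TΣ₁`. For `q ∈
Σ₁` with nearest point `x`, the vector `q - x` is then normal to `Σ₁` at `x`, which is impossible
for distinct nearby points of a hypersurface (`eventually_eq_of_normal`). So `ψ = 0` on `Σ₁`.
Conversely `Σ₂ ⊆ Σ₁`, because `φ` and `ψ` both increase along a common transversal direction
(`eventually_eq_zero_of_le`). -/

section Invariance

variable {E : Type*} [NormedAddCommGroup E] [InnerProductSpace ℝ E]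

/-- A vector field is tangent to `F` in `O` if it is orthogonal to all proximal normals of `F` at
the points of `F ∩ O`, i.e. to `z - x` whenever `x` is a point of `F` closest to `z`. -/
def TangentTo (F O : Set E) (V : E → E) : Prop :=
  ∀ x ∈ F ∩ O, ∀ z, (∀ y ∈ F, dist x z ≤ dist y z) → inner ℝ (V x) (z - x) = 0

theorem TangentTo.neg {F O : Set E} {V : E → E} (h : TangentTo F O V) :
    TangentTo F O (-V) := fun x hx z hz => by
  simp [inner_neg_left, h x hx z hz]

theorem TangentTo.add {F O : Set E} {V W : E → E} (h : TangentTo F O V) (h' : TangentTo F O W) :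
    TangentTo F O (V + W) := fun x hx z hz => by
  simp [inner_add_left, h x hx z hz, h' x hx z hz]

theorem TangentTo.smul {F O : Set E} {V : E → E} (h : TangentTo F O V) (f : E → ℝ) :
    TangentTo F O (fun x => f x • V x) := fun x hx z hz => by
  simp [inner_smul_left, h x hx z hz]

theorem TangentTo.congr {F O : Set E} {V W : E → E} (h : TangentTo F O V)
    (hVW : EqOn V W (F ∩ O)) : TangentTo F O W := fun x hx z hz => by
  rw [← hVW hx, h x hx z hz]

/-- Near a point, the integral curves of a `C¹` vector field exist for a uniform time and stay in a
given neighbourhood. -/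
theorem exists_integralCurve_mem {E : Type*} [NormedAddCommGroup E] [NormedSpace ℝ E]
    [CompleteSpace E] {V : E → E} {x₀ : E}
    (hV : ContDiffAt ℝ 1 V x₀) {s : Set E} (hs : s ∈ 𝓝 x₀) :
    ∃ δ > (0 : ℝ), ∀ y ∈ Metric.ball x₀ δ, ∃ γ : ℝ → E, γ 0 = y ∧
      ∀ t ∈ Ioo (-δ) δ, HasDerivAt γ (V (γ t)) t ∧ γ t ∈ s := by
  obtain ⟨ε, hε, a, r, L, K, hr, hpl⟩ := IsPicardLindelof.of_contDiffAt_one hV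
  obtain ⟨a₁, ha₁, ha₁s⟩ := Metric.nhds_basis_closedBall.mem_iff.1 hs
  have hra : r ≤ a := by
    have := (hpl 0).mul_max_le
    have h2 : (0 : ℝ) ≤ L * max (0 + ε - (0 : ℝ)) (0 - (0 - ε)) :=
      mul_nonneg L.2 (le_max_of_le_left (by linarith))
    exact_mod_cast sub_nonneg.1 (h2.trans this)
  have ha : 0 < a := hr.trans_le hra
  -- Curves confined to the ball of radius `a'` lie in `s`; starting points within `a' / 2` leave
  -- them room for a uniform time.
  set a' : NNReal := min a ⟨a₁, ha₁.le⟩ with ha'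
  have ha'0 : 0 < a' := lt_min ha ha₁
  obtain ⟨ε', hε', H⟩ := (hpl 0).exists_shrink_radius hε (a' := a') (r' := a' / 2) (min_le_left _ _)
    (by exact NNReal.half_lt_self ha'0.ne')
  refine ⟨min ε' (a' / 2), lt_min hε' (by positivity), fun y hy => ?_⟩
  have hy' : y ∈ Metric.closedBall x₀ ((a' / 2 : NNReal) : ℝ) := by
    rw [Metric.mem_closedBall]
    push_cast
    exact (Metric.mem_ball.1 hy).le.trans (min_le_right _ _)
  -- The fixed point of the Picard map gives both the differential equation and the confinement to
  -- the ball of radius `a'`.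
  obtain ⟨α, hα⟩ := ODE.FunSpace.exists_isFixedPt_next H hy'
  refine ⟨α.compProj, ?_, fun t ht => ⟨?_, ?_⟩⟩
  · have := ODE.FunSpace.compProj_val (α := α)
      (t := (⟨0, by simp [hε'.le]⟩ : Icc (0 - ε') (0 + ε')))
    refine this.trans ?_
    rw [← hα, ODE.FunSpace.next_apply₀]
  · have ht' : t ∈ Ioo (0 - ε') (0 + ε') := by
      constructor
      · have := ht.1
        have h2 := min_le_left ε' (a' / 2)
        linarith
      · have := ht.2
        have h2 := min_le_left ε' (a' / 2)
        linarith
    have h1 := ODE.hasDerivWithinAt_picard_Icc (t₀ := 0) (f := fun _ => V) (by simp [hε'.le])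
      H.continuousOn_uncurry
      α.continuous_compProj.continuousOn
      (fun _ _ => α.compProj_mem_closedBall H.mul_max_le) y (Ioo_subset_Icc_self ht')
    have h2 := h1.congr_of_mem (f₁ := α.compProj) ?_ (Ioo_subset_Icc_self ht')
    · exact h2.hasDerivAt (Icc_mem_nhds ht'.1 ht'.2)
    · intro t' ht'
      nth_rw 1 [← hα]
      rw [ODE.FunSpace.compProj_of_mem ht', ODE.FunSpace.next_apply]
  · apply ha₁s
    refine Metric.closedBall_subset_closedBall ?_ (α.compProj_mem_closedBall H.mul_max_le)
    exact_mod_cast min_le_right a ⟨a₁, ha₁.le⟩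

/-- Second order Taylor expansion of integral curves, uniformly in the initial point. -/
theorem exists_integralCurve_taylor {E : Type*} [NormedAddCommGroup E] [NormedSpace ℝ E]
    {V : E → E} {x₀ : E} (hV : ContDiffAt ℝ 2 V x₀) :
    ∃ s ∈ 𝓝 x₀, ∃ C : ℝ, ∀ (γ : ℝ → E) (δ : ℝ),
      (∀ t ∈ Ioo (-δ) δ, HasDerivAt γ (V (γ t)) t ∧ γ t ∈ s) → ∀ t ∈ Ioo (-δ) δ,
      ‖γ t - γ 0 - t • V (γ 0) - (t ^ 2 / 2) • fderiv ℝ V (γ 0) (V (γ 0))‖ ≤ C * |t| ^ 3 := by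
  have hV2 : ContDiffAt ℝ 1 (fun y => fderiv ℝ V y (V y)) x₀ :=
    (hV.fderiv_right (m := 1) (by norm_num)).clm_apply (hV.of_le (by norm_num))
  obtain ⟨K, s₁, hs₁, hK⟩ := hV2.exists_lipschitzOnWith
  have hd : ∀ᶠ y in 𝓝 x₀, DifferentiableAt ℝ V y :=
    (hV.eventually (by simp)).mono fun y hy => hy.differentiableAt (by norm_num)
  have hb : ∀ᶠ y in 𝓝 x₀, ‖V y‖ < ‖V x₀‖ + 1 :=
    hV.continuousAt.norm.eventually_lt_const (by linarith)
  -- The second derivative of `γ` is `DV(γ) V(γ)`, whose variation is at most `K` times the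
  -- displacement of `γ`, itself at most `(‖V x₀‖ + 1) |t|`. Two applications of the mean value
  -- inequality then produce the cube and this constant.
  refine ⟨s₁ ∩ ({y | DifferentiableAt ℝ V y} ∩ {y | ‖V y‖ < ‖V x₀‖ + 1}),
    inter_mem hs₁ (inter_mem hd hb), K * (‖V x₀‖ + 1), fun γ δ hγ t ht => ?_⟩
  set M := ‖V x₀‖ + 1
  have hM : 0 ≤ M := by positivity
  have h0 : (0 : ℝ) ∈ Ioo (-δ) δ := by
    have := ht.1.trans ht.2
    constructor <;> linarith
  have hsub : uIcc 0 t ⊆ Ioo (-δ) δ := (convex_Ioo (-δ) δ).ordConnected.uIcc_subset h0 ht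
  have habs : ∀ s ∈ uIcc 0 t, |s| ≤ |t| := fun s hs => by
    simpa using abs_sub_left_of_mem_uIcc hs
  have hconv : Convex ℝ (uIcc 0 t) := convex_uIcc 0 t
  have hA : ∀ s ∈ uIcc 0 t, ‖γ s - γ 0‖ ≤ M * |t| := fun s hs => by
    have := hconv.norm_image_sub_le_of_norm_hasDerivWithin_le (f := γ) (C := M)
      (fun s hs => (hγ s (hsub hs)).1.hasDerivWithinAt)
      (fun s hs => (hγ s (hsub hs)).2.2.2.le) left_mem_uIcc hs
    refine this.trans ?_
    simpa using mul_le_mul_of_nonneg_left (habs s hs) hM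
  have hB : ∀ s ∈ uIcc 0 t,
      ‖V (γ s) - V (γ 0) - s • fderiv ℝ V (γ 0) (V (γ 0))‖ ≤ K * (M * |t|) * |t| := fun s hs => by
    have := hconv.norm_image_sub_le_of_norm_hasDerivWithin_le
      (f := fun s => V (γ s) - V (γ 0) - s • fderiv ℝ V (γ 0) (V (γ 0))) (C := K * (M * |t|))
      (f' := fun s => fderiv ℝ V (γ s) (V (γ s)) - (1 : ℝ) • fderiv ℝ V (γ 0) (V (γ 0)))
      (fun s hs => by
        have h1 := (hγ s (hsub hs)).2.2.1.hasFDerivAt.comp_hasDerivAt s (hγ s (hsub hs)).1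
        exact ((h1.sub_const _).sub ((hasDerivAt_id s).smul_const _)).hasDerivWithinAt)
      (fun s hs => by
        rw [one_smul]
        refine (hK.norm_sub_le (hγ s (hsub hs)).2.1 (hγ 0 h0).2.1).trans ?_
        exact mul_le_mul_of_nonneg_left (hA s hs) K.2) left_mem_uIcc hs
    simp only [zero_smul, sub_zero, sub_self, Real.norm_eq_abs] at this
    exact this.trans (mul_le_mul_of_nonneg_left (habs s hs) (by positivity))
  have := hconv.norm_image_sub_le_of_norm_hasDerivWithin_le
    (f := fun s => γ s - γ 0 - s • V (γ 0) - (s ^ 2 / 2) • fderiv ℝ V (γ 0) (V (γ 0)))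
    (C := K * (M * |t|) * |t|)
    (f' := fun s => V (γ s) - V (γ 0) - s • fderiv ℝ V (γ 0) (V (γ 0)))
    (fun s hs => by
      have h1 := ((hγ s (hsub hs)).1.sub_const (γ 0)).sub ((hasDerivAt_id s).smul_const (V (γ 0)))
      have h2 := (((hasDerivAt_id s).pow 2).div_const 2).smul_const
        (fderiv ℝ V (γ 0) (V (γ 0)))
      have h3 := h1.sub h2
      refine (h3.congr_deriv ?_).hasDerivWithinAt
      simp) hB left_mem_uIcc right_mem_uIcc
  simp only [zero_smul, sub_zero, sub_self, Real.norm_eq_abs, ne_eq, OfNat.ofNat_ne_zero,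
    not_false_eq_true, zero_pow, zero_div] at this
  calc _ ≤ _ := this
    _ = _ := by ring

/-- Gronwall's inequality for the squared distance to `F`. If `f` is a point of `F` nearest to `γ
τ`, then `γ τ - f` is a proximal normal, so `⟨γ τ - f, V (γ τ)⟩ = ⟨γ τ - f, V (γ τ) - V f⟩ ≤ K
dist²`. Since `infDist (γ z) F ≤ ‖γ z - f‖` with equality at `τ`, the squared distance grows at rate
at most `2K` times itself. -/
theorem TangentTo.integralCurve_mem_of_nonneg [ProperSpace E] {F : Set E} (hF : IsClosed F)
    {V : E → E} {x₀ : E} {r : ℝ} {K : NNReal}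
    (hV : TangentTo F (Metric.ball x₀ (3 * r)) V)
    (hK : LipschitzOnWith K V (Metric.ball x₀ (3 * r))) {γ : ℝ → E} {T : ℝ} (h0 : γ 0 ∈ F)
    (hγ : ∀ t ∈ Icc 0 T, HasDerivAt γ (V (γ t)) t ∧ γ t ∈ Metric.ball x₀ r) :
    ∀ t ∈ Icc 0 T, γ t ∈ F := by
  intro t ht
  have hFne : F.Nonempty := ⟨_, h0⟩
  have hcont : ContinuousOn (fun t => Metric.infDist (γ t) F ^ 2) (Icc 0 T) := by
    have : ContinuousOn γ (Icc 0 T) := fun t ht => (hγ t ht).1.continuousAt.continuousWithinAt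
    exact ((Metric.continuous_infDist_pt F).comp_continuousOn this).pow 2
  have h00 : (0 : ℝ) ∈ Icc 0 T := ⟨le_rfl, ht.1.trans ht.2⟩
  have key := le_gronwallBound_of_liminf_deriv_right_le (δ := 0) (K := 2 * K) (ε := 0)
    (f' := fun t => 2 * K * Metric.infDist (γ t) F ^ 2) hcont ?_ ?_ ?_ t ht
  · rw [gronwallBound_ε0_δ0] at key
    rw [hF.mem_iff_infDist_zero hFne]
    exact pow_eq_zero_iff (two_ne_zero) |>.1 (le_antisymm key (sq_nonneg _))
  · intro τ hτ ρ hρ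
    obtain ⟨f, hf, hfd⟩ := hF.exists_infDist_eq_dist hFne (γ τ)
    obtain ⟨hγd, hγm⟩ := hγ τ (Ico_subset_Icc_self hτ)
    have hmin : ∀ y ∈ F, dist f (γ τ) ≤ dist y (γ τ) := fun y hy => by
      rw [dist_comm f, ← hfd, dist_comm y]
      exact Metric.infDist_le_dist_of_mem hy
    -- The nearest point is no farther from `γ τ` than `γ 0` is, hence within `2r` of it: this is
    -- why tangency is needed on the ball of radius `3r`.
    have hfm : f ∈ Metric.ball x₀ (3 * r) := by
      have h1 := hmin _ h0
      have h2 := dist_triangle_right (γ 0) (γ τ) x₀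
      have h3 := dist_triangle f (γ τ) x₀
      have h4 := (hγ 0 h00).2
      rw [Metric.mem_ball] at h4 hγm ⊢
      linarith
    have hγm' : γ τ ∈ Metric.ball x₀ (3 * r) := by
      rw [Metric.mem_ball] at hγm ⊢
      have := dist_nonneg.trans_lt hγm
      linarith
    have hd : HasDerivAt (fun z => ‖γ z - f‖ ^ 2) (2 * inner ℝ (γ τ - f) (V (γ τ))) τ :=
      (hγd.sub_const f).norm_sq
    have hle : 2 * inner ℝ (γ τ - f) (V (γ τ)) ≤ 2 * K * Metric.infDist (γ τ) F ^ 2 := by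
      have h1 : inner ℝ (γ τ - f) (V (γ τ)) = inner ℝ (γ τ - f) (V (γ τ) - V f) := by
        have := hV f ⟨hf, hfm⟩ (γ τ) hmin
        rw [inner_sub_right, real_inner_comm (V f), this, sub_zero]
      have h2 := real_inner_le_norm (γ τ - f) (V (γ τ) - V f)
      have h3 := hK.norm_sub_le hγm' hfm
      rw [hfd, dist_eq_norm, h1]
      nlinarith [norm_nonneg (γ τ - f)]
    have hslope := hasDerivAt_iff_tendsto_slope.1 hd
    have hev : ∀ᶠ z in 𝓝[>] τ, slope (fun z => ‖γ z - f‖ ^ 2) τ z < ρ :=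
      (hslope.mono_left (nhdsWithin_mono _ (fun z hz => ne_of_gt hz))).eventually_lt_const
        (hle.trans_lt hρ)
    refine (Eventually.frequently (f := 𝓝[>] τ) ?_)
    filter_upwards [hev, self_mem_nhdsWithin] with z hz hzτ
    refine lt_of_le_of_lt ?_ hz
    rw [slope_def_field, div_eq_inv_mul]
    have hpos : 0 ≤ (z - τ)⁻¹ := inv_nonneg.2 (sub_nonneg.2 (le_of_lt hzτ))
    refine mul_le_mul_of_nonneg_left ?_ hpos
    have h5 : Metric.infDist (γ z) F ≤ ‖γ z - f‖ := by
      rw [← dist_eq_norm]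
      exact Metric.infDist_le_dist_of_mem hf
    rw [hfd, dist_eq_norm]
    have := pow_le_pow_left₀ Metric.infDist_nonneg h5 2
    linarith
  · simp [Metric.infDist_zero_of_mem h0]
  · intro x _
    simp

/-- A closed set is invariant under the flow of the vector fields tangent to it. -/
theorem TangentTo.integralCurve_mem [ProperSpace E] {F O : Set E} (hF : IsClosed F)
    {V : E → E} (hV : TangentTo F O V) {x₀ : E} (hO : O ∈ 𝓝 x₀) (hV1 : ContDiffAt ℝ 1 V x₀) :
    ∃ s ∈ 𝓝 x₀, ∀ (γ : ℝ → E) (δ : ℝ), γ 0 ∈ F →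
      (∀ t ∈ Ioo (-δ) δ, HasDerivAt γ (V (γ t)) t ∧ γ t ∈ s) → ∀ t ∈ Ioo (-δ) δ, γ t ∈ F := by
  obtain ⟨K, s₁, hs₁, hK⟩ := hV1.exists_lipschitzOnWith
  obtain ⟨R, hR, hRs⟩ := Metric.nhds_basis_ball.mem_iff.1 (inter_mem hO hs₁)
  refine ⟨Metric.ball x₀ (R / 3), Metric.ball_mem_nhds _ (by positivity), fun γ δ h0 hγ t ht => ?_⟩
  have e : 3 * (R / 3) = R := by ring
  have hVt : TangentTo F (Metric.ball x₀ (3 * (R / 3))) V := fun x hx =>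
    hV x ⟨hx.1, (hRs (by simpa only [e] using hx.2)).1⟩
  have hVK : LipschitzOnWith K V (Metric.ball x₀ (3 * (R / 3))) :=
    hK.mono fun x hx => (hRs (by simpa only [e] using hx)).2
  rcases le_total 0 t with h | h
  · refine hVt.integralCurve_mem_of_nonneg hF hVK h0 (T := t) (fun τ hτ => hγ τ ⟨?_, ?_⟩) t
      ⟨h, le_rfl⟩
    · linarith [hτ.1, ht.1, ht.2]
    · linarith [hτ.2, ht.2]
  -- Negative times: the reversed curve integrates `-V`, which is tangent too because tangency is an
  -- equality.
  · have := hVt.neg.integralCurve_mem_of_nonneg hF hVK.neg (γ := fun τ => γ (-τ)) (T := -t)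
      (by simpa using h0) (fun τ hτ => ?_) (-t) ⟨by linarith, le_rfl⟩
    · simpa using this
    · have hm : -τ ∈ Ioo (-δ) δ := ⟨by linarith [hτ.2, ht.1], by linarith [hτ.1, ht.1, ht.2]⟩
      obtain ⟨h1, h2⟩ := hγ _ hm
      refine ⟨?_, h2⟩
      have := h1.scomp τ (hasDerivAt_neg τ)
      simpa using! this

/-- A vector field is tangent to a set at the points where its integral curve stays in the set. -/
theorem inner_eq_zero_of_integralCurve_mem {F : Set E} {γ : ℝ → E} {v x z : E}
    (hγ : HasDerivAt γ v 0) (h0 : γ 0 = x) (hF : ∀ᶠ t in 𝓝 (0 : ℝ), γ t ∈ F)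
    (hz : ∀ y ∈ F, dist x z ≤ dist y z) : inner ℝ v (z - x) = 0 := by
  have hd : HasDerivAt (fun t => ‖γ t - z‖ ^ 2) (2 * inner ℝ (γ 0 - z) v) 0 :=
    (hγ.sub_const z).norm_sq
  have hmin : IsLocalMin (fun t => ‖γ t - z‖ ^ 2) 0 := by
    filter_upwards [hF] with t ht
    have := hz _ ht
    rw [dist_eq_norm, dist_eq_norm] at this
    rw [h0]
    exact pow_le_pow_left₀ (norm_nonneg _) this 2
  have := hmin.hasDerivAt_eq_zero hd
  rw [h0] at this
  rw [← neg_sub x z, inner_neg_right, real_inner_comm]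
  linarith

end Invariance

/-! ### Lie brackets of fields tangent to a closed set. -/

section Bracket

variable {E : Type*} [NormedAddCommGroup E] [InnerProductSpace ℝ E] [ProperSpace E]

open Asymptotics

/-- Following a vector field tangent to `F` for time `t` from a point `c t = x + t A + t² B + o(t²)`
of `F`. -/
theorem TangentTo.exists_step {F O : Set E} (hF : IsClosed F) {V : E → E} (hV : TangentTo F O V)
    {x : E} (hO : O ∈ 𝓝 x) (hV2 : ContDiffAt ℝ 2 V x) {c : ℝ → E} {A B : E}
    (hc : ∀ᶠ t in 𝓝[>] (0 : ℝ), c t ∈ F)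
    (hco : (fun t => c t - (x + t • A + t ^ 2 • B)) =o[𝓝[>] (0 : ℝ)] fun t => t ^ 2) :
    ∃ c' : ℝ → E, (∀ᶠ t in 𝓝[>] (0 : ℝ), c' t ∈ F) ∧
      (fun t => c' t - (x + t • (A + V x) + t ^ 2 • (B + fderiv ℝ V x A +
        (1 / 2 : ℝ) • fderiv ℝ V x (V x)))) =o[𝓝[>] (0 : ℝ)] fun t => t ^ 2 := by
  have hV1 : ContDiffAt ℝ 1 V x := hV2.of_le (by norm_num)
  have : CompleteSpace E := inferInstance
  obtain ⟨s₁, hs₁, C, hC⟩ := exists_integralCurve_taylor hV2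
  obtain ⟨s₂, hs₂, hinv⟩ := hV.integralCurve_mem hF hO hV1
  obtain ⟨δ, hδ, H⟩ := exists_integralCurve_mem hV1 (inter_mem hs₁ hs₂)
  choose! γ hγ0 hγ using H
  have ht0 : Tendsto (fun t : ℝ => t) (𝓝[>] 0) (𝓝 0) := tendsto_id.mono_left nhdsWithin_le_nhds
  have hidpow : (fun t : ℝ => t ^ 2) =o[𝓝[>] 0] fun t => t := by
    simpa using! ((isLittleO_pow_pow (𝕜 := ℝ) (m := 1) (n := 2) (by norm_num)).mono
      (nhdsWithin_le_nhds (a := (0 : ℝ)) (s := Ioi 0)))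
  have hcA : (fun t => c t - x - t • A) =o[𝓝[>] (0 : ℝ)] fun t => t := by
    have h1 : (fun t : ℝ => t ^ 2 • B) =o[𝓝[>] 0] fun t => t := by
      have := hidpow.smul_isBigO (isBigO_refl (fun _ : ℝ => B) (𝓝[>] 0))
      refine this.trans_isBigO ?_
      refine IsBigO.of_bound ‖B‖ (Eventually.of_forall fun t => ?_)
      rw [norm_smul, mul_comm]
    refine ((hco.trans hidpow).add h1).congr_left fun t => ?_
    abel
  have hcx : (fun t => c t - x) =O[𝓝[>] (0 : ℝ)] fun t => t := by
    have h1 : (fun t : ℝ => t • A) =O[𝓝[>] 0] fun t => t :=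
      IsBigO.of_bound ‖A‖ (Eventually.of_forall fun t => by rw [norm_smul, mul_comm])
    refine (hcA.isBigO.add h1).congr_left fun t => ?_
    abel
  have hct : Tendsto c (𝓝[>] 0) (𝓝 x) := by
    have := (hcx.trans_tendsto ht0).add_const x
    simpa using this
  have hball : ∀ᶠ t in 𝓝[>] (0 : ℝ), c t ∈ Metric.ball x δ :=
    hct.eventually (Metric.ball_mem_nhds x hδ)
  have hsmall : ∀ᶠ t in 𝓝[>] (0 : ℝ), t ∈ Ioo (-δ) δ :=
    ht0.eventually (Ioo_mem_nhds (by linarith) hδ)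
  -- The integral curve starts at the moving point `c t`, hence the need for a Taylor bound uniform
  -- in the initial point.
  refine ⟨fun t => γ (c t) t, ?_, ?_⟩
  · filter_upwards [hc, hball, hsmall] with t h1 h2 h3
    exact hinv (γ (c t)) δ (by rwa [hγ0 _ h2])
      (fun τ hτ => ⟨(hγ _ h2 τ hτ).1, (hγ _ h2 τ hτ).2.2⟩) t h3
  · have e1 : (fun t => γ (c t) t - c t - t • V (c t) -
        (t ^ 2 / 2) • fderiv ℝ V (c t) (V (c t))) =o[𝓝[>] (0 : ℝ)] fun t => t ^ 2 := by
      have : (fun t => γ (c t) t - c t - t • V (c t) -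
        (t ^ 2 / 2) • fderiv ℝ V (c t) (V (c t))) =O[𝓝[>] (0 : ℝ)] fun t => t ^ 3 := by
        refine IsBigO.of_bound C ?_
        filter_upwards [hball, hsmall] with t h2 h3
        have := hC (γ (c t)) δ (fun τ hτ => ⟨(hγ _ h2 τ hτ).1, (hγ _ h2 τ hτ).2.1⟩) t h3
        rw [hγ0 _ h2] at this
        simpa using this
      exact this.trans_isLittleO
        ((isLittleO_pow_pow (𝕜 := ℝ) (by norm_num)).mono nhdsWithin_le_nhds)
    have hVd : HasFDerivAt V (fderiv ℝ V x) x := (hV1.differentiableAt (by norm_num)).hasFDerivAt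
    have e2 : (fun t => V (c t) - V x - t • fderiv ℝ V x A) =o[𝓝[>] (0 : ℝ)] fun t => t := by
      have h1 := (hVd.isLittleO.comp_tendsto hct).trans_isBigO hcx
      have h2 : (fun t => fderiv ℝ V x (c t - x - t • A)) =o[𝓝[>] (0 : ℝ)] fun t => t :=
        ((fderiv ℝ V x).isBigO_comp _ _).trans_isLittleO hcA
      refine (h1.add h2).congr_left fun t => ?_
      simp only [Function.comp_apply, map_sub, map_smul]
      abel
    have e3 : (fun t => fderiv ℝ V (c t) (V (c t)) - fderiv ℝ V x (V x)) =o[𝓝[>] (0 : ℝ)]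
        fun _ => (1 : ℝ) := by
      have hcont : ContinuousAt (fun y => fderiv ℝ V y (V y)) x :=
        ((hV2.fderiv_right (m := 1) (by norm_num)).clm_apply hV1).continuousAt
      rw [isLittleO_one_iff]
      simpa using (hcont.tendsto.comp hct).sub_const (fderiv ℝ V x (V x))
    have e2' : (fun t => t • (V (c t) - V x - t • fderiv ℝ V x A)) =o[𝓝[>] (0 : ℝ)]
        fun t => t ^ 2 := by
      simpa [sq] using (isBigO_refl (fun t : ℝ => t) (𝓝[>] 0)).smul_isLittleO e2
    have e3' : (fun t => (t ^ 2 / 2) • (fderiv ℝ V (c t) (V (c t)) - fderiv ℝ V x (V x)))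
        =o[𝓝[>] (0 : ℝ)] fun t => t ^ 2 := by
      have h1 : (fun t : ℝ => t ^ 2 / 2) =O[𝓝[>] 0] fun t => t ^ 2 :=
        IsBigO.of_bound 1 (Eventually.of_forall fun t => by
          simp only [norm_div, norm_pow, Real.norm_ofNat]
          linarith [sq_nonneg ‖t‖])
      simpa using h1.smul_isLittleO e3
    refine (((e1.add hco).add e2').add e3').congr_left fun t => ?_
    simp only [smul_sub, smul_add, smul_smul]
    module

/-- A one-sided consequence of the commutator expansion. -/
theorem TangentTo.inner_lieBracket_nonpos {F O : Set E} (hF : IsClosed F) {V W : E → E}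
    (hV : TangentTo F O V) (hW : TangentTo F O W) {x : E} (hxF : x ∈ F) (hO : O ∈ 𝓝 x)
    (hV2 : ContDiffAt ℝ 2 V x) (hW2 : ContDiffAt ℝ 2 W x) {z : E}
    (hz : ∀ y ∈ F, dist x z ≤ dist y z) :
    inner ℝ (VectorField.lieBracket ℝ V W x) (z - x) ≤ 0 := by
  -- Follow `V`, `W`, `-V`, `-W` in turn, each for time `t`. First order terms cancel and the `t²`
  -- coefficient is `DW V - DV W`, so a curve `x + t² [V, W] + o(t²)` runs in `F`.
  obtain ⟨c₁, h₁, e₁⟩ := hV.exists_step hF hO hV2 (c := fun _ => x) (A := 0) (B := 0)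
    (Eventually.of_forall fun _ => hxF) (by simp)
  obtain ⟨c₂, h₂, e₂⟩ := hW.exists_step hF hO hW2 h₁ e₁
  obtain ⟨c₃, h₃, e₃⟩ := hV.neg.exists_step hF hO hV2.neg h₂ e₂
  obtain ⟨c₄, h₄, e₄⟩ := hW.neg.exists_step hF hO hW2.neg h₃ e₃
  set Z := VectorField.lieBracket ℝ V W x with hZ
  have e : (fun t => c₄ t - (x + t ^ 2 • Z)) =o[𝓝[>] (0 : ℝ)] fun t => t ^ 2 := by
    refine e₄.congr_left fun t => ?_
    simp only [hZ, VectorField.lieBracket, fderiv_neg, Pi.neg_apply, map_neg, map_add, map_zero,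
      _root_.neg_apply, zero_add]
    module
  have hd : Tendsto (fun t => (t ^ 2)⁻¹ • (c₄ t - x)) (𝓝[>] (0 : ℝ)) (𝓝 Z) := by
    have h1 := e.tendsto_inv_smul_nhds_zero
    have h2 := h1.add_const Z
    rw [zero_add] at h2
    refine h2.congr' ?_
    filter_upwards [self_mem_nhdsWithin] with t ht
    have ht' : (t ^ 2 : ℝ) ≠ 0 := pow_ne_zero _ (ne_of_gt ht)
    rw [← sub_sub, smul_sub, smul_smul, inv_mul_cancel₀ ht', one_smul, sub_add_cancel]
  have hc4 : Tendsto (fun t => c₄ t - x) (𝓝[>] (0 : ℝ)) (𝓝 0) := by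
    have ht0 : Tendsto (fun t : ℝ => t ^ 2) (𝓝[>] 0) (𝓝 0) := by
      have : Tendsto (fun t : ℝ => t ^ 2) (𝓝 0) (𝓝 (0 ^ 2)) := (continuous_pow 2).tendsto 0
      simpa using this.mono_left nhdsWithin_le_nhds
    have := ht0.smul hd
    rw [zero_smul] at this
    refine this.congr' ?_
    filter_upwards [self_mem_nhdsWithin] with t ht
    rw [smul_smul, mul_inv_cancel₀ (pow_ne_zero _ (ne_of_gt ht)), one_smul]
  have hlim : Tendsto (fun t => inner ℝ ((t ^ 2)⁻¹ • (c₄ t - x)) (2 • (z - x) - (c₄ t - x)))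
      (𝓝[>] (0 : ℝ)) (𝓝 (inner ℝ Z (2 • (z - x) - 0))) :=
    hd.inner (tendsto_const_nhds.sub hc4)
  -- Expanding `‖c₄ t - z‖² ≥ ‖x - z‖²` makes the inner product of `c₄ t - x` with `2(z - x) - (c₄ t
  -- - x)` nonpositive; divide by `t²` and let `t → 0`.
  have hle : inner ℝ Z (2 • (z - x) - 0) ≤ 0 := by
    refine le_of_tendsto hlim ?_
    filter_upwards [h₄, self_mem_nhdsWithin] with t ht ht0
    have h1 := hz _ ht
    rw [dist_eq_norm, dist_eq_norm] at h1
    have h2 := pow_le_pow_left₀ (norm_nonneg _) h1 2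
    have h3 : ‖c₄ t - z‖ ^ 2 = ‖x - z‖ ^ 2 - inner ℝ (c₄ t - x) (2 • (z - x) - (c₄ t - x)) := by
      have e1 : c₄ t - z = (c₄ t - x) + (x - z) := by abel
      rw [e1, norm_add_sq_real, inner_sub_right (c₄ t - x) (2 • (z - x)),
        real_inner_self_eq_norm_sq, ← neg_sub x z, two_nsmul, inner_add_right, inner_neg_right]
      ring
    rw [real_inner_smul_left]
    exact mul_nonpos_of_nonneg_of_nonpos (by positivity) (by linarith)
  rw [sub_zero, two_nsmul, inner_add_right] at hle
  linarith

theorem two_le_smooth : (2 : WithTop ℕ∞) ≤ ∞ :=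
  WithTop.coe_le_coe.2 (le_top : (2 : ℕ∞) ≤ ⊤)

/-- The Lie bracket of vector fields tangent to a closed set is tangent to it. -/
theorem TangentTo.lieBracket {F O : Set E} (hF : IsClosed F) (hO : IsOpen O) {V W : E → E}
    (hV : TangentTo F O V) (hW : TangentTo F O W)
    (hV2 : ContDiffOn ℝ ∞ V O) (hW2 : ContDiffOn ℝ ∞ W O) :
    TangentTo F O (VectorField.lieBracket ℝ V W) := fun x hx z hz => by
  have hOx := hO.mem_nhds hx.2
  have hVx : ContDiffAt ℝ 2 V x := (hV2.contDiffAt hOx).of_le two_le_smooth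
  have hWx : ContDiffAt ℝ 2 W x := (hW2.contDiffAt hOx).of_le two_le_smooth
  -- The commutator curve moves only forward along the bracket; exchanging the fields gives the
  -- opposite inequality.
  refine le_antisymm (hV.inner_lieBracket_nonpos hF hW hx.1 hOx hVx hWx hz) ?_
  have := hW.inner_lieBracket_nonpos hF hV hx.1 hOx hWx hVx hz
  rw [VectorField.lieBracket_swap, inner_neg_left] at this
  linarith

end Bracket

/-! ### The Hopf lemma for degenerate elliptic operators -/

section Hopf

/-- At a local minimum the second derivative is nonnegative. -/
theorem IsLocalMin.fderiv_fderiv_nonneg {E : Type*} [NormedAddCommGroup E] [NormedSpace ℝ E]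
    {w : E → ℝ} {y : E} (h : IsLocalMin w y) (hw : ContDiffAt ℝ 2 w y) (v : E) :
    0 ≤ fderiv ℝ (fderiv ℝ w) y v v := by
  by_contra! hneg
  have hline : ContinuousAt (fun t : ℝ => y + t • v) 0 := by fun_prop
  have hline' : Tendsto (fun t : ℝ => y + t • v) (𝓝 0) (𝓝 y) := by
    simpa using! hline.tendsto
  have hl : ∀ t : ℝ, HasDerivAt (fun t : ℝ => y + t • v) v t := fun t => by
    simpa using ((hasDerivAt_id t).smul_const v).const_add y
  have hd1 : ∀ᶠ t in 𝓝 (0 : ℝ), HasDerivAt (fun t : ℝ => w (y + t • v))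
      (fderiv ℝ w (y + t • v) v) t := by
    filter_upwards [hline'.eventually (hw.eventually (by simp))] with t ht
    exact (ht.differentiableAt (by norm_num)).hasFDerivAt.comp_hasDerivAt t (hl t)
  have hd1' : deriv (fun t : ℝ => w (y + t • v)) =ᶠ[𝓝 0] fun t : ℝ => fderiv ℝ w (y + t • v) v :=
    hd1.mono fun t ht => ht.deriv
  have hd2 : HasDerivAt (fun t : ℝ => fderiv ℝ w (y + t • v) v)
      (fderiv ℝ (fderiv ℝ w) y v v) 0 := by
    have h1 : HasFDerivAt (fderiv ℝ w) (fderiv ℝ (fderiv ℝ w) y) (y + (0 : ℝ) • v) := by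
      rw [zero_smul, add_zero]
      exact ((hw.fderiv_right (m := 1) (by norm_num)).differentiableAt (by norm_num)).hasFDerivAt
    have := h1.comp_hasDerivAt (0 : ℝ) (hl 0)
    simpa using this.clm_apply (hasDerivAt_const (0 : ℝ) v)
  have hdd : deriv (deriv (fun t : ℝ => w (y + t • v))) 0 = fderiv ℝ (fderiv ℝ w) y v v := by
    rw [hd1'.deriv_eq, hd2.deriv]
  have hmin : IsLocalMin (fun t : ℝ => w (y + t • v)) 0 := by
    filter_upwards [hline'.eventually h] with t ht
    simpa using ht
  -- A negative second derivative makes the minimum a local maximum as well, so the function is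
  -- constant along the line near `0`, and its second derivative vanishes.
  have hmax := isLocalMax_of_deriv_deriv_neg (hdd ▸ hneg) hmin.deriv_eq_zero
    hd1.self_of_nhds.continuousAt
  have hconst : (fun t : ℝ => w (y + t • v)) =ᶠ[𝓝 0] fun _ => w (y + (0 : ℝ) • v) := by
    filter_upwards [hmin, hmax] with t h1 h2
    exact le_antisymm h2 h1
  have h0 : deriv (deriv (fun t : ℝ => w (y + t • v))) 0 = 0 := by
    rw [hconst.deriv.deriv_eq]
    simp
  rw [hdd] at h0
  exact hneg.ne h0

variable {n : ℕ}

/-- The contraction `∑ a_ij Q_ij` of a matrix with a bilinear form. -/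
noncomputable def contraction (a : Matrix (Fin n) (Fin n) ℝ)
    (Q : EuclideanSpace ℝ (Fin n) →L[ℝ] EuclideanSpace ℝ (Fin n) →L[ℝ] ℝ) : ℝ :=
  ∑ i, ∑ j, a i j * Q (EuclideanSpace.single i 1) (EuclideanSpace.single j 1)

-- Writing `a = BᵀB` turns the contraction into the sum of `Q(bₖ, bₖ)` over the rows `bₖ` of `B`.
open scoped MatrixOrder in
theorem contraction_nonneg {a : Matrix (Fin n) (Fin n) ℝ} (ha : a.PosSemidef)
    {Q : EuclideanSpace ℝ (Fin n) →L[ℝ] EuclideanSpace ℝ (Fin n) →L[ℝ] ℝ}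
    (hQ : ∀ v, 0 ≤ Q v v) : 0 ≤ contraction a Q := by
  obtain ⟨B, rfl⟩ := CStarAlgebra.nonneg_iff_eq_star_mul_self.1 ha.nonneg
  have h : contraction (star B * B) Q =
      ∑ k, Q (∑ i, B k i • EuclideanSpace.single i 1) (∑ i, B k i • EuclideanSpace.single i 1) := by
    simp only [contraction, Matrix.mul_apply, Matrix.star_apply, star_trivial,
      Finset.sum_mul, map_sum, map_smul, sum_apply, smul_apply,
      smul_eq_mul]
    rw [Finset.sum_congr rfl fun i _ => Finset.sum_comm, Finset.sum_comm]
    refine Finset.sum_congr rfl fun k _ => ?_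
    rw [Finset.sum_comm]
    refine Finset.sum_congr rfl fun i _ => ?_
    rw [Finset.mul_sum]
    refine Finset.sum_congr rfl fun j _ => ?_
    ring
  rw [h]
  exact Finset.sum_nonneg fun k _ => hQ _

theorem contraction_sub_smul (a : Matrix (Fin n) (Fin n) ℝ)
    (Q Q' : EuclideanSpace ℝ (Fin n) →L[ℝ] EuclideanSpace ℝ (Fin n) →L[ℝ] ℝ) (c : ℝ) :
    contraction a (Q - c • Q') = contraction a Q - c * contraction a Q' := by
  simp only [contraction, sub_apply, smul_apply, smul_eq_mul,
    mul_sub, Finset.sum_sub_distrib, Finset.mul_sum]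
  congr 1
  refine Finset.sum_congr rfl fun i _ => Finset.sum_congr rfl fun j _ => ?_
  ring

theorem hasFDerivAt_exp_neg_sq {E : Type*} [NormedAddCommGroup E] [InnerProductSpace ℝ E]
    (α : ℝ) (z y : E) :
    HasFDerivAt (fun y => Real.exp (-α * ‖y - z‖ ^ 2))
      ((-(2 * α) * Real.exp (-α * ‖y - z‖ ^ 2)) • innerSL ℝ (y - z)) y := by
  have h1 : HasFDerivAt (fun y : E => ‖y - z‖ ^ 2) (2 • innerSL ℝ (y - z)) y := by
    simpa using! ((hasFDerivAt_id y).sub_const z).norm_sq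
  refine ((h1.const_mul (-α)).exp).congr_fderiv ?_
  ext v
  simp
  ring

theorem fderiv_fderiv_exp_neg_sq {E : Type*} [NormedAddCommGroup E] [InnerProductSpace ℝ E]
    (α : ℝ) (z y v w : E) :
    fderiv ℝ (fderiv ℝ (fun y => Real.exp (-α * ‖y - z‖ ^ 2))) y v w =
      Real.exp (-α * ‖y - z‖ ^ 2) *
        (4 * α ^ 2 * (inner ℝ (y - z) v * inner ℝ (y - z) w) - 2 * α * inner ℝ v w) := by
  have h0 : fderiv ℝ (fun y : E => Real.exp (-α * ‖y - z‖ ^ 2)) =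
      fun y => (-(2 * α) * Real.exp (-α * ‖y - z‖ ^ 2)) • innerSL ℝ (y - z) :=
    funext fun y => (hasFDerivAt_exp_neg_sq α z y).fderiv
  have h1 := (hasFDerivAt_exp_neg_sq α z y).const_mul (-(2 * α))
  have h2 : HasFDerivAt (fun y : E => innerSL ℝ (y - z)) (innerSL ℝ : E →L[ℝ] E →L[ℝ] ℝ) y := by
    exact (innerSL ℝ : E →L[ℝ] E →L[ℝ] ℝ).hasFDerivAt.comp y ((hasFDerivAt_id y).sub_const z)
  have h3 : (innerSL ℝ : E →L[ℝ] E →L[ℝ] ℝ) v w = inner ℝ v w := rfl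
  rw [h0, (h1.fun_smul h2).fderiv]
  simp [h3, inner_sub_left]
  ring

/-- The reason for an exponential barrier: `a(y - z, y - z)` comes with `α²` and the trace only with
`α`, so a noncharacteristic normal wins for large `α`. -/
theorem contraction_fderiv_fderiv_exp (a : Matrix (Fin n) (Fin n) ℝ) (α : ℝ)
    (z y : EuclideanSpace ℝ (Fin n)) :
    contraction a (fderiv ℝ (fderiv ℝ (fun y => Real.exp (-α * ‖y - z‖ ^ 2))) y) =
      Real.exp (-α * ‖y - z‖ ^ 2) *
        (4 * α ^ 2 * (∑ i, ∑ j, a i j * ((y - z) i * (y - z) j)) - 2 * α * a.trace) := by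
  have htr : a.trace = ∑ i, ∑ j, a i j * (if i = j then 1 else 0) := by
    simp [Matrix.trace]
  rw [htr]
  simp only [contraction, fderiv_fderiv_exp_neg_sq, Finset.mul_sum, ← Finset.sum_sub_distrib]
  refine Finset.sum_congr rfl fun i _ => Finset.sum_congr rfl fun j _ => ?_
  simp only [EuclideanSpace.inner_single_right, PiLp.single_apply, one_mul,
    conj_trivial]
  by_cases h : i = j
  · subst h
    simp
    ring
  · simp [h, Ne.symm h]
    ring

/-- The Hopf lemma: if `u ≥ 0` is a supersolution of a degenerate elliptic equation, then the
operator is characteristic in the directions normal to the zero set of `u`; version for a ball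
touching the zero set at one point only. -/
theorem sum_eq_zero_of_strict_normal {u : EuclideanSpace ℝ (Fin n) → ℝ}
    {x z : EuclideanSpace ℝ (Fin n)} {a : EuclideanSpace ℝ (Fin n) → Matrix (Fin n) (Fin n) ℝ}
    {K : ℝ} {N : Set (EuclideanSpace ℝ (Fin n))} (hN : N ∈ 𝓝 x)
    (hu : ∀ y ∈ N, ContDiffAt ℝ 2 u y) (hnn : ∀ y ∈ N, 0 ≤ u y)
    (ha : ∀ y ∈ N, (a y).PosSemidef) (hac : ContinuousAt a x)
    (hineq : ∀ y ∈ N, contraction (a y) (fderiv ℝ (fderiv ℝ u) y) ≤ K * (‖fderiv ℝ u y‖ + |u y|))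
    (hux : u x = 0) (hz : ∀ y ∈ N, u y = 0 → y ≠ x → dist x z < dist y z) :
    ∑ i, ∑ j, a x i j * ((x - z) i * (x - z) j) ≤ 0 := by
  by_contra! hpos
  set q : EuclideanSpace ℝ (Fin n) → ℝ :=
    fun y => ∑ i, ∑ j, a y i j * ((y - z) i * (y - z) j) with hq
  set q₀ := q x with hq₀
  have hq0 : 0 < q₀ := hpos
  have hcoord : ∀ i j, ContinuousAt (fun y => a y i j) x := fun i j =>
    (continuous_id.matrix_elem i j).continuousAt.comp hac
  have hqc : ContinuousAt q x := by
    refine tendsto_finsetSum _ fun i _ => tendsto_finsetSum _ fun j _ => ?_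
    exact (hcoord i j).mul (Continuous.continuousAt (by fun_prop))
  have htc : ContinuousAt (fun y => (a y).trace) x :=
    tendsto_finsetSum _ fun i _ => hcoord i i
  set R := ‖x - z‖
  set T := (a x).trace + 1 with hT
  have hT0 : 0 ≤ (a x).trace := (ha x (mem_of_mem_nhds hN)).trace_nonneg
  obtain ⟨r₀, hr₀, hr₀s⟩ := Metric.nhds_basis_closedBall.mem_iff.1
    (inter_mem hN (inter_mem (hqc.eventually_const_lt (show q₀ / 2 < q x by linarith))
      (inter_mem (htc.eventually_lt_const (show (a x).trace < T by linarith))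
        ((show ContinuousAt (fun y => ‖y - z‖) x by fun_prop).eventually_lt_const
          (show ‖x - z‖ < R + 1 by linarith)))))
  -- At the touching point found below, the inequality reduces to `2 q₀ α ≤ D`. The three terms come
  -- from the trace, the gradient and `u` itself; `α` is chosen to violate this.
  set D := 2 * T + 2 * |K| * (R + 1) + |K| with hD
  have hR : 0 ≤ R := norm_nonneg _
  have hD0 : 0 < D := by positivity
  set α := 1 + D / (2 * q₀) with hα
  have hα1 : 1 ≤ α := by
    have : 0 ≤ D / (2 * q₀) := by positivity
    linarith
  have hαD : D < 2 * q₀ * α := by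
    have : 2 * q₀ * α = 2 * q₀ + D := by rw [hα]; field_simp
    linarith
  set g : EuclideanSpace ℝ (Fin n) → ℝ := fun y => Real.exp (-α * ‖y - z‖ ^ 2) with hg
  set c := g x with hc
  have hgpos : ∀ y, 0 < g y := fun y => Real.exp_pos _
  have hg1 : ∀ y, g y ≤ 1 := fun y => by
    rw [hg]
    refine Real.exp_le_one_iff.2 ?_
    have : 0 ≤ α * ‖y - z‖ ^ 2 := by positivity
    linarith
  have hgC : ContDiff ℝ 2 g := by
    have : ContDiff ℝ 2 (fun y : EuclideanSpace ℝ (Fin n) => ‖y - z‖ ^ 2) :=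
      (contDiff_id.sub contDiff_const).norm_sq ℝ
    exact (contDiff_const.mul this).exp
  have hgc : ∀ y, c ≤ g y → ‖y - z‖ ≤ R := fun y hy => by
    have h1 := Real.exp_le_exp.1 hy
    have h2 : ‖y - z‖ ^ 2 ≤ R ^ 2 := by
      have : α * ‖y - z‖ ^ 2 ≤ α * R ^ 2 := by linarith
      exact le_of_mul_le_mul_left this (by linarith)
    exact (pow_le_pow_iff_left₀ (norm_nonneg _) hR two_ne_zero).1 h2
  have hucont : ContinuousOn u (Metric.closedBall x r₀) := fun y hy =>
    (hu y (hr₀s hy).1).continuousAt.continuousWithinAt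
  have hScomp : IsCompact (Metric.sphere x r₀ ∩ {y | c ≤ g y}) :=
    (isCompact_sphere x r₀).inter_right (isClosed_le continuous_const hgC.continuous)
  -- The set `c ≤ g` lies in the closed ball about `z` through `x`, where `u` vanishes only at `x`;
  -- compactness of its part on the small sphere gives a positive lower bound for `u`.
  obtain ⟨ε, hε, hεS⟩ : ∃ ε > 0, ∀ y ∈ Metric.sphere x r₀ ∩ {y | c ≤ g y}, ε ≤ u y := by
    have hsub : Metric.sphere x r₀ ∩ {y | c ≤ g y} ⊆ Metric.closedBall x r₀ := fun y hy =>
      Metric.sphere_subset_closedBall hy.1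
    refine hScomp.exists_forall_le' (hucont.mono hsub) (a := 0) fun y hy => ?_
    refine lt_of_le_of_ne (hnn y (hr₀s (hsub hy)).1) fun h0 => ?_
    have hyx : y ≠ x := by
      rintro rfl
      have := hy.1
      rw [Metric.mem_sphere, dist_self] at this
      exact hr₀.ne this
    have h1 := hz y (hr₀s (hsub hy)).1 h0.symm hyx
    rw [dist_eq_norm, dist_eq_norm] at h1
    exact absurd (hgc y hy.2) (not_le.2 h1)
  -- On the sphere about `x` this is positive: where `g < c` because `u ≥ 0`, and elsewhere because
  -- `u ≥ ε` and `g - c < 1`. As `w x = 0`, the minimum over the ball is attained inside.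
  set w : EuclideanSpace ℝ (Fin n) → ℝ := fun y => u y - ε * (g y - c) with hw
  have hwcont : ContinuousOn w (Metric.closedBall x r₀) :=
    hucont.sub (continuousOn_const.mul (hgC.continuous.continuousOn.sub continuousOn_const))
  obtain ⟨y, hyB, hymin⟩ := (isCompact_closedBall x r₀).exists_isMinOn
    ⟨x, Metric.mem_closedBall_self hr₀.le⟩ hwcont
  have hwx : w x = 0 := by simp [hw, hux, hc]
  have hwy : w y ≤ 0 := hwx ▸ hymin (Metric.mem_closedBall_self hr₀.le)
  obtain ⟨hyN, hyq, hyT, hyR⟩ := hr₀s hyB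
  simp only [mem_ofPred_eq] at hyq hyT hyR
  have huy := hnn y hyN
  have hgy : c ≤ g y := by
    by_contra! h
    simp only [hw] at hwy
    nlinarith
  have hcpos : 0 < c := hgpos x
  have hyball : y ∈ Metric.ball x r₀ := by
    refine lt_of_le_of_ne (Metric.mem_closedBall.1 hyB) fun h => ?_
    have h1 := hεS y ⟨h, hgy⟩
    have h2 : ε * (g y - c) < ε * 1 := mul_lt_mul_of_pos_left (by linarith [hg1 y]) hε
    simp only [hw] at hwy
    linarith
  have hlm : IsLocalMin w y :=
    hymin.isLocalMin (Filter.mem_of_superset (Metric.isOpen_ball.mem_nhds hyball)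
      Metric.ball_subset_closedBall)
  have hwC : ContDiffAt ℝ 2 w y :=
    (hu y hyN).sub (contDiffAt_const.mul (hgC.contDiffAt.sub contDiffAt_const))
  have hfw : ∀ y', ContDiffAt ℝ 2 u y' → fderiv ℝ w y' = fderiv ℝ u y' - ε • fderiv ℝ g y' :=
    fun y' hy' => by
      have h1 := (hy'.differentiableAt (by norm_num)).hasFDerivAt
      have h2 := (hgC.differentiable (by norm_num) y').hasFDerivAt
      exact (h1.sub ((h2.sub_const c).const_mul ε)).fderiv
  have hfw' : fderiv ℝ w =ᶠ[𝓝 y] fun y' => fderiv ℝ u y' - ε • fderiv ℝ g y' :=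
    ((hu y hyN).eventually (by simp)).mono hfw
  have hffw : fderiv ℝ (fderiv ℝ w) y =
      fderiv ℝ (fderiv ℝ u) y - ε • fderiv ℝ (fderiv ℝ g) y := by
    have h1 := (((hu y hyN).fderiv_right (m := 1) (by norm_num)).differentiableAt
      (by norm_num)).hasFDerivAt
    have h2 := (((hgC.contDiffAt (x := y)).fderiv_right (m := 1) (by norm_num)).differentiableAt
      (by norm_num)).hasFDerivAt
    rw [hfw'.fderiv_eq]
    exact (h1.sub (h2.const_smul ε)).fderiv
  have hcn := contraction_nonneg (ha y hyN) (hlm.fderiv_fderiv_nonneg hwC)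
  rw [hffw, contraction_sub_smul, contraction_fderiv_fderiv_exp] at hcn
  have hdu : fderiv ℝ u y = ε • fderiv ℝ g y := by
    have := hlm.fderiv_eq_zero
    rw [hfw y (hu y hyN)] at this
    exact sub_eq_zero.1 this
  have hdun : ‖fderiv ℝ u y‖ = ε * (2 * α * g y * ‖y - z‖) := by
    rw [hdu, (hasFDerivAt_exp_neg_sq α z y).fderiv, norm_smul, norm_smul, innerSL_apply_norm,
      Real.norm_of_nonneg hε.le, Real.norm_eq_abs, abs_mul, abs_neg, abs_of_pos (hgpos y),
      abs_of_pos (by linarith)]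
  have huy' : |u y| ≤ ε * g y := by
    rw [abs_of_nonneg huy]
    simp only [hw] at hwy
    nlinarith
  have hin := hineq y hyN
  have hKle : K * (‖fderiv ℝ u y‖ + |u y|) ≤ |K| * (ε * (2 * α * g y * (R + 1)) + ε * g y) := by
    refine (mul_le_mul_of_nonneg_right (le_abs_self K) (by positivity)).trans ?_
    refine mul_le_mul_of_nonneg_left ?_ (abs_nonneg _)
    rw [hdun]
    have h0 := hgpos y
    gcongr
  -- At the minimum `Du = ε Dg` and `0 ≤ u ≤ ε g`, so every term of the inequality carries the
  -- factor `ε g y`, which cancels. The term `K |u|` is harmless for the same reason.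
  have hgyq : g y * (4 * α ^ 2 * q y - 2 * α * (a y).trace) ≤
      g y * (|K| * (2 * α * (R + 1) + 1)) := by
    refine le_of_mul_le_mul_left ?_ hε
    have h5 := sub_nonneg.1 hcn |>.trans (hin.trans hKle)
    refine h5.trans (le_of_eq ?_)
    ring
  have hfin := le_of_mul_le_mul_left hgyq (hgpos y)
  have hα0 : 0 < α := by linarith
  have h1 : 4 * α ^ 2 * (q₀ / 2) ≤ 4 * α ^ 2 * q y := by gcongr
  have h2 : 2 * α * (a y).trace ≤ 2 * α * T := by gcongr
  have h3 : α * D < α * (2 * q₀ * α) := mul_lt_mul_of_pos_left hαD hα0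
  have h4 : |K| ≤ α * |K| := le_mul_of_one_le_left (abs_nonneg _) hα1
  rw [hD] at h3
  linarith

/-- The Hopf lemma: if `u ≥ 0` is a supersolution of a degenerate elliptic equation, then the
operator is characteristic in the directions normal to the zero set of `u`. -/
theorem sum_eq_zero_of_normal {u : EuclideanSpace ℝ (Fin n) → ℝ}
    {x z : EuclideanSpace ℝ (Fin n)} {a : EuclideanSpace ℝ (Fin n) → Matrix (Fin n) (Fin n) ℝ}
    {K : ℝ} {N : Set (EuclideanSpace ℝ (Fin n))} (hN : N ∈ 𝓝 x)
    (hu : ∀ y ∈ N, ContDiffAt ℝ 2 u y) (hnn : ∀ y ∈ N, 0 ≤ u y)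
    (ha : ∀ y ∈ N, (a y).PosSemidef) (hac : ContinuousAt a x)
    (hineq : ∀ y ∈ N, contraction (a y) (fderiv ℝ (fderiv ℝ u) y) ≤ K * (‖fderiv ℝ u y‖ + |u y|))
    (hux : u x = 0) (hz : ∀ y ∈ N, u y = 0 → dist x z ≤ dist y z) :
    ∑ i, ∑ j, a x i j * ((z - x) i * (z - x) j) ≤ 0 := by
  -- Halving the ball, with `x` kept on its boundary, makes `x` the only point of contact;
  -- strictness comes from the parallelogram law. The normal is halved, whence the factor `1 / 4`.
  have h := sum_eq_zero_of_strict_normal (z := midpoint ℝ x z) hN hu hnn ha hac hineq hux ?_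
  · have e : x - midpoint ℝ x z = -((1 / 2 : ℝ) • (z - x)) := by
      rw [midpoint_eq_smul_add]
      norm_num
      module
    rw [e] at h
    have e2 : ∑ i, ∑ j, a x i j * ((-((1 / 2 : ℝ) • (z - x))) i * (-((1 / 2 : ℝ) • (z - x))) j) =
        1 / 4 * ∑ i, ∑ j, a x i j * ((z - x) i * (z - x) j) := by
      simp only [Finset.mul_sum]
      refine Finset.sum_congr rfl fun i _ => Finset.sum_congr rfl fun j _ => ?_
      simp only [PiLp.neg_apply, PiLp.smul_apply, smul_eq_mul]
      ring
    rw [e2] at h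
    linarith
  · intro y hy hy0 hyx
    have h1 := hz y hy hy0
    rw [dist_eq_norm, dist_eq_norm] at h1 ⊢
    have hp := parallelogram_law_with_norm ℝ (y - x) (y - z)
    have e1 : y - x + (y - z) = (2 : ℝ) • (y - midpoint ℝ x z) := by
      rw [midpoint_eq_smul_add]
      norm_num
      module
    have e2 : y - x - (y - z) = -((2 : ℝ) • (x - midpoint ℝ x z)) := by
      rw [midpoint_eq_smul_add]
      norm_num
      module
    have e3 : ‖x - z‖ = 2 * ‖x - midpoint ℝ x z‖ := by
      have : x - z = (2 : ℝ) • (x - midpoint ℝ x z) := by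
        rw [midpoint_eq_smul_add]
        norm_num
        module
      rw [this, norm_smul]
      simp
    rw [e1, e2, norm_neg, norm_smul, norm_smul] at hp
    simp only [Real.norm_ofNat] at hp
    have h2 : 0 < ‖y - x‖ := norm_pos_iff.2 (sub_ne_zero.2 hyx)
    rw [e3] at h1
    refine lt_of_pow_lt_pow_left₀ 2 (norm_nonneg _) ?_
    nlinarith [norm_nonneg (x - midpoint ℝ x z), norm_nonneg (y - z)]

end Hopf

/-! ### The linearized operator in coordinates -/

section Linearization

variable {n : ℕ}

local notation "𝔼" d:max => EuclideanSpace ℝ (Fin d)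

/-- The divergence of a vector field on `ℝⁿ`. -/
noncomputable def divergence (W : 𝔼 n → 𝔼 n) (y : 𝔼 n) : ℝ :=
  ∑ i, fderiv ℝ W y (EuclideanSpace.single i 1) i

/-- The vector `|q|^{p-1} A q`, where `A` raises indices and `|q|² = q (A q)`. -/
noncomputable def flux (p : ℝ) (A : (𝔼 n →L[ℝ] ℝ) →L[ℝ] 𝔼 n) (q : 𝔼 n →L[ℝ] ℝ) : 𝔼 n :=
  (√(q (A q)) ^ (1 - p))⁻¹ • A q

/-- The matrix `|q|^{p-1} (A + (p - 1) |q|⁻² Aq ⊗ Aq)`, the derivative of the flux. -/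
noncomputable def fluxSymbol (p : ℝ) (A : (𝔼 n →L[ℝ] ℝ) →L[ℝ] 𝔼 n) (q : 𝔼 n →L[ℝ] ℝ) :
    Matrix (Fin n) (Fin n) ℝ :=
  Matrix.of fun i j => (√(q (A q)) ^ (1 - p))⁻¹ *
    (A (EuclideanSpace.proj j) i + (p - 1) / q (A q) * (A q i * A q j))

theorem covector_eq_sum (θ : 𝔼 n →L[ℝ] ℝ) :
    θ = ∑ i, θ (EuclideanSpace.single i 1) • (EuclideanSpace.proj i : 𝔼 n →L[ℝ] ℝ) := by
  refine ContinuousLinearMap.coe_injective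
    ((EuclideanSpace.basisFun (Fin n) ℝ).toBasis.ext fun j => ?_)
  simp [PiLp.single_apply]

theorem innerSL_eq_sum (v : 𝔼 n) :
    innerSL ℝ v = ∑ i, v i • (EuclideanSpace.proj i : 𝔼 n →L[ℝ] ℝ) := by
  rw [covector_eq_sum (innerSL ℝ v)]
  simp [EuclideanSpace.inner_single_right]

variable {A : (𝔼 n →L[ℝ] ℝ) →L[ℝ] 𝔼 n} {p : ℝ} {q : 𝔼 n →L[ℝ] ℝ}

theorem sq_apply_le (hs : ∀ θ η : 𝔼 n →L[ℝ] ℝ, θ (A η) = η (A θ))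
    (hn : ∀ θ : 𝔼 n →L[ℝ] ℝ, 0 ≤ θ (A θ))
    (θ η : 𝔼 n →L[ℝ] ℝ) : θ (A η) ^ 2 ≤ θ (A θ) * η (A η) := by
  let B : LinearMap.BilinForm ℝ (𝔼 n →L[ℝ] ℝ) :=
    LinearMap.mk₂ ℝ (fun θ η => θ (A η)) (by simp) (by simp) (by simp) (by simp)
  exact B.apply_sq_le_of_symm hn ⟨fun θ η => hs θ η⟩ θ η

theorem sum_fluxSymbol (v : 𝔼 n) :
    ∑ i, ∑ j, fluxSymbol p A q i j * (v i * v j) = (√(q (A q)) ^ (1 - p))⁻¹ *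
      (innerSL ℝ v (A (innerSL ℝ v)) + (p - 1) / q (A q) * innerSL ℝ v (A q) ^ 2) := by
  have h1 : innerSL ℝ v (A (innerSL ℝ v)) =
      ∑ i, ∑ j, A (EuclideanSpace.proj j) i * (v i * v j) := by
    conv_lhs => rw [innerSL_eq_sum]
    simp only [map_sum, map_smul, sum_apply, smul_apply, smul_eq_mul, PiLp.proj_apply]
    rw [Finset.sum_comm]
    refine Finset.sum_congr rfl fun i _ => ?_
    rw [Finset.mul_sum]
    refine Finset.sum_congr rfl fun j _ => ?_
    ring
  have h2 : innerSL ℝ v (A q) ^ 2 = ∑ i, ∑ j, A q i * A q j * (v i * v j) := by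
    rw [innerSL_eq_sum]
    simp only [sum_apply, smul_apply, smul_eq_mul, PiLp.proj_apply]
    rw [sq, Finset.sum_mul_sum]
    refine Finset.sum_congr rfl fun i _ => Finset.sum_congr rfl fun j _ => ?_
    ring
  rw [h1, h2]
  simp only [fluxSymbol, Matrix.of_apply, Finset.mul_sum, ← Finset.sum_add_distrib]
  refine Finset.sum_congr rfl fun i _ => Finset.sum_congr rfl fun j _ => ?_
  ring

/-- Up to a positive factor the form is `(θ(Aθ) - s²/N) + p s²/N` with `s = θ(Aq)` and `N = q(Aq)`;
the bracket is nonnegative by Cauchy–Schwarz. -/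
theorem fluxSymbol_posSemidef (hs : ∀ θ η : 𝔼 n →L[ℝ] ℝ, θ (A η) = η (A θ))
    (hn : ∀ θ : 𝔼 n →L[ℝ] ℝ, 0 ≤ θ (A θ)) (hp : 0 ≤ p) (hq : 0 < q (A q)) :
    (fluxSymbol p A q).PosSemidef := by
  refine Matrix.PosSemidef.of_dotProduct_mulVec_nonneg ?_ fun v => ?_
  · ext i j
    have := hs (EuclideanSpace.proj i) (EuclideanSpace.proj j)
    simp only [PiLp.proj_apply] at this
    simp [fluxSymbol, this, mul_comm]
  · have h := sum_fluxSymbol (p := p) (A := A) (q := q) (WithLp.toLp 2 v)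
    have h' : star v ⬝ᵥ (fluxSymbol p A q).mulVec v =
        ∑ i, ∑ j, fluxSymbol p A q i j * (v i * v j) := by
      simp only [dotProduct, Matrix.mulVec, star_trivial, Finset.mul_sum]
      refine Finset.sum_congr rfl fun i _ => Finset.sum_congr rfl fun j _ => ?_
      ring
    rw [h', h]
    set θ : 𝔼 n →L[ℝ] ℝ := innerSL ℝ (WithLp.toLp 2 v)
    refine mul_nonneg (by positivity) ?_
    have hcs := sq_apply_le hs hn θ q
    have h1 : θ (A q) ^ 2 / q (A q) ≤ θ (A θ) := (div_le_iff₀ hq).2 hcs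
    have h2 : 0 ≤ p * (θ (A q) ^ 2 / q (A q)) := by positivity
    have h3 : (p - 1) / q (A q) * θ (A q) ^ 2 =
        p * (θ (A q) ^ 2 / q (A q)) - θ (A q) ^ 2 / q (A q) := by ring
    rw [h3]
    linarith

/-- The null directions of the symbol. -/
theorem apply_eq_zero_of_sum_fluxSymbol_nonpos (hs : ∀ θ η : 𝔼 n →L[ℝ] ℝ, θ (A η) = η (A θ))
    (hn : ∀ θ : 𝔼 n →L[ℝ] ℝ, 0 ≤ θ (A θ)) (hp : 0 ≤ p) (hq : 0 < q (A q)) {v : 𝔼 n}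
    (hv : ∑ i, ∑ j, fluxSymbol p A q i j * (v i * v j) ≤ 0) (η : 𝔼 n →L[ℝ] ℝ)
    (hη : 0 < p ∨ q (A η) = 0) : inner ℝ v (A η) = 0 := by
  rw [sum_fluxSymbol] at hv
  have hf : 0 < (√(q (A q)) ^ (1 - p))⁻¹ :=
    inv_pos.2 (Real.rpow_pos_of_pos (Real.sqrt_pos.2 hq) _)
  change (innerSL ℝ v : 𝔼 n →L[ℝ] ℝ) (A η) = 0
  set θ : 𝔼 n →L[ℝ] ℝ := innerSL ℝ v
  set N := q (A q)
  set s := θ (A q)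
  have h0 : θ (A θ) + (p - 1) / N * s ^ 2 ≤ 0 := by
    by_contra! h
    exact absurd hv (not_le.2 (mul_pos hf h))
  -- The component of `θ` orthogonal to `q`. The form equals `θ'(Aθ') + p s²/N`, so both terms
  -- vanish. Cauchy–Schwarz gives `θ'(Aη) = 0`, that is `θ(Aη) = (s/N) q(Aη)`; here `s = 0` if `p >
  -- 0`, and otherwise `q(Aη) = 0` by assumption.
  set θ' : 𝔼 n →L[ℝ] ℝ := θ - (s / N) • q
  have h1 : θ' (A θ') = θ (A θ) - s ^ 2 / N := by
    have e : q (A θ) = s := hs q θ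
    simp only [θ', map_sub, map_smul, sub_apply, smul_apply, smul_eq_mul, e]
    change θ (A θ) - s / N * s - s / N * (s - s / N * N) = _
    field_simp
    ring
  have h2 : (p - 1) / N * s ^ 2 = p * (s ^ 2 / N) - s ^ 2 / N := by ring
  have h3 : 0 ≤ s ^ 2 / N := by positivity
  have h4 := hn θ'
  have h5 : 0 ≤ p * (s ^ 2 / N) := mul_nonneg hp h3
  have h6 : θ' (A θ') = 0 := by linarith
  have h7 : θ' (A η) = 0 := by
    have := sq_apply_le hs hn θ' η
    rw [h6, zero_mul] at this
    exact pow_eq_zero_iff two_ne_zero |>.1 (le_antisymm this (sq_nonneg _))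
  have h8 : θ (A η) = s / N * q (A η) := by
    have : θ' (A η) = θ (A η) - s / N * q (A η) := by simp [θ']
    linarith
  rw [h8]
  rcases hη with hη | hη
  · have h9 : s ^ 2 / N = 0 := by
      have : p * (s ^ 2 / N) = 0 := by linarith
      rcases mul_eq_zero.1 this with h | h
      · exact absurd h hη.ne'
      · exact h
    have : s = 0 := by
      rcases div_eq_zero_iff.1 h9 with h | h
      · exact pow_eq_zero_iff two_ne_zero |>.1 h
      · exact absurd h hq.ne'
    simp [this]
  · rw [hη, mul_zero]

/-- Identifies the second order operator with the trace of the derivative of the flux, the form in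
which it appears when a divergence is differentiated. -/
theorem contraction_fluxSymbol (hs : ∀ θ η : 𝔼 n →L[ℝ] ℝ, θ (A η) = η (A θ))
    (Q : 𝔼 n →L[ℝ] 𝔼 n →L[ℝ] ℝ) :
    contraction (fluxSymbol p A q) Q = ∑ i, ((√(q (A q)) ^ (1 - p))⁻¹ •
      (A (Q (EuclideanSpace.single i 1)) +
        ((p - 1) / q (A q) * q (A (Q (EuclideanSpace.single i 1)))) • A q)) i := by
  have h1 : ∀ η : 𝔼 n →L[ℝ] ℝ, ∀ i, A η i =
      ∑ j, A (EuclideanSpace.proj j) i * η (EuclideanSpace.single j 1) := fun η i => by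
    conv_lhs => rw [covector_eq_sum η]
    simp [mul_comm]
  have h2 : ∀ η : 𝔼 n →L[ℝ] ℝ, q (A η) = ∑ j, A q j * η (EuclideanSpace.single j 1) := fun η => by
    rw [hs]
    conv_lhs => rw [covector_eq_sum η]
    simp [mul_comm]
  simp only [contraction]
  refine Finset.sum_congr rfl fun i _ => ?_
  simp only [PiLp.smul_apply, PiLp.add_apply, smul_eq_mul]
  rw [h1 (Q (EuclideanSpace.single i 1)) i, h2 (Q (EuclideanSpace.single i 1))]
  simp only [fluxSymbol, Matrix.of_apply, Finset.mul_sum, Finset.sum_mul, ← Finset.sum_add_distrib]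
  refine Finset.sum_congr rfl fun j _ => ?_
  ring

theorem inv_sqrt_rpow {s : ℝ} (hs : 0 < s) (p : ℝ) :
    (√s ^ (1 - p))⁻¹ = s ^ ((p - 1) / 2) := by
  rw [Real.sqrt_eq_rpow, ← Real.rpow_mul hs.le, ← Real.rpow_neg hs.le]
  congr 1
  ring

theorem hasDerivAt_flux (hs : ∀ θ η : 𝔼 n →L[ℝ] ℝ, θ (A η) = η (A θ)) (hq : 0 < q (A q))
    (η : 𝔼 n →L[ℝ] ℝ) :
    HasDerivAt (fun t : ℝ => flux p A (q + t • η))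
      ((√(q (A q)) ^ (1 - p))⁻¹ • (A η + ((p - 1) / q (A q) * q (A η)) • A q)) 0 := by
  have hl : HasDerivAt (fun t : ℝ => q + t • η) η 0 := by
    simpa using ((hasDerivAt_id (0 : ℝ)).smul_const η).const_add q
  have hA : HasDerivAt (fun t : ℝ => A (q + t • η)) (A η) 0 := A.hasFDerivAt.comp_hasDerivAt 0 hl
  have hN : HasDerivAt (fun t : ℝ => (q + t • η) (A (q + t • η))) (2 * q (A η)) 0 := by
    refine (hl.clm_apply hA).congr_deriv ?_
    simp only [zero_smul, add_zero]
    rw [hs η q]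
    ring
  have hN0 : (q + (0 : ℝ) • η) (A (q + (0 : ℝ) • η)) = q (A q) := by simp
  have hpos : ∀ᶠ t in 𝓝 (0 : ℝ), 0 < (q + t • η) (A (q + t • η)) :=
    hN.continuousAt.eventually_const_lt (by simpa using hq)
  have hf : HasDerivAt (fun t : ℝ => (√((q + t • η) (A (q + t • η))) ^ (1 - p))⁻¹)
      ((√(q (A q)) ^ (1 - p))⁻¹ * ((p - 1) / q (A q) * q (A η))) 0 := by
    have h1 := hN.rpow_const (p := (p - 1) / 2) (Or.inl (by rw [hN0]; exact hq.ne'))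
    rw [hN0] at h1
    refine (h1.congr_of_eventuallyEq ?_).congr_deriv ?_
    · filter_upwards [hpos] with t ht
      exact inv_sqrt_rpow ht p
    · rw [inv_sqrt_rpow hq, Real.rpow_sub_one hq.ne']
      ring
  refine (hf.smul hA).congr_deriv ?_
  simp only [zero_smul, add_zero]
  module

theorem contDiffAt_flux {X : Type*} [NormedAddCommGroup X] [NormedSpace ℝ X]
    {G : X → (𝔼 n →L[ℝ] ℝ) →L[ℝ] 𝔼 n} {θ : X → 𝔼 n →L[ℝ] ℝ} {x : X} {k : WithTop ℕ∞}
    (hG : ContDiffAt ℝ k G x) (hθ : ContDiffAt ℝ k θ x) (hx : 0 < θ x (G x (θ x))) :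
    ContDiffAt ℝ k (fun x => flux p (G x) (θ x)) x := by
  have h1 : ContDiffAt ℝ k (fun x => G x (θ x)) x := hG.clm_apply hθ
  have h2 : ContDiffAt ℝ k (fun x => θ x (G x (θ x))) x := hθ.clm_apply h1
  have h3 : ContDiffAt ℝ k (fun x => √(θ x (G x (θ x)))) x := h2.sqrt hx.ne'
  exact ((h3.rpow_const_of_ne (Real.sqrt_pos.2 hx).ne').inv
    (Real.rpow_pos_of_pos (Real.sqrt_pos.2 hx) _).ne').smul h1

theorem continuousAt_fluxSymbol {X : Type*} [TopologicalSpace X]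
    {G : X → (𝔼 n →L[ℝ] ℝ) →L[ℝ] 𝔼 n} {θ : X → 𝔼 n →L[ℝ] ℝ} {x : X}
    (hG : ContinuousAt G x) (hθ : ContinuousAt θ x) (hx : 0 < θ x (G x (θ x))) :
    ContinuousAt (fun x => fluxSymbol p (G x) (θ x)) x := by
  have h1 : ContinuousAt (fun x => G x (θ x)) x := hG.clm_apply hθ
  have h2 : ContinuousAt (fun x => θ x (G x (θ x))) x := hθ.clm_apply h1
  have h3 : ContinuousAt (fun x => (√(θ x (G x (θ x))) ^ (1 - p))⁻¹) x :=
    (h2.sqrt.rpow_const (Or.inl (Real.sqrt_pos.2 hx).ne')).inv₀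
      (Real.rpow_pos_of_pos (Real.sqrt_pos.2 hx) _).ne'
  have hc : ∀ i, Continuous fun v : 𝔼 n => v i := fun i => by fun_prop
  have h4 : ∀ i, ContinuousAt (fun x => G x (θ x) i) x := fun i => (hc i).continuousAt.comp h1
  have h5 : ∀ i j, ContinuousAt (fun x => G x (EuclideanSpace.proj j) i) x := fun i j =>
    (hc i).continuousAt.comp (hG.clm_apply continuousAt_const)
  refine tendsto_pi_nhds.2 fun i => tendsto_pi_nhds.2 fun j => ?_
  exact h3.mul ((h5 i j).add ((continuousAt_const.div h2 hx.ne').mul ((h4 i).mul (h4 j))))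

/-- By the chain rule, what is left after removing the principal part is `DW(y, dψ) - DW(y, dφ)`
applied to `(eᵢ, D²ψ eᵢ)`: a Lipschitz difference acting on a bounded vector. The second derivatives
of `ψ` are thus frozen into the constant, and the error is of first order in `ψ - φ`. -/
theorem abs_divergence_sub_le {W : 𝔼 n × (𝔼 n →L[ℝ] ℝ) → 𝔼 n} {φ ψ : 𝔼 n → ℝ} {y₀ : 𝔼 n}
    (hφ : ContDiffAt ℝ ∞ φ y₀) (hψ : ContDiffAt ℝ ∞ ψ y₀) (hd : fderiv ℝ ψ y₀ = fderiv ℝ φ y₀)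
    (hW : ContDiffAt ℝ 2 W (y₀, fderiv ℝ φ y₀)) :
    ∃ K : ℝ, ∀ᶠ y in 𝓝 y₀,
      |divergence (fun y => W (y, fderiv ℝ ψ y)) y - divergence (fun y => W (y, fderiv ℝ φ y)) y -
        ∑ i, fderiv ℝ W (y, fderiv ℝ φ y) (0, (fderiv ℝ (fderiv ℝ ψ) y - fderiv ℝ (fderiv ℝ φ) y)
          (EuclideanSpace.single i 1)) i| ≤ K * ‖fderiv ℝ ψ y - fderiv ℝ φ y‖ := by
  have hφ1 : ContDiffAt ℝ 2 (fderiv ℝ φ) y₀ :=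
    (hφ.fderiv_right (m := ∞) (by simp)).of_le two_le_smooth
  have hψ1 : ContDiffAt ℝ 2 (fderiv ℝ ψ) y₀ :=
    (hψ.fderiv_right (m := ∞) (by simp)).of_le two_le_smooth
  obtain ⟨K, s, hs, hK⟩ := (hW.fderiv_right (m := 1) (by norm_num)).exists_lipschitzOnWith
  have hPφ : Tendsto (fun y => (y, fderiv ℝ φ y)) (𝓝 y₀) (𝓝 (y₀, fderiv ℝ φ y₀)) :=
    (continuousAt_id.prodMk hφ1.continuousAt).tendsto
  have hPψ : Tendsto (fun y => (y, fderiv ℝ ψ y)) (𝓝 y₀) (𝓝 (y₀, fderiv ℝ φ y₀)) := by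
    have := (continuousAt_id.prodMk hψ1.continuousAt).tendsto
    simpa [hd] using! this
  have hψ2 : ContDiffAt ℝ 1 (fderiv ℝ (fderiv ℝ ψ)) y₀ := hψ1.fderiv_right (by norm_num)
  have hψn : ContinuousAt (fun y => ‖fderiv ℝ (fderiv ℝ ψ) y‖) y₀ :=
    (continuous_norm (E := 𝔼 n →L[ℝ] 𝔼 n →L[ℝ] ℝ)).continuousAt.comp hψ2.continuousAt
  set C := ‖fderiv ℝ (fderiv ℝ ψ) y₀‖ + 1 with hC
  refine ⟨n * (K * (1 + C)), ?_⟩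
  have hWd : ∀ᶠ w in 𝓝 (y₀, fderiv ℝ φ y₀), DifferentiableAt ℝ W w :=
    (hW.eventually (by simp)).mono fun w hw => hw.differentiableAt (by norm_num)
  filter_upwards [hPφ.eventually hs, hPψ.eventually hs, hPφ.eventually hWd, hPψ.eventually hWd,
    hφ1.eventually (by simp), hψ1.eventually (by simp),
    hψn.eventually_lt_const (show ‖fderiv ℝ (fderiv ℝ ψ) y₀‖ < C by rw [hC]; linarith)]
    with y h1 h2 h3 h4 h5 h6 h7
  have hder : ∀ χ : 𝔼 n → ℝ, DifferentiableAt ℝ W (y, fderiv ℝ χ y) →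
      ContDiffAt ℝ 2 (fderiv ℝ χ) y → ∀ v, fderiv ℝ (fun y => W (y, fderiv ℝ χ y)) y v =
        fderiv ℝ W (y, fderiv ℝ χ y) (v, fderiv ℝ (fderiv ℝ χ) y v) := fun χ hW' hχ v => by
    have e1 := (hasFDerivAt_id y).prodMk (hχ.differentiableAt (by norm_num)).hasFDerivAt
    have e2 := hW'.hasFDerivAt.comp y e1
    exact congrArg (fun L => L v) e2.fderiv
  have hterm : ∀ i : Fin n, ∀ v : 𝔼 n, ‖v‖ ≤ 1 →
      |(fderiv ℝ (fun y => W (y, fderiv ℝ ψ y)) y v - fderiv ℝ (fun y => W (y, fderiv ℝ φ y)) y v -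
        fderiv ℝ W (y, fderiv ℝ φ y) (0, (fderiv ℝ (fderiv ℝ ψ) y - fderiv ℝ (fderiv ℝ φ) y) v)) i|
        ≤ K * (1 + C) * ‖fderiv ℝ ψ y - fderiv ℝ φ y‖ := fun i v hv => by
    rw [hder ψ h4 h6, hder φ h3 h5]
    have e : fderiv ℝ W (y, fderiv ℝ ψ y) (v, fderiv ℝ (fderiv ℝ ψ) y v) -
        fderiv ℝ W (y, fderiv ℝ φ y) (v, fderiv ℝ (fderiv ℝ φ) y v) -
        fderiv ℝ W (y, fderiv ℝ φ y) (0, (fderiv ℝ (fderiv ℝ ψ) y - fderiv ℝ (fderiv ℝ φ) y) v) =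
        (fderiv ℝ W (y, fderiv ℝ ψ y) - fderiv ℝ W (y, fderiv ℝ φ y))
          (v, fderiv ℝ (fderiv ℝ ψ) y v) := by
      rw [sub_sub, ← map_add, sub_apply]
      simp
    rw [e]
    rw [← Real.norm_eq_abs]
    refine (PiLp.norm_apply_le _ i).trans ?_
    refine (ContinuousLinearMap.le_opNorm _ _).trans ?_
    have e1 : ‖fderiv ℝ W (y, fderiv ℝ ψ y) - fderiv ℝ W (y, fderiv ℝ φ y)‖ ≤
        K * ‖fderiv ℝ ψ y - fderiv ℝ φ y‖ := by
      refine (hK.norm_sub_le h2 h1).trans ?_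
      simp [Prod.norm_def]
    have e2 : ‖(v, fderiv ℝ (fderiv ℝ ψ) y v)‖ ≤ 1 + C := by
      have hC0 : 0 ≤ C := by positivity
      have e3 : ‖fderiv ℝ (fderiv ℝ ψ) y v‖ ≤ C :=
        (ContinuousLinearMap.le_opNorm _ _).trans
          ((mul_le_mul h7.le hv (norm_nonneg _) hC0).trans (by simp))
      rw [Prod.norm_def]
      exact max_le (by linarith) (by linarith)
    calc _ ≤ (K * ‖fderiv ℝ ψ y - fderiv ℝ φ y‖) * (1 + C) :=
          mul_le_mul e1 e2 (norm_nonneg _) (by positivity)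
      _ = _ := by ring
  simp only [divergence, ← Finset.sum_sub_distrib]
  refine (Finset.abs_sum_le_sum_abs _ _).trans ?_
  refine (Finset.sum_le_card_nsmul _ _ (K * (1 + C) * ‖fderiv ℝ ψ y - fderiv ℝ φ y‖)
    fun i _ => ?_).trans ?_
  · simpa using hterm i (EuclideanSpace.single i 1) (by simp)
  · simp [mul_assoc]

/-- The difference of two solutions of a quasilinear differential inequality in divergence form
satisfies a linear one. -/
theorem exists_contraction_le {G : 𝔼 n → (𝔼 n →L[ℝ] ℝ) →L[ℝ] 𝔼 n} {ρ : 𝔼 n → ℝ} {φ ψ : 𝔼 n → ℝ}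
    {b : 𝔼 n × ℝ × (𝔼 n →L[ℝ] ℝ) → ℝ} {y₀ : 𝔼 n} {p : ℝ}
    (hG : ContDiffAt ℝ ∞ G y₀) (hρ : ContDiffAt ℝ ∞ ρ y₀) (hρ0 : ρ y₀ ≠ 0)
    (hs : ∀ᶠ y in 𝓝 y₀, ∀ θ η : 𝔼 n →L[ℝ] ℝ, θ (G y η) = η (G y θ))
    (hφ : ContDiffAt ℝ ∞ φ y₀) (hψ : ContDiffAt ℝ ∞ ψ y₀) (hφψ : ψ y₀ = φ y₀)
    (hd : fderiv ℝ ψ y₀ = fderiv ℝ φ y₀)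
    (hb : ContDiffAt ℝ 1 b (y₀, φ y₀, fderiv ℝ φ y₀))
    (hq : 0 < fderiv ℝ φ y₀ (G y₀ (fderiv ℝ φ y₀)))
    (hH : ∀ᶠ y in 𝓝 y₀,
      (ρ y)⁻¹ * divergence (fun y => ρ y • flux p (G y) (fderiv ℝ ψ y)) y +
          b (y, ψ y, fderiv ℝ ψ y) ≤
        (ρ y)⁻¹ * divergence (fun y => ρ y • flux p (G y) (fderiv ℝ φ y)) y +
          b (y, φ y, fderiv ℝ φ y)) :
    ∃ K : ℝ, ∀ᶠ y in 𝓝 y₀, contraction (fluxSymbol p (G y) (fderiv ℝ φ y))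
      (fderiv ℝ (fderiv ℝ (fun y => ψ y - φ y)) y) ≤
        K * (‖fderiv ℝ (fun y => ψ y - φ y) y‖ + |ψ y - φ y|) := by
  set W : 𝔼 n × (𝔼 n →L[ℝ] ℝ) → 𝔼 n := fun w => ρ w.1 • flux p (G w.1) w.2 with hWdef
  have hW : ContDiffAt ℝ 2 W (y₀, fderiv ℝ φ y₀) :=
    ((hρ.comp (y₀, fderiv ℝ φ y₀) contDiffAt_fst).smul
      (contDiffAt_flux (hG.comp (y₀, fderiv ℝ φ y₀) contDiffAt_fst) contDiffAt_snd hq)).of_le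
        two_le_smooth
  obtain ⟨K₁, hK₁⟩ := abs_divergence_sub_le hφ hψ hd hW
  obtain ⟨K₂, s, hsb, hK₂⟩ := hb.exists_lipschitzOnWith
  have hφ1 : ContDiffAt ℝ 2 (fderiv ℝ φ) y₀ :=
    (hφ.fderiv_right (m := ∞) (by simp)).of_le two_le_smooth
  have hψ1 : ContDiffAt ℝ 2 (fderiv ℝ ψ) y₀ :=
    (hψ.fderiv_right (m := ∞) (by simp)).of_le two_le_smooth
  have hPφ : Tendsto (fun y => (y, fderiv ℝ φ y)) (𝓝 y₀) (𝓝 (y₀, fderiv ℝ φ y₀)) :=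
    (continuousAt_id.prodMk hφ1.continuousAt).tendsto
  have hJφ : Tendsto (fun y => (y, φ y, fderiv ℝ φ y)) (𝓝 y₀) (𝓝 (y₀, φ y₀, fderiv ℝ φ y₀)) :=
    (continuousAt_id.prodMk (hφ.continuousAt.prodMk hφ1.continuousAt)).tendsto
  -- Both 1-jets tend to the same point because the functions touch to first order at `y₀`, so one
  -- neighbourhood on which `b` is Lipschitz serves for both.
  have hJψ : Tendsto (fun y => (y, ψ y, fderiv ℝ ψ y)) (𝓝 y₀) (𝓝 (y₀, φ y₀, fderiv ℝ φ y₀)) := by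
    have := (continuousAt_id.prodMk (hψ.continuousAt.prodMk hψ1.continuousAt)).tendsto
    simpa [hd, hφψ] using! this
  have hN : ContinuousAt (fun y => fderiv ℝ φ y (G y (fderiv ℝ φ y))) y₀ :=
    hφ1.continuousAt.clm_apply (hG.continuousAt.clm_apply hφ1.continuousAt)
  have hWd : ∀ᶠ w in 𝓝 (y₀, fderiv ℝ φ y₀), DifferentiableAt ℝ W w :=
    (hW.eventually (by simp)).mono fun w hw => hw.differentiableAt (by norm_num)
  set C := |(ρ y₀)⁻¹| + 1 with hC
  refine ⟨C * |K₁| + K₂, ?_⟩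
  filter_upwards [hK₁, hJφ.eventually hsb, hJψ.eventually hsb, hs, hH,
    hN.eventually_const_lt hq, hρ.continuousAt.eventually_ne hρ0, hPφ.eventually hWd,
    (hρ.continuousAt.inv₀ hρ0).abs.eventually_lt_const (show _ < C by simp [hC]),
    ((hφ.of_le two_le_smooth).eventually (by simp)),
    ((hψ.of_le two_le_smooth).eventually (by simp)).and
      (((hφ.of_le two_le_smooth).eventually (by simp)).eventually_nhds.and
      ((hψ.of_le two_le_smooth).eventually (by simp)).eventually_nhds)]
    with y h1 h2 h3 h4 h5 h6 h7 h8 h9 h10 h11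
  obtain ⟨h11, h12, h13⟩ := h11
  have hu1 : fderiv ℝ (fun y => ψ y - φ y) y = fderiv ℝ ψ y - fderiv ℝ φ y :=
    fderiv_fun_sub (h11.differentiableAt (by norm_num)) (h10.differentiableAt (by norm_num))
  have hu2 : fderiv ℝ (fderiv ℝ (fun y => ψ y - φ y)) y =
      fderiv ℝ (fderiv ℝ ψ) y - fderiv ℝ (fderiv ℝ φ) y := by
    have : fderiv ℝ (fun y => ψ y - φ y) =ᶠ[𝓝 y] fun y => fderiv ℝ ψ y - fderiv ℝ φ y := by
      filter_upwards [h12, h13] with y' e1 e2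
      exact fderiv_fun_sub (e2.differentiableAt (by norm_num)) (e1.differentiableAt (by norm_num))
    rw [this.fderiv_eq]
    exact fderiv_fun_sub ((h11.fderiv_right (m := 1) (by norm_num)).differentiableAt (by norm_num))
      ((h10.fderiv_right (m := 1) (by norm_num)).differentiableAt (by norm_num))
  have hWη : ∀ η : 𝔼 n →L[ℝ] ℝ, fderiv ℝ W (y, fderiv ℝ φ y) (0, η) =
      ρ y • ((√(fderiv ℝ φ y (G y (fderiv ℝ φ y))) ^ (1 - p))⁻¹ • (G y η +
        ((p - 1) / fderiv ℝ φ y (G y (fderiv ℝ φ y)) * fderiv ℝ φ y (G y η)) •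
          G y (fderiv ℝ φ y))) := fun η => by
    have e1 : HasDerivAt (fun t : ℝ => (y, fderiv ℝ φ y + t • η)) (0, η) 0 :=
      (hasDerivAt_const (0 : ℝ) y).prodMk
        (by simpa using ((hasDerivAt_id (0 : ℝ)).smul_const η).const_add (fderiv ℝ φ y))
    have e2 : HasFDerivAt W (fderiv ℝ W (y, fderiv ℝ φ y)) (y, fderiv ℝ φ y + (0 : ℝ) • η) := by
      simpa using h8.hasFDerivAt
    have e3 := e2.comp_hasDerivAt (0 : ℝ) e1
    have e4 := (hasDerivAt_flux (p := p) h4 h6 η).const_smul (ρ y)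
    exact e3.unique e4
  -- Only the covector variable is differentiated here, so the weight `ρ y` is a constant factor and
  -- cancels.
  have hcon : contraction (fluxSymbol p (G y) (fderiv ℝ φ y))
      (fderiv ℝ (fderiv ℝ (fun y => ψ y - φ y)) y) =
      (ρ y)⁻¹ * ∑ i, fderiv ℝ W (y, fderiv ℝ φ y)
        (0, (fderiv ℝ (fderiv ℝ ψ) y - fderiv ℝ (fderiv ℝ φ) y) (EuclideanSpace.single i 1)) i := by
    rw [contraction_fluxSymbol h4, hu2, Finset.mul_sum]
    refine Finset.sum_congr rfl fun i _ => ?_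
    have e : ∀ w : 𝔼 n, w i = (ρ y)⁻¹ * (ρ y • w) i := fun w => by simp [h7]
    rw [hWη]
    exact e _
  set S := ∑ i, fderiv ℝ W (y, fderiv ℝ φ y)
    (0, (fderiv ℝ (fderiv ℝ ψ) y - fderiv ℝ (fderiv ℝ φ) y) (EuclideanSpace.single i 1)) i
  set dψ := divergence (fun y => W (y, fderiv ℝ ψ y)) y
  set dφ := divergence (fun y => W (y, fderiv ℝ φ y)) y
  have h5' : (ρ y)⁻¹ * dψ + b (y, ψ y, fderiv ℝ ψ y) ≤
    (ρ y)⁻¹ * dφ + b (y, φ y, fderiv ℝ φ y) := h5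
  have hbb : b (y, φ y, fderiv ℝ φ y) - b (y, ψ y, fderiv ℝ ψ y) ≤
      K₂ * (‖fderiv ℝ ψ y - fderiv ℝ φ y‖ + |ψ y - φ y|) := by
    refine (le_abs_self _).trans ?_
    rw [← Real.norm_eq_abs, norm_sub_rev]
    refine (hK₂.norm_sub_le h3 h2).trans ?_
    refine mul_le_mul_of_nonneg_left ?_ K₂.2
    simp only [Prod.mk_sub_mk, sub_self, Prod.norm_def, norm_zero, Real.norm_eq_abs]
    have e1 := norm_nonneg (fderiv ℝ ψ y - fderiv ℝ φ y)
    have e2 := abs_nonneg (ψ y - φ y)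
    exact max_le (by linarith) (max_le (by linarith) (by linarith))
  have hKK : (ρ y)⁻¹ * S - (ρ y)⁻¹ * (dψ - dφ) ≤ C * |K₁| * ‖fderiv ℝ ψ y - fderiv ℝ φ y‖ := by
    rw [← mul_sub]
    refine (le_abs_self _).trans ?_
    rw [abs_mul, abs_sub_comm, mul_assoc]
    refine mul_le_mul h9.le (h1.trans ?_) (abs_nonneg _) (by positivity)
    exact mul_le_mul_of_nonneg_right (le_abs_self _) (norm_nonneg _)
  rw [hcon, hu1]
  have e3 : 0 ≤ C * |K₁| * |ψ y - φ y| := by positivity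
  linarith

end Linearization

/-! ### Coordinate expressions -/

section Chart

theorem ContDiffAt.smul_const_vector {X F : Type*} [NormedAddCommGroup X] [NormedSpace ℝ X]
    [NormedAddCommGroup F] [NormedSpace ℝ F] {k : WithTop ℕ∞} {f : X → ℝ} {x : X}
    (hf : ContDiffAt ℝ k f x) (c : F) : ContDiffAt ℝ k (fun x => f x • c) x :=
  hf.smul contDiffAt_const

variable {m : ℕ} {M : Type*} [TopologicalSpace M] [ChartedSpace (EuclideanSpace ℝ (Fin (m + 1))) M]

local notation "𝔼" d:max => EuclideanSpace ℝ (Fin d)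

/-- The derivative of the chart at `x₀`, at the point with coordinates `y`. -/
noncomputable def chartDeriv (x₀ : M) (y : 𝔼 (m + 1)) :
    TangentSpace (𝓡 (m + 1)) ((extChartAt (𝓡 (m + 1)) x₀).symm y) →L[ℝ] 𝔼 (m + 1) :=
  mfderiv (𝓡 (m + 1)) 𝓘(ℝ, 𝔼 (m + 1)) (extChartAt (𝓡 (m + 1)) x₀)
    ((extChartAt (𝓡 (m + 1)) x₀).symm y)

/-- The derivative of the inverse of the chart at `x₀`, at the point with coordinates `y`. -/
noncomputable def chartSymmDeriv (x₀ : M) (y : 𝔼 (m + 1)) :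
    𝔼 (m + 1) →L[ℝ] TangentSpace (𝓡 (m + 1)) ((extChartAt (𝓡 (m + 1)) x₀).symm y) :=
  mfderiv 𝓘(ℝ, 𝔼 (m + 1)) (𝓡 (m + 1)) (extChartAt (𝓡 (m + 1)) x₀).symm y

/-- The map raising indices, in the chart at `x₀`. -/
noncomputable def raiseInChart (g : CoMetric m M) (x₀ : M) (y : 𝔼 (m + 1)) :
    (𝔼 (m + 1) →L[ℝ] ℝ) →L[ℝ] 𝔼 (m + 1) :=
  ∑ i, ∑ j, g.inner ((extChartAt (𝓡 (m + 1)) x₀).symm y)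
      ((EuclideanSpace.proj i : 𝔼 (m + 1) →L[ℝ] ℝ).comp (chartDeriv x₀ y))
      ((EuclideanSpace.proj j : 𝔼 (m + 1) →L[ℝ] ℝ).comp (chartDeriv x₀ y)) •
    (ContinuousLinearMap.apply ℝ ℝ (EuclideanSpace.single j (1 : ℝ) : 𝔼 (m + 1))).smulRight
      (EuclideanSpace.single i (1 : ℝ))

theorem apply_raiseInChart {x₀ : M} {y : 𝔼 (m + 1)} (g : CoMetric m M) (θ η : 𝔼 (m + 1) →L[ℝ] ℝ) :
    θ (raiseInChart g x₀ y η) = g.inner ((extChartAt (𝓡 (m + 1)) x₀).symm y)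
      (θ.comp (chartDeriv x₀ y)) (η.comp (chartDeriv x₀ y)) := by
  have hc : ∀ θ : 𝔼 (m + 1) →L[ℝ] ℝ, θ.comp (chartDeriv x₀ y) =
      ∑ i, θ (EuclideanSpace.single i 1) •
        ((EuclideanSpace.proj i : 𝔼 (m + 1) →L[ℝ] ℝ).comp (chartDeriv x₀ y)) := fun θ => by
    conv_lhs => rw [covector_eq_sum θ]
    rw [ContinuousLinearMap.finsetSum_comp]
    rfl
  rw [hc θ, hc η]
  simp only [raiseInChart, map_sum, map_smul, sum_apply, smul_apply, LinearMap.sum_apply,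
    LinearMap.smul_apply, smul_eq_mul, ContinuousLinearMap.smulRight_apply,
    ContinuousLinearMap.apply_apply, Finset.mul_sum]
  rw [Finset.sum_comm]
  refine Finset.sum_congr rfl fun i _ => Finset.sum_congr rfl fun j _ => ?_
  ring

theorem chartDeriv_G {x₀ : M} {y : 𝔼 (m + 1)} (g : CoMetric m M) (θ : 𝔼 (m + 1) →L[ℝ] ℝ) :
    chartDeriv x₀ y (g.G _ (θ.comp (chartDeriv x₀ y))) = raiseInChart g x₀ y θ := by
  ext i
  have h1 := apply_raiseInChart (x₀ := x₀) (y := y) g (EuclideanSpace.proj i) θ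
  have h2 := g.apply_G ((extChartAt (𝓡 (m + 1)) x₀).symm y)
    ((EuclideanSpace.proj i : 𝔼 (m + 1) →L[ℝ] ℝ).comp (chartDeriv x₀ y))
    (θ.comp (chartDeriv x₀ y))
  exact h2.trans h1.symm

variable [IsManifold (𝓡 (m + 1)) ∞ M] {x₀ : M} {y : 𝔼 (m + 1)}

theorem chartDeriv_chartSymmDeriv (hy : y ∈ (extChartAt (𝓡 (m + 1)) x₀).target) (v : 𝔼 (m + 1)) :
    chartDeriv x₀ y (chartSymmDeriv x₀ y v) = v := by
  have h := mfderiv_extChartAt_comp_mfderivWithin_extChartAt_symm (I := 𝓡 (m + 1)) hy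
  rw [ModelWithCorners.range_eq_univ, mfderivWithin_univ] at h
  exact congrArg (fun L => L v) h

theorem chartSymmDeriv_chartDeriv (hy : y ∈ (extChartAt (𝓡 (m + 1)) x₀).target)
    (v : TangentSpace (𝓡 (m + 1)) ((extChartAt (𝓡 (m + 1)) x₀).symm y)) :
    chartSymmDeriv x₀ y (chartDeriv x₀ y v) = v := by
  have h := mfderivWithin_extChartAt_symm_comp_mfderiv_extChartAt (I := 𝓡 (m + 1)) hy
  rw [ModelWithCorners.range_eq_univ, mfderivWithin_univ] at h
  exact congrArg (fun L => L v) h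

theorem contMDiffAt_chart_symm (hy : y ∈ (extChartAt (𝓡 (m + 1)) x₀).target) :
    ContMDiffAt 𝓘(ℝ, 𝔼 (m + 1)) (𝓡 (m + 1)) ∞ (extChartAt (𝓡 (m + 1)) x₀).symm y :=
  (contMDiffOn_extChartAt_symm x₀).contMDiffAt ((isOpen_extChartAt_target x₀).mem_nhds hy)

theorem contDiffAt_comp_chart_symm (hy : y ∈ (extChartAt (𝓡 (m + 1)) x₀).target) {f : M → ℝ}
    (hf : ContMDiffAt (𝓡 (m + 1)) 𝓘(ℝ, ℝ) ∞ f ((extChartAt (𝓡 (m + 1)) x₀).symm y)) :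
    ContDiffAt ℝ ∞ (fun y => f ((extChartAt (𝓡 (m + 1)) x₀).symm y)) y :=
  contMDiffAt_iff_contDiffAt.1 (hf.comp y (contMDiffAt_chart_symm hy))

theorem differential_eq_comp (hy : y ∈ (extChartAt (𝓡 (m + 1)) x₀).target) {f : M → ℝ}
    (hf : MDifferentiableAt (𝓡 (m + 1)) 𝓘(ℝ, ℝ) f ((extChartAt (𝓡 (m + 1)) x₀).symm y)) :
    differential f ((extChartAt (𝓡 (m + 1)) x₀).symm y) =
      (fderiv ℝ (fun y => f ((extChartAt (𝓡 (m + 1)) x₀).symm y)) y).comp (chartDeriv x₀ y) := by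
  have h1 := mfderiv_comp (I := 𝓘(ℝ, 𝔼 (m + 1))) y hf
    ((contMDiffAt_chart_symm hy).mdifferentiableAt (by simp))
  have h2 : fderiv ℝ (fun y => f ((extChartAt (𝓡 (m + 1)) x₀).symm y)) y =
      (mfderiv (𝓡 (m + 1)) 𝓘(ℝ, ℝ) f ((extChartAt (𝓡 (m + 1)) x₀).symm y)).comp
        (chartSymmDeriv x₀ y) := by
    rw [← mfderiv_eq_fderiv]
    exact h1
  ext v
  rw [h2]
  change _ = mfderiv (𝓡 (m + 1)) 𝓘(ℝ, ℝ) f ((extChartAt (𝓡 (m + 1)) x₀).symm y)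
    (chartSymmDeriv x₀ y (chartDeriv x₀ y v))
  rw [chartSymmDeriv_chartDeriv hy]
  rfl

/-- The coefficients are `⟨dxⁱ, dxʲ⟩` for the coordinate functions of the chart, to which `g.smooth`
applies. -/
theorem contDiffAt_raiseInChart (g : CoMetric m M)
    (hy : y ∈ (extChartAt (𝓡 (m + 1)) x₀).target) : ContDiffAt ℝ ∞ (raiseInChart g x₀) y := by
  unfold raiseInChart
  refine ContDiffAt.sum fun i _ => ContDiffAt.sum fun j _ => ?_
  suffices h : ContDiffAt ℝ ∞ (fun y => g.inner ((extChartAt (𝓡 (m + 1)) x₀).symm y)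
      ((EuclideanSpace.proj i : 𝔼 (m + 1) →L[ℝ] ℝ).comp (chartDeriv x₀ y))
      ((EuclideanSpace.proj j : 𝔼 (m + 1) →L[ℝ] ℝ).comp (chartDeriv x₀ y))) y from
    h.smul_const_vector _
  have hcoord : ∀ i : Fin (m + 1), ContMDiffOn (𝓡 (m + 1)) 𝓘(ℝ, ℝ) ∞
      (fun x => extChartAt (𝓡 (m + 1)) x₀ x i) (extChartAt (𝓡 (m + 1)) x₀).source := fun i => by
    rw [extChartAt_source]
    exact ((EuclideanSpace.proj i : 𝔼 (m + 1) →L[ℝ] ℝ).contMDiff.comp_contMDiffOn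
      contMDiffOn_extChartAt)
  have hs := g.smooth (extChartAt (𝓡 (m + 1)) x₀).source _ _ (isOpen_extChartAt_source x₀)
    (hcoord i) (hcoord j)
  have h1 := contDiffAt_comp_chart_symm hy (hs.contMDiffAt
    ((isOpen_extChartAt_source x₀).mem_nhds ((extChartAt (𝓡 (m + 1)) x₀).map_target hy)))
  refine h1.congr_of_eventuallyEq ?_
  have hd : ∀ i : Fin (m + 1), ∀ y ∈ (extChartAt (𝓡 (m + 1)) x₀).target,
      (EuclideanSpace.proj i : 𝔼 (m + 1) →L[ℝ] ℝ).comp (chartDeriv x₀ y) =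
        differential (fun x => extChartAt (𝓡 (m + 1)) x₀ x i)
          ((extChartAt (𝓡 (m + 1)) x₀).symm y) := fun i y hy => by
    have hmd : MDifferentiableAt (𝓡 (m + 1)) 𝓘(ℝ, ℝ) (fun x => extChartAt (𝓡 (m + 1)) x₀ x i)
        ((extChartAt (𝓡 (m + 1)) x₀).symm y) :=
      ((hcoord i).contMDiffAt ((isOpen_extChartAt_source x₀).mem_nhds
        ((extChartAt (𝓡 (m + 1)) x₀).map_target hy))).mdifferentiableAt (by simp)
    rw [differential_eq_comp hy hmd]
    congr 1
    have : (fun y => extChartAt (𝓡 (m + 1)) x₀ ((extChartAt (𝓡 (m + 1)) x₀).symm y) i) =ᶠ[𝓝 y]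
        (EuclideanSpace.proj i : 𝔼 (m + 1) →L[ℝ] ℝ) := by
      filter_upwards [(isOpen_extChartAt_target x₀).mem_nhds hy] with y' hy'
      rw [(extChartAt (𝓡 (m + 1)) x₀).right_inv hy']
      rfl
    rw [this.fderiv_eq]
    exact (ContinuousLinearMap.fderiv _).symm
  filter_upwards [(isOpen_extChartAt_target x₀).mem_nhds hy] with y' hy'
  rw [hd i y' hy', hd j y' hy']

end Chart

/-! ### The mean curvature in coordinates -/

section MeanCurvature

local notation "𝔼" d:max => EuclideanSpace ℝ (Fin d)

theorem apply_basis_ne_zero {n : ℕ} {β : 𝔼 n [⋀^Fin n]→L[ℝ] ℝ} (hβ : β ≠ 0) :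
    β (EuclideanSpace.basisFun (Fin n) ℝ) ≠ 0 := by
  intro h0
  apply hβ
  apply ContinuousAlternatingMap.toAlternatingMap_injective
  have := β.toAlternatingMap.eq_smul_basis_det (EuclideanSpace.basisFun (Fin n) ℝ).toBasis
  rw [this]
  simp [h0]

theorem eq_smul_of_ne_zero {n : ℕ} (α : 𝔼 n [⋀^Fin n]→L[ℝ] ℝ) {β : 𝔼 n [⋀^Fin n]→L[ℝ] ℝ}
    (hβ : β ≠ 0) :
    α = (α (EuclideanSpace.basisFun (Fin n) ℝ) / β (EuclideanSpace.basisFun (Fin n) ℝ)) • β := by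
  have key : ∀ α : 𝔼 n [⋀^Fin n]→L[ℝ] ℝ,
      α.toAlternatingMap = α (EuclideanSpace.basisFun (Fin n) ℝ) •
        (EuclideanSpace.basisFun (Fin n) ℝ).toBasis.det := fun α => by
    simpa using α.toAlternatingMap.eq_smul_basis_det (EuclideanSpace.basisFun (Fin n) ℝ).toBasis
  apply ContinuousAlternatingMap.toAlternatingMap_injective
  rw [ContinuousAlternatingMap.toAlternatingMap_smul, key β, smul_smul,
    div_mul_cancel₀ _ (apply_basis_ne_zero hβ), key α]

variable {m : ℕ}

/-- Contraction with a form of top degree on `ℝ^{m+1}`, as a continuous linear map. -/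
noncomputable def contractCLM (α : 𝔼 (m + 1) [⋀^Fin (m + 1)]→L[ℝ] ℝ) :
    𝔼 (m + 1) →L[ℝ] (𝔼 (m + 1) [⋀^Fin m]→L[ℝ] ℝ) :=
  LinearMap.toContinuousLinearMap
    { toFun := fun v => contract (M := 𝔼 (m + 1)) (x := (0 : 𝔼 (m + 1))) v α
      map_add' := fun v w => by
        ext u
        exact α.map_vecCons_add u v w
      map_smul' := fun c v => by
        ext u
        exact α.map_vecCons_smul u c v }

theorem contractCLM_apply (α : 𝔼 (m + 1) [⋀^Fin (m + 1)]→L[ℝ] ℝ) (v : 𝔼 (m + 1))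
    (u : Fin m → 𝔼 (m + 1)) : contractCLM α v u = α (Matrix.vecCons v u) := rfl

theorem contractCLM_smul (c : ℝ) (α : 𝔼 (m + 1) [⋀^Fin (m + 1)]→L[ℝ] ℝ) (v : 𝔼 (m + 1)) :
    contractCLM (c • α) v = contractCLM α (c • v) := by
  ext u
  rw [contractCLM_apply, map_smul]
  rfl

/-- The exterior derivative of the contraction of a constant volume form with a vector field is
given by the divergence. -/
theorem extDeriv_contractCLM_apply_basis (α : 𝔼 (m + 1) [⋀^Fin (m + 1)]→L[ℝ] ℝ)
    {V : 𝔼 (m + 1) → 𝔼 (m + 1)} {y : 𝔼 (m + 1)} (hV : DifferentiableAt ℝ V y) :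
    extDeriv (fun y => contractCLM α (V y)) y (EuclideanSpace.basisFun (Fin (m + 1)) ℝ) =
      divergence V y * α (EuclideanSpace.basisFun (Fin (m + 1)) ℝ) := by
  set e : Fin (m + 1) → 𝔼 (m + 1) := ⇑(EuclideanSpace.basisFun (Fin (m + 1)) ℝ) with he
  have hd : HasFDerivAt (fun y => contractCLM α (V y)) ((contractCLM α).comp (fderiv ℝ V y)) y :=
    (contractCLM α).hasFDerivAt.comp y hV.hasFDerivAt
  have hd' : ∀ w v, fderiv ℝ (fun y => contractCLM α (V y) w) y v =
      (contractCLM α).comp (fderiv ℝ V y) v w := fun w v => by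
    have := ((ContinuousAlternatingMap.apply ℝ (𝔼 (m + 1)) ℝ w).hasFDerivAt.comp y hd).fderiv
    exact congrArg (fun L => L v) this
  rw [extDeriv_apply hd.differentiableAt]
  simp only [hd']
  have hdec : ∀ v : 𝔼 (m + 1), v = ∑ j, v j • e j := fun v => by
    simpa [he] using ((EuclideanSpace.basisFun (Fin (m + 1)) ℝ).sum_repr v).symm
  -- For each component, `dVⱼ ∧ ι_{eⱼ} α = (∂ⱼ Vⱼ) α` by `wedge_contract`; the sum over `j` is the
  -- divergence.
  have hj : ∀ j, ∑ i : Fin (m + 1), (-1 : ℤ) ^ (i : ℕ) •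
      (fderiv ℝ V y (e i) j * contractCLM α (e j) (i.removeNth e)) =
        fderiv ℝ V y (e j) j * α e := fun j => by
    have h := wedge_contract (M := 𝔼 (m + 1)) (x := (0 : 𝔼 (m + 1)))
      ((EuclideanSpace.proj j : 𝔼 (m + 1) →L[ℝ] ℝ).comp (fderiv ℝ V y)) (e j) α
    have h2 := congrArg (fun L => L e) h
    exact (AlternatingMap.alternatizeUncurryFin_apply _ _).symm.trans h2
  have hl : ∀ i : Fin (m + 1), (contractCLM α).comp (fderiv ℝ V y) (e i) (i.removeNth e) =
      ∑ j, fderiv ℝ V y (e i) j * contractCLM α (e j) (i.removeNth e) := fun i => by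
    rw [ContinuousLinearMap.comp_apply]
    conv_lhs => rw [hdec (fderiv ℝ V y (e i))]
    simp only [map_sum, map_smul]
    simp
  simp only [hl, Finset.smul_sum]
  rw [Finset.sum_comm]
  simp only [hj, divergence, Finset.sum_mul]
  refine Finset.sum_congr rfl fun j _ => ?_
  simp [he]

variable {M : Type*} [TopologicalSpace M] [ChartedSpace (EuclideanSpace ℝ (Fin (m + 1))) M]

/-- The density of the volume form in the chart at `x₀`. -/
noncomputable def density (dv : VolumeForm m M) (x₀ : M) (y : 𝔼 (m + 1)) : ℝ :=
  dv.form.inChart x₀ y (EuclideanSpace.basisFun (Fin (m + 1)) ℝ)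

variable {x₀ : M} {y : 𝔼 (m + 1)}

theorem contDiffAt_density (dv : VolumeForm m M)
    (hy : y ∈ (extChartAt (𝓡 (m + 1)) x₀).target) : ContDiffAt ℝ ∞ (density dv x₀) y :=
  (ContinuousAlternatingMap.apply ℝ (𝔼 (m + 1)) ℝ
    (EuclideanSpace.basisFun (Fin (m + 1)) ℝ)).contDiff.contDiffAt.comp y
      ((dv.smooth x₀).contDiffAt ((isOpen_extChartAt_target x₀).mem_nhds hy))

variable [IsManifold (𝓡 (m + 1)) ∞ M]

theorem inChart_ne_zero (dv : VolumeForm m M) (hy : y ∈ (extChartAt (𝓡 (m + 1)) x₀).target) :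
    dv.form.inChart x₀ y ≠ 0 := by
  intro h
  apply dv.ne_zero ((extChartAt (𝓡 (m + 1)) x₀).symm y)
  ext v
  have h1 := congrArg (fun L => L fun i => chartDeriv x₀ y (v i)) h
  have h2 : dv.form.inChart x₀ y (fun i => chartDeriv x₀ y (v i)) =
      dv.form ((extChartAt (𝓡 (m + 1)) x₀).symm y)
        (fun i => chartSymmDeriv x₀ y (chartDeriv x₀ y (v i))) := rfl
  simp only [chartSymmDeriv_chartDeriv hy] at h2
  exact h2.symm.trans h1

theorem density_ne_zero (dv : VolumeForm m M) (hy : y ∈ (extChartAt (𝓡 (m + 1)) x₀).target) :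
    density dv x₀ y ≠ 0 := apply_basis_ne_zero (inChart_ne_zero dv hy)

theorem norm_differential (g : CoMetric m M) (hy : y ∈ (extChartAt (𝓡 (m + 1)) x₀).target)
    {φ : M → ℝ}
    (hφ : MDifferentiableAt (𝓡 (m + 1)) 𝓘(ℝ, ℝ) φ ((extChartAt (𝓡 (m + 1)) x₀).symm y)) :
    g.norm (differential φ ((extChartAt (𝓡 (m + 1)) x₀).symm y)) =
      √(fderiv ℝ (fun y => φ ((extChartAt (𝓡 (m + 1)) x₀).symm y)) y (raiseInChart g x₀ y
        (fderiv ℝ (fun y => φ ((extChartAt (𝓡 (m + 1)) x₀).symm y)) y))) := by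
  rw [CoMetric.norm, differential_eq_comp hy hφ, apply_raiseInChart]

theorem areaForm_inChart (g : CoMetric m M) (dv : VolumeForm m M) (p : ℝ)
    (hy : y ∈ (extChartAt (𝓡 (m + 1)) x₀).target) {φ : M → ℝ}
    (hφ : MDifferentiableAt (𝓡 (m + 1)) 𝓘(ℝ, ℝ) φ ((extChartAt (𝓡 (m + 1)) x₀).symm y)) :
    (g.areaForm dv p φ).inChart x₀ y = contractCLM (dv.form.inChart x₀ y)
      (flux p (raiseInChart g x₀ y)
        (fderiv ℝ (fun y => φ ((extChartAt (𝓡 (m + 1)) x₀).symm y)) y)) := by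
  ext u
  set x := (extChartAt (𝓡 (m + 1)) x₀).symm y with hx
  set v : TangentSpace (𝓡 (m + 1)) x :=
    g.G x ((g.norm (differential φ x) ^ (1 - p))⁻¹ • differential φ x) with hv
  have hl : (g.areaForm dv p φ).inChart x₀ y u =
      dv.form x (Matrix.vecCons v fun i => chartSymmDeriv x₀ y (u i)) := rfl
  have hfl : flux p (raiseInChart g x₀ y)
      (fderiv ℝ (fun y => φ ((extChartAt (𝓡 (m + 1)) x₀).symm y)) y) = chartDeriv x₀ y v := by
    rw [hv, norm_differential g hy hφ, map_smul, map_smul, differential_eq_comp hy hφ,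
      chartDeriv_G]
    rfl
  rw [hl, contractCLM_apply, hfl]
  change _ = dv.form x fun i => chartSymmDeriv x₀ y (Matrix.vecCons (chartDeriv x₀ y v) u i)
  congr 1
  funext i
  refine Fin.cases ?_ (fun i => ?_) i
  · exact (chartSymmDeriv_chartDeriv hy v).symm
  · rfl

/-- Forms of top degree are multiples of one another, so the variable volume form can be replaced by
a fixed one with the density moved onto the vector field. This is the shape required by
`extDeriv_contractCLM_apply_basis`. -/
theorem areaForm_inChart_eventuallyEq (g : CoMetric m M) (dv : VolumeForm m M) (p : ℝ)
    (hy : y ∈ (extChartAt (𝓡 (m + 1)) x₀).target) {φ : M → ℝ}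
    (hφ : ContMDiffAt (𝓡 (m + 1)) 𝓘(ℝ, ℝ) ∞ φ ((extChartAt (𝓡 (m + 1)) x₀).symm y)) :
    (g.areaForm dv p φ).inChart x₀ =ᶠ[𝓝 y] fun y' =>
      contractCLM ((density dv x₀ y)⁻¹ • dv.form.inChart x₀ y) (density dv x₀ y' •
        flux p (raiseInChart g x₀ y')
          (fderiv ℝ (fun y => φ ((extChartAt (𝓡 (m + 1)) x₀).symm y)) y')) := by
  have hev : ∀ᶠ x in 𝓝 ((extChartAt (𝓡 (m + 1)) x₀).symm y),
      ContMDiffAt (𝓡 (m + 1)) 𝓘(ℝ, ℝ) 1 φ x :=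
    (contMDiffAt_iff_contMDiffAt_nhds (by simp)).1 (ContMDiffAt.of_le hφ (by simp))
  filter_upwards [(contMDiffAt_chart_symm hy).continuousAt.eventually hev,
    (isOpen_extChartAt_target x₀).mem_nhds hy] with y' h1 h2
  rw [areaForm_inChart g dv p h2 (h1.mdifferentiableAt (by simp)),
    eq_smul_of_ne_zero (dv.form.inChart x₀ y') (inChart_ne_zero dv hy), contractCLM_smul,
    contractCLM_smul, smul_smul]
  congr 2
  rw [div_eq_inv_mul]
  rfl

theorem differentiableAt_areaForm_inChart (g : CoMetric m M) (dv : VolumeForm m M) (p : ℝ)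
    (hy : y ∈ (extChartAt (𝓡 (m + 1)) x₀).target) {φ : M → ℝ}
    (hφ : ContMDiffAt (𝓡 (m + 1)) 𝓘(ℝ, ℝ) ∞ φ ((extChartAt (𝓡 (m + 1)) x₀).symm y))
    (hφ0 : g.norm (differential φ ((extChartAt (𝓡 (m + 1)) x₀).symm y)) ≠ 0) :
    DifferentiableAt ℝ (fun y' => density dv x₀ y' • flux p (raiseInChart g x₀ y')
      (fderiv ℝ (fun y => φ ((extChartAt (𝓡 (m + 1)) x₀).symm y)) y')) y := by
  rw [norm_differential g hy (hφ.mdifferentiableAt (by simp))] at hφ0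
  have h1 := contDiffAt_flux (p := p) (contDiffAt_raiseInChart g hy)
    ((contDiffAt_comp_chart_symm hy hφ).fderiv_right (m := ∞) (by simp))
    (Real.sqrt_ne_zero'.1 hφ0)
  exact ((contDiffAt_density dv hy).smul h1).differentiableAt (by simp)

/-- The exterior derivative on `M` does not depend on the chart. -/
theorem extDeriv_inChart {k : ℕ} (θ : Form m M k) (hy : y ∈ (extChartAt (𝓡 (m + 1)) x₀).target)
    (hθ : DifferentiableAt ℝ (θ.inChart ((extChartAt (𝓡 (m + 1)) x₀).symm y))
      (extChartAt (𝓡 (m + 1)) ((extChartAt (𝓡 (m + 1)) x₀).symm y)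
        ((extChartAt (𝓡 (m + 1)) x₀).symm y))) :
    θ.extDeriv.inChart x₀ y = extDeriv (θ.inChart x₀) y := by
  set x := (extChartAt (𝓡 (m + 1)) x₀).symm y with hx
  -- `Form.extDeriv` uses the preferred chart of the point itself. The transition map `f` compares
  -- it with the fixed chart at `x₀`, and `d` commutes with pullback under `f`.
  set f : 𝔼 (m + 1) → 𝔼 (m + 1) := fun y' =>
    extChartAt (𝓡 (m + 1)) x ((extChartAt (𝓡 (m + 1)) x₀).symm y') with hf
  have hfM : ContMDiffAt 𝓘(ℝ, 𝔼 (m + 1)) 𝓘(ℝ, 𝔼 (m + 1)) ∞ f y :=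
    (contMDiffAt_extChartAt (x := x)).comp y (contMDiffAt_chart_symm hy)
  have hfC : ContDiffAt ℝ ∞ f y := contMDiffAt_iff_contDiffAt.1 hfM
  have hfd : fderiv ℝ f y = (mfderiv (𝓡 (m + 1)) 𝓘(ℝ, 𝔼 (m + 1)) (extChartAt (𝓡 (m + 1)) x) x).comp
      (chartSymmDeriv x₀ y) := by
    rw [← mfderiv_eq_fderiv]
    exact mfderiv_comp y (mdifferentiableAt_extChartAt (mem_chart_source _ x))
      ((contMDiffAt_chart_symm hy).mdifferentiableAt (by simp))
  have hpull : θ.inChart x₀ =ᶠ[𝓝 y] fun y' =>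
      (θ.inChart x (f y')).compContinuousLinearMap (fderiv ℝ f y') := by
    have hsrc : ∀ᶠ y' in 𝓝 y, (extChartAt (𝓡 (m + 1)) x₀).symm y' ∈
        (extChartAt (𝓡 (m + 1)) x).source :=
      (contMDiffAt_chart_symm hy).continuousAt.eventually
        ((isOpen_extChartAt_source x).mem_nhds (mem_extChartAt_source x))
    filter_upwards [hsrc.eventually_nhds, (isOpen_extChartAt_target x₀).mem_nhds hy] with y' h1 h2
    have h1' := h1.self_of_nhds
    have hinv : (extChartAt (𝓡 (m + 1)) x).symm (f y') = (extChartAt (𝓡 (m + 1)) x₀).symm y' :=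
      (extChartAt (𝓡 (m + 1)) x).left_inv h1'
    have hft : f y' ∈ (extChartAt (𝓡 (m + 1)) x).target :=
      (extChartAt (𝓡 (m + 1)) x).map_source h1'
    have hfM' : MDifferentiableAt 𝓘(ℝ, 𝔼 (m + 1)) 𝓘(ℝ, 𝔼 (m + 1)) f y' := by
      refine MDifferentiableAt.comp y' (mdifferentiableAt_extChartAt ?_)
        ((contMDiffAt_chart_symm h2).mdifferentiableAt (by simp))
      rwa [← extChartAt_source (𝓡 (m + 1))]
    have hcomp : mfderiv 𝓘(ℝ, 𝔼 (m + 1)) (𝓡 (m + 1)) (extChartAt (𝓡 (m + 1)) x₀).symm y' =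
        (mfderiv 𝓘(ℝ, 𝔼 (m + 1)) (𝓡 (m + 1)) (extChartAt (𝓡 (m + 1)) x).symm (f y')).comp
          (fderiv ℝ f y') := by
      have e2 : mfderiv 𝓘(ℝ, 𝔼 (m + 1)) 𝓘(ℝ, 𝔼 (m + 1)) f y' = fderiv ℝ f y' := mfderiv_eq_fderiv
      have e1 := mfderiv_comp y' ((contMDiffAt_chart_symm hft).mdifferentiableAt (by simp)) hfM'
      rw [e2] at e1
      have e3 : (extChartAt (𝓡 (m + 1)) x₀).symm =ᶠ[𝓝 y'] (extChartAt (𝓡 (m + 1)) x).symm ∘ f := by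
        filter_upwards [h1] with y'' h3
        exact ((extChartAt (𝓡 (m + 1)) x).left_inv h3).symm
      exact e3.mfderiv_eq.trans e1
    ext u
    have hl : θ.inChart x₀ y' u = θ ((extChartAt (𝓡 (m + 1)) x₀).symm y') fun i =>
      mfderiv 𝓘(ℝ, 𝔼 (m + 1)) (𝓡 (m + 1)) (extChartAt (𝓡 (m + 1)) x₀).symm y' (u i) := rfl
    rw [hl, hcomp]
    change θ ((extChartAt (𝓡 (m + 1)) x₀).symm y') _ =
      θ ((extChartAt (𝓡 (m + 1)) x).symm (f y')) _
    rw [hinv]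
    rfl
  have hp : extDeriv (fun y' => (θ.inChart x (f y')).compContinuousLinearMap (fderiv ℝ f y')) y =
      (extDeriv (θ.inChart x) (f y)).compContinuousLinearMap (fderiv ℝ f y) :=
    extDeriv_pullback hθ hfC (by simp [two_le_smooth])
  rw [hpull.extDeriv_eq, hp, hfd]
  rfl

/-- The mean curvature in coordinates. -/
theorem meanCurvature_eq (g : CoMetric m M) (dv : VolumeForm m M) (p : ℝ)
    (hy : y ∈ (extChartAt (𝓡 (m + 1)) x₀).target) {φ : M → ℝ}
    (hφ : ContMDiffAt (𝓡 (m + 1)) 𝓘(ℝ, ℝ) ∞ φ ((extChartAt (𝓡 (m + 1)) x₀).symm y))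
    (hφ0 : g.norm (differential φ ((extChartAt (𝓡 (m + 1)) x₀).symm y)) ≠ 0) :
    g.meanCurvature dv p φ ((extChartAt (𝓡 (m + 1)) x₀).symm y) = (density dv x₀ y)⁻¹ *
      divergence (fun y => density dv x₀ y • flux p (raiseInChart g x₀ y)
        (fderiv ℝ (fun y => φ ((extChartAt (𝓡 (m + 1)) x₀).symm y)) y)) y := by
  set x := (extChartAt (𝓡 (m + 1)) x₀).symm y with hx
  have hxt := mem_extChartAt_target (I := 𝓡 (m + 1)) x
  have hxx : (extChartAt (𝓡 (m + 1)) x).symm (extChartAt (𝓡 (m + 1)) x x) = x :=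
    extChartAt_to_inv x
  have hdiff : DifferentiableAt ℝ ((g.areaForm dv p φ).inChart x) (extChartAt (𝓡 (m + 1)) x x) := by
    refine DifferentiableAt.congr_of_eventuallyEq ?_
      (areaForm_inChart_eventuallyEq g dv p hxt (by rwa [hxx]))
    exact (contractCLM _).differentiableAt.comp _
      (differentiableAt_areaForm_inChart g dv p hxt (by rwa [hxx]) (by rwa [hxx]))
  have h1 := extDeriv_inChart (g.areaForm dv p φ) hy hdiff
  have h2 : (g.areaForm dv p φ).extDeriv.inChart x₀ y =
      g.meanCurvature dv p φ x • dv.form.inChart x₀ y := by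
    ext u
    change (g.areaForm dv p φ).extDeriv x _ = _
    rw [g.extDeriv_areaForm dv p φ x]
    rfl
  have h3 := congrArg (fun L => L (EuclideanSpace.basisFun (Fin (m + 1)) ℝ)) (h2.symm.trans h1)
  beta_reduce at h3
  rw [(areaForm_inChart_eventuallyEq g dv p hy hφ).extDeriv_eq,
    extDeriv_contractCLM_apply_basis _ (differentiableAt_areaForm_inChart g dv p hy hφ hφ0)] at h3
  -- The fixed form, normalized by its density at `y`, takes the value `1` on the basis.
  have hρ := density_ne_zero dv hy
  have h4 : g.meanCurvature dv p φ x * density dv x₀ y = divergence (fun y => density dv x₀ y •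
      flux p (raiseInChart g x₀ y)
        (fderiv ℝ (fun y => φ ((extChartAt (𝓡 (m + 1)) x₀).symm y)) y)) y *
          ((density dv x₀ y)⁻¹ * density dv x₀ y) := h3
  rw [inv_mul_cancel₀ hρ, mul_one] at h4
  rw [← h4, mul_comm, mul_assoc, mul_inv_cancel₀ hρ, mul_one]

end MeanCurvature

/-! ### Vector fields in coordinates -/

section FieldInChart

variable {m : ℕ} {M : Type*} [TopologicalSpace M] [ChartedSpace (EuclideanSpace ℝ (Fin (m + 1))) M]

local notation "𝔼" d:max => EuclideanSpace ℝ (Fin d)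

/-- The expression of a vector field in the chart at `x₀`. -/
noncomputable def fieldInChart (x₀ : M) (Z : Π x : M, TangentSpace (𝓡 (m + 1)) x) :
    𝔼 (m + 1) → 𝔼 (m + 1) :=
  VectorField.mpullback 𝓘(ℝ, 𝔼 (m + 1)) (𝓡 (m + 1)) (extChartAt (𝓡 (m + 1)) x₀).symm Z

variable [IsManifold (𝓡 (m + 1)) ∞ M] {x₀ : M} {y : 𝔼 (m + 1)}

/-- The derivative of the inverse chart as an isomorphism. -/
noncomputable def chartSymmDerivEquiv (hy : y ∈ (extChartAt (𝓡 (m + 1)) x₀).target) :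
    𝔼 (m + 1) ≃L[ℝ] TangentSpace (𝓡 (m + 1)) ((extChartAt (𝓡 (m + 1)) x₀).symm y) :=
  ContinuousLinearEquiv.equivOfInverse (chartSymmDeriv x₀ y) (chartDeriv x₀ y)
    (chartDeriv_chartSymmDeriv hy) (chartSymmDeriv_chartDeriv hy)

theorem fieldInChart_apply (hy : y ∈ (extChartAt (𝓡 (m + 1)) x₀).target)
    (Z : Π x : M, TangentSpace (𝓡 (m + 1)) x) :
    fieldInChart x₀ Z y = chartDeriv x₀ y (Z ((extChartAt (𝓡 (m + 1)) x₀).symm y)) := by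
  have h := ContinuousLinearMap.inverse_equiv (chartSymmDerivEquiv hy)
  exact congrArg (fun L => L (Z ((extChartAt (𝓡 (m + 1)) x₀).symm y))) h

theorem contDiffAt_fieldInChart (hy : y ∈ (extChartAt (𝓡 (m + 1)) x₀).target)
    {Z : Π x : M, TangentSpace (𝓡 (m + 1)) x}
    (hZ : ContMDiffAt (𝓡 (m + 1)) (𝓡 (m + 1)).tangent ∞
      (fun x => (⟨x, Z x⟩ : TangentBundle (𝓡 (m + 1)) M)) ((extChartAt (𝓡 (m + 1)) x₀).symm y)) :
    ContDiffAt ℝ ∞ (fieldInChart x₀ Z) y := by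
  have : IsManifold (𝓡 (m + 1)) 1 M := .of_le (n := ∞) (by simp)
  exact contMDiffAt_vectorSpace_iff_contDiffAt.1
    (hZ.mpullback_vectorField_preimage (contMDiffAt_chart_symm hy) ⟨chartSymmDerivEquiv hy, rfl⟩
      (by simp))

theorem fieldInChart_mlieBracket (hy : y ∈ (extChartAt (𝓡 (m + 1)) x₀).target)
    {V W : Π x : M, TangentSpace (𝓡 (m + 1)) x}
    (hV : ContMDiffAt (𝓡 (m + 1)) (𝓡 (m + 1)).tangent ∞
      (fun x => (⟨x, V x⟩ : TangentBundle (𝓡 (m + 1)) M)) ((extChartAt (𝓡 (m + 1)) x₀).symm y))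
    (hW : ContMDiffAt (𝓡 (m + 1)) (𝓡 (m + 1)).tangent ∞
      (fun x => (⟨x, W x⟩ : TangentBundle (𝓡 (m + 1)) M)) ((extChartAt (𝓡 (m + 1)) x₀).symm y)) :
    fieldInChart x₀ (VectorField.mlieBracket (𝓡 (m + 1)) V W) y =
      VectorField.lieBracket ℝ (fieldInChart x₀ V) (fieldInChart x₀ W) y := by
  have h2 : minSmoothness ℝ 2 ≤ ∞ := by simp [two_le_smooth]
  have : IsManifold (𝓡 (m + 1)) (minSmoothness ℝ 2) M := .of_le (n := ∞) h2
  have h := VectorField.mpullback_mlieBracket (hV.mdifferentiableAt (by simp))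
    (hW.mdifferentiableAt (by simp)) (contMDiffAt_chart_symm hy) h2
  refine h.trans ?_
  rw [← VectorField.mlieBracketWithin_univ, VectorField.mlieBracketWithin_eq_lieBracketWithin]
  exact congrFun VectorField.lieBracketWithin_univ y

/-- `LieSpan` does not record smoothness, which is needed to transport brackets to the chart. -/
theorem contMDiffAt_of_lieSpan {U : Set M} (hU : IsOpen U) {r : ℕ}
    {X : Fin r → Π x : M, TangentSpace (𝓡 (m + 1)) x} (hX : ∀ i, SmoothFieldOn U (X i))
    {Z : Π x : M, TangentSpace (𝓡 (m + 1)) x} (hZ : LieSpan U X Z) {x : M} (hx : x ∈ U) :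
    ContMDiffAt (𝓡 (m + 1)) (𝓡 (m + 1)).tangent ∞
      (fun x => (⟨x, Z x⟩ : TangentBundle (𝓡 (m + 1)) M)) x := by
  have h2 : minSmoothness ℝ 2 ≤ ∞ := by simp [two_le_smooth]
  have i1 : IsManifold (𝓡 (m + 1)) (minSmoothness ℝ 2) M := .of_le (n := ∞) h2
  have i2 : IsManifold (𝓡 (m + 1)) (((⊤ : ℕ∞) : WithTop ℕ∞) + 1) M := by simpa
  induction hZ with
  | gen i => exact (hX i).contMDiffAt (hU.mem_nhds hx)
  | zero => exact (Bundle.contMDiff_zeroSection ℝ (TangentSpace (𝓡 (m + 1)) (M := M))).contMDiffAt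
  | add _ _ hV hW => exact hV.add_section hW
  | smul f hf _ hV => exact (hf.contMDiffAt (hU.mem_nhds hx)).smul_section hV
  | bracket _ _ hV hW => exact hV.mlieBracket_vectorField hW (by simp)

/-- A property of vector fields on `ℝ^{m+1}` which is stable under the operations generating
`£(X₁, …, X_r)` passes from the `Xᵢ` to all of `£(X₁, …, X_r)`. -/
theorem LieSpan.induction_inChart {U : Set M} (hU : IsOpen U) {r : ℕ}
    {X : Fin r → Π x : M, TangentSpace (𝓡 (m + 1)) x} (hX : ∀ i, SmoothFieldOn U (X i))
    {O : Set (𝔼 (m + 1))} (hOt : O ⊆ (extChartAt (𝓡 (m + 1)) x₀).target)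
    (hOU : ∀ y ∈ O, (extChartAt (𝓡 (m + 1)) x₀).symm y ∈ U)
    {P : (𝔼 (m + 1) → 𝔼 (m + 1)) → Prop}
    (hcongr : ∀ V W, P V → EqOn V W O → P W) (hzero : P 0)
    (hadd : ∀ V W, P V → P W → P (V + W))
    (hsmul : ∀ (f : 𝔼 (m + 1) → ℝ) V, P V → P fun y => f y • V y)
    (hbracket : ∀ V W, ContDiffOn ℝ ∞ V O → ContDiffOn ℝ ∞ W O → P V → P W →
      P (VectorField.lieBracket ℝ V W))
    (hgen : ∀ i, P (fieldInChart x₀ (X i)))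
    {Z : Π x : M, TangentSpace (𝓡 (m + 1)) x} (hZ : LieSpan U X Z) :
    P (fieldInChart x₀ Z) := by
  induction hZ with
  | gen i => exact hgen i
  | zero =>
    refine hcongr _ _ hzero fun y hy => ?_
    rw [fieldInChart_apply (hOt hy)]
    exact (map_zero _).symm
  | add _ _ hV hW =>
    refine hcongr _ _ (hadd _ _ hV hW) fun y hy => ?_
    rw [Pi.add_apply]
    simp only [fieldInChart_apply (hOt hy)]
    exact (map_add _ _ _).symm
  | smul f hf _ hV =>
    refine hcongr _ _ (hsmul (fun y => f ((extChartAt (𝓡 (m + 1)) x₀).symm y)) _ hV) fun y hy => ?_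
    simp only [fieldInChart_apply (hOt hy)]
    exact (map_smul _ _ _).symm
  | bracket hV' hW' hV hW =>
    have hs : ∀ {Z}, LieSpan U X Z → ContDiffOn ℝ ∞ (fieldInChart x₀ Z) O := fun hZ y hy =>
      (contDiffAt_fieldInChart (hOt hy)
        (contMDiffAt_of_lieSpan hU hX hZ (hOU y hy))).contDiffWithinAt
    refine hcongr _ _ (hbracket _ _ (hs hV') (hs hW') hV hW) fun y hy => ?_
    exact (fieldInChart_mlieBracket (hOt hy) (contMDiffAt_of_lieSpan hU hX hV' (hOU y hy))
      (contMDiffAt_of_lieSpan hU hX hW' (hOU y hy))).symm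

/-- The span of `£(X₁, …, X_r)` in the coordinates of a chart. -/
def lieSpanInChart (x₀ : M) (U : Set M) {r : ℕ} (X : Fin r → Π x : M, TangentSpace (𝓡 (m + 1)) x)
    (y : 𝔼 (m + 1)) : Submodule ℝ (𝔼 (m + 1)) :=
  Submodule.span ℝ {v | ∃ Z, LieSpan U X Z ∧ fieldInChart x₀ Z y = v}

theorem finrank_lieSpanInChart (hy : y ∈ (extChartAt (𝓡 (m + 1)) x₀).target) (U : Set M) {r : ℕ}
    (X : Fin r → Π x : M, TangentSpace (𝓡 (m + 1)) x) :
    Module.finrank ℝ (lieSpanInChart x₀ U X y) =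
      lieRank U X ((extChartAt (𝓡 (m + 1)) x₀).symm y) := by
  have h : lieSpanInChart x₀ U X y = (Submodule.span ℝ {v | ∃ Z, LieSpan U X Z ∧
      Z ((extChartAt (𝓡 (m + 1)) x₀).symm y) = v}).map
        ((chartSymmDerivEquiv hy).symm.toLinearEquiv : _ →ₗ[ℝ] 𝔼 (m + 1)) := by
    rw [Submodule.map_span, lieSpanInChart]
    congr 1
    ext v
    constructor
    · rintro ⟨Z, hZ, rfl⟩
      exact ⟨_, ⟨Z, hZ, rfl⟩, (fieldInChart_apply hy Z).symm⟩
    · rintro ⟨_, ⟨Z, hZ, rfl⟩, rfl⟩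
      exact ⟨Z, hZ, fieldInChart_apply hy Z⟩
  rw [h, lieRank]
  exact LinearEquiv.finrank_map_eq _ _

end FieldInChart

/-! ### The contact set of two hypersurfaces in coordinates -/

section ContactSet

local notation "𝔼" d:max => EuclideanSpace ℝ (Fin d)

variable {n : ℕ}

theorem fderiv_eq_of_le_of_eq {φ ψ : 𝔼 n → ℝ} {x : 𝔼 n} (hφ : DifferentiableAt ℝ φ x)
    (hψ : DifferentiableAt ℝ ψ x) (hle : ∀ᶠ y in 𝓝 x, φ y ≤ ψ y) (hx : ψ x = φ x) :
    fderiv ℝ ψ x = fderiv ℝ φ x := by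
  have hmin : IsLocalMin (fun y => ψ y - φ y) x := by
    filter_upwards [hle] with y hy
    rw [hx, sub_self]
    exact sub_nonneg.2 hy
  have h := hmin.fderiv_eq_zero
  rw [fderiv_fun_sub hψ hφ] at h
  exact sub_eq_zero.1 h

/-- Vectors normal to the contact set are orthogonal to the horizontal vectors: to those tangent to
the hypersurface, and to all of them if `p > 0`. -/
theorem eventually_inner_eq_zero_of_normal {G : 𝔼 n → (𝔼 n →L[ℝ] ℝ) →L[ℝ] 𝔼 n} {ρ : 𝔼 n → ℝ}
    {φ ψ : 𝔼 n → ℝ} {b : 𝔼 n × ℝ × (𝔼 n →L[ℝ] ℝ) → ℝ} {y₀ : 𝔼 n} {p : ℝ} (hp : 0 ≤ p)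
    (hG : ContDiffAt ℝ ∞ G y₀) (hρ : ContDiffAt ℝ ∞ ρ y₀) (hρ0 : ρ y₀ ≠ 0)
    (hs : ∀ᶠ y in 𝓝 y₀, ∀ θ η : 𝔼 n →L[ℝ] ℝ, θ (G y η) = η (G y θ))
    (hn : ∀ᶠ y in 𝓝 y₀, ∀ θ : 𝔼 n →L[ℝ] ℝ, 0 ≤ θ (G y θ))
    (hφ : ContDiffAt ℝ ∞ φ y₀) (hψ : ContDiffAt ℝ ∞ ψ y₀) (hφψ : ψ y₀ = φ y₀)
    (hle : ∀ᶠ y in 𝓝 y₀, φ y ≤ ψ y)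
    (hb : ContDiffAt ℝ 1 b (y₀, φ y₀, fderiv ℝ φ y₀))
    (hq : 0 < fderiv ℝ φ y₀ (G y₀ (fderiv ℝ φ y₀)))
    (hH : ∀ᶠ y in 𝓝 y₀,
      (ρ y)⁻¹ * divergence (fun y => ρ y • flux p (G y) (fderiv ℝ ψ y)) y +
          b (y, ψ y, fderiv ℝ ψ y) ≤
        (ρ y)⁻¹ * divergence (fun y => ρ y • flux p (G y) (fderiv ℝ φ y)) y +
          b (y, φ y, fderiv ℝ φ y)) :
    ∀ᶠ x in 𝓝 y₀, ψ x = φ x → ∀ z, (∀ᶠ y in 𝓝 x, ψ y = φ y → dist x z ≤ dist y z) →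
      ∀ η : 𝔼 n →L[ℝ] ℝ, 0 < p ∨ fderiv ℝ φ x (G x η) = 0 → inner ℝ (G x η) (z - x) = 0 := by
  have hd := fderiv_eq_of_le_of_eq (hφ.differentiableAt (by simp)) (hψ.differentiableAt (by simp))
    hle hφψ
  obtain ⟨K, hK⟩ := exists_contraction_le hG hρ hρ0 hs hφ hψ hφψ hd hb hq hH
  have hu : ∀ᶠ y in 𝓝 y₀, ContDiffAt ℝ 2 (fun y => ψ y - φ y) y :=
    ((hψ.sub hφ).of_le two_le_smooth).eventually (by simp)
  have hφ2 : ∀ᶠ y in 𝓝 y₀, ContDiffAt ℝ 2 φ y := (hφ.of_le two_le_smooth).eventually (by simp)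
  have hG2 : ∀ᶠ y in 𝓝 y₀, ContDiffAt ℝ 2 G y := (hG.of_le two_le_smooth).eventually (by simp)
  have hφ' : ContinuousAt (fderiv ℝ φ) y₀ := (hφ.fderiv_right (m := ∞) (by simp)).continuousAt
  have hqc : ContinuousAt (fun y => fderiv ℝ φ y (G y (fderiv ℝ φ y))) y₀ :=
    hφ'.clm_apply (hG.continuousAt.clm_apply hφ')
  have hq' : ∀ᶠ y in 𝓝 y₀, 0 < fderiv ℝ φ y (G y (fderiv ℝ φ y)) :=
    hqc.eventually (lt_mem_nhds hq)
  have hall := ((((((hK.and hu).and hφ2).and hG2).and hs).and hn).and hle).and hq'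
  -- The Hopf lemma at `x` needs every hypothesis on a whole neighbourhood of `x`, which `hz` may
  -- shrink further.
  filter_upwards [hall.eventually_nhds] with x hx hux z hz η hη
  obtain ⟨⟨⟨⟨⟨⟨⟨-, -⟩, hφx⟩, hGx⟩, hsx⟩, hnx⟩, -⟩, hqx⟩ := hx.self_of_nhds
  have hN := hx.and hz
  rw [real_inner_comm]
  refine apply_eq_zero_of_sum_fluxSymbol_nonpos hsx hnx hp hqx ?_ η hη
  refine sum_eq_zero_of_normal (u := fun y => ψ y - φ y) (K := K)
    (a := fun y => fluxSymbol p (G y) (fderiv ℝ φ y)) hN (fun y hy => ?_) (fun y hy => ?_)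
    (fun y hy => ?_) ?_ (fun y hy => ?_) (by simp [hux]) (fun y hy h => ?_)
  · exact hy.1.1.1.1.1.1.1.2
  · exact sub_nonneg.2 hy.1.1.2
  · exact fluxSymbol_posSemidef hy.1.1.1.1.2 hy.1.1.1.2 hp hy.1.2
  · exact continuousAt_fluxSymbol hGx.continuousAt
      (hφx.fderiv_right (m := 1) (by norm_num)).continuousAt hqx
  · exact hy.1.1.1.1.1.1.1.1
  · exact hy.2 (sub_eq_zero.1 h)

/-- With `q` within `R / 2` of a point `y₀` of `F`, a nearest point stays in the ball of radius `R`,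
where tangency is known. -/
theorem exists_nearest {F : Set (𝔼 n)} (hF : IsClosed F) {y₀ q : 𝔼 n} {R : ℝ} (h0 : y₀ ∈ F)
    (hq : q ∈ Metric.ball y₀ (R / 2)) :
    ∃ x ∈ F ∩ Metric.ball y₀ R, ∀ y ∈ F, dist x q ≤ dist y q := by
  obtain ⟨x, hx, hxd⟩ := hF.exists_infDist_eq_dist ⟨y₀, h0⟩ q
  have hmin : ∀ y ∈ F, dist x q ≤ dist y q := fun y hy => by
    rw [dist_comm x, dist_comm y, ← hxd]
    exact Metric.infDist_le_dist_of_mem hy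
  refine ⟨x, ⟨hx, ?_⟩, hmin⟩
  have h1 := hmin y₀ h0
  have h2 := dist_triangle x q y₀
  rw [Metric.mem_ball] at hq ⊢
  rw [dist_comm y₀] at h1
  linarith

/-- A vector field tangent to `F` and to the level sets of `φ` is tangent to their intersection. -/
theorem TangentTo.inner_eq_zero_of_level {F O : Set (𝔼 n)} (hF : IsClosed F) (hO : IsOpen O)
    {V : 𝔼 n → 𝔼 n} (hV : TangentTo F O V) {φ : 𝔼 n → ℝ} (hφ : ∀ y ∈ O, DifferentiableAt ℝ φ y)
    (hVφ : ∀ y ∈ O, fderiv ℝ φ y (V y) = 0) {x z : 𝔼 n} (hx : x ∈ F ∩ O)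
    (hV1 : ContDiffAt ℝ 1 V x) (hz : ∀ y ∈ F, φ y = φ x → dist x z ≤ dist y z) :
    inner ℝ (V x) (z - x) = 0 := by
  obtain ⟨s, hs, hsF⟩ := hV.integralCurve_mem hF (hO.mem_nhds hx.2) hV1
  obtain ⟨δ, hδ, h⟩ := exists_integralCurve_mem hV1 (inter_mem hs (hO.mem_nhds hx.2))
  obtain ⟨γ, hγ0, hγ⟩ := h x (Metric.mem_ball_self hδ)
  have h0 : (0 : ℝ) ∈ Ioo (-δ) δ := ⟨by linarith, hδ⟩
  have hd : ∀ t ∈ Ioo (-δ) δ, HasDerivAt (fun t => φ (γ t)) 0 t := fun t ht => by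
    have := (hφ _ (hγ t ht).2.2).hasFDerivAt.comp_hasDerivAt t (hγ t ht).1
    rwa [hVφ _ (hγ t ht).2.2] at this
  have hconst : ∀ t ∈ Ioo (-δ) δ, φ (γ t) = φ x := fun t ht => by
    have := isOpen_Ioo.is_const_of_deriv_eq_zero isPreconnected_Ioo
      (fun t ht => (hd t ht).differentiableAt.differentiableWithinAt)
      (fun t ht => (hd t ht).deriv) ht h0
    simpa [hγ0] using this
  have hγ' := (hγ 0 h0).1
  rw [hγ0] at hγ'
  -- The integral curve through `x` stays in `F` by invariance and in the level set because `φ` is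
  -- constant along it.
  refine inner_eq_zero_of_integralCurve_mem (F := F ∩ {y | φ y = φ x}) hγ' hγ0 ?_
    fun y hy => hz y hy.1 hy.2
  filter_upwards [Ioo_mem_nhds h0.1 h0.2] with t ht
  exact ⟨hsF γ δ (hγ0 ▸ hx.1) (fun t ht => ⟨(hγ t ht).1, (hγ t ht).2.1⟩) t ht, hconst t ht⟩

/-- Lagrange multipliers: `x` is an extremum of `h` on the level set since `h` vanishes there, and
`dφ ≠ 0` forces `dh` to be a multiple of `dφ`. -/
theorem fderiv_apply_eq_zero_of_level {φ h : 𝔼 n → ℝ} {x v : 𝔼 n} (hφ : ContDiffAt ℝ 1 φ x)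
    (hh : ContDiffAt ℝ 1 h x) (hφx : φ x = 0) (h0 : ∀ᶠ y in 𝓝 x, φ y = 0 → h y = 0)
    (hd : fderiv ℝ φ x ≠ 0) (hv : fderiv ℝ φ x v = 0) : fderiv ℝ h x v = 0 := by
  have hext : IsLocalExtrOn h {y | φ y = φ x} x := by
    left
    rw [IsMinFilter, eventually_nhdsWithin_iff]
    filter_upwards [h0] with y hy hyφ
    rw [hy (hyφ.trans hφx), h0.self_of_nhds hφx]
  obtain ⟨a, b, hab, heq⟩ := hext.exists_multipliers_of_hasStrictFDerivAt_1d
    (hφ.hasStrictFDerivAt (by simp)) (hh.hasStrictFDerivAt (by simp))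
  have hb : b ≠ 0 := by
    rintro rfl
    simp only [zero_smul, add_zero, smul_eq_zero] at heq
    rcases heq with rfl | h
    · exact hab rfl
    · exact hd h
  have := congrArg (fun L => L v) heq
  simpa [hv, hb] using this

/-- The Lie bracket of two vector fields tangent to the hypersurface `φ = 0` is tangent to it. -/
theorem fderiv_lieBracket_eq_zero {φ : 𝔼 n → ℝ} {V W : 𝔼 n → 𝔼 n} {x : 𝔼 n}
    (hφ : ContDiffAt ℝ 2 φ x) (hV : ContDiffAt ℝ 1 V x) (hW : ContDiffAt ℝ 1 W x) (hφx : φ x = 0)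
    (hd : fderiv ℝ φ x ≠ 0) (hVφ : ∀ᶠ y in 𝓝 x, φ y = 0 → fderiv ℝ φ y (V y) = 0)
    (hWφ : ∀ᶠ y in 𝓝 x, φ y = 0 → fderiv ℝ φ y (W y) = 0) :
    fderiv ℝ φ x (VectorField.lieBracket ℝ V W x) = 0 := by
  have hφ' : ContDiffAt ℝ 1 (fderiv ℝ φ) x := hφ.fderiv_right (by norm_num)
  -- Differentiate `dφ(W) = 0` in the tangential direction `V`. The resulting `D²φ(V, W)` is
  -- symmetric and cancels in the bracket.
  have key : ∀ {V W : 𝔼 n → 𝔼 n}, ContDiffAt ℝ 1 W x →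
      (∀ᶠ y in 𝓝 x, φ y = 0 → fderiv ℝ φ y (W y) = 0) → fderiv ℝ φ x (V x) = 0 →
      fderiv ℝ φ x (fderiv ℝ W x (V x)) = -fderiv ℝ (fderiv ℝ φ) x (V x) (W x) := by
    intro V W hW hWφ hVx
    have h := fderiv_apply_eq_zero_of_level (hφ.of_le (by norm_num)) (hφ'.clm_apply hW) hφx hWφ hd
      hVx
    rw [fderiv_clm_apply (hφ'.differentiableAt (by simp)) (hW.differentiableAt (by simp))] at h
    simp only [add_apply, ContinuousLinearMap.comp_apply, ContinuousLinearMap.flip_apply] at h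
    linarith
  have hsymm : IsSymmSndFDerivAt ℝ φ x := hφ.isSymmSndFDerivAt (by simp)
  rw [VectorField.lieBracket_eq, map_sub, key hW hWφ (hVφ.self_of_nhds hφx),
    key hV hVφ (hWφ.self_of_nhds hφx), hsymm (V x) (W x)]
  ring

/-- Near a regular point, a vector which joins two points of the hypersurface `φ = 0` is not normal
to it. -/
theorem eventually_eq_of_normal {φ : 𝔼 n → ℝ} {y₀ : 𝔼 n} (hφ : ContDiffAt ℝ 1 φ y₀)
    (hd : fderiv ℝ φ y₀ ≠ 0) :
    ∀ᶠ w in 𝓝 (y₀, y₀), φ w.1 = 0 → φ w.2 = 0 →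
      (∀ v, fderiv ℝ φ w.1 v = 0 → inner ℝ v (w.2 - w.1) = 0) → w.2 = w.1 := by
  obtain ⟨v₀, hv₀⟩ : ∃ v, fderiv ℝ φ y₀ v = 1 := by
    obtain ⟨v, hv⟩ := DFunLike.ne_iff.1 hd
    exact ⟨(fderiv ℝ φ y₀ v)⁻¹ • v, by
      rw [map_smul, smul_eq_mul, inv_mul_cancel₀ (by simpa using hv)]⟩
  -- Small enough that `dφ_x v₀ ≥ 1/2` (`e5`) and `2 ε ‖v₀‖ ≤ 1/4` (`e7`), which contradict each
  -- other through `e3` unless `ν = 0`.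
  set ε : ℝ := 1 / (8 * (‖v₀‖ + 1)) with hε
  have hε0 : 0 < ε := by positivity
  have hεv : ε * (‖v₀‖ + 1) = 1 / 8 := by rw [hε]; field_simp
  have h1 : ∀ᶠ w : 𝔼 n × 𝔼 n in 𝓝 (y₀, y₀),
      ‖φ w.1 - φ w.2 - fderiv ℝ φ y₀ (w.1 - w.2)‖ ≤ ε * ‖w.1 - w.2‖ :=
    (hφ.hasStrictFDerivAt (by simp)).isLittleO.def hε0
  have hc : ContinuousAt (fderiv ℝ φ) y₀ := (hφ.fderiv_right (m := 0) (by norm_num)).continuousAt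
  have h2 : ∀ᶠ w : 𝔼 n × 𝔼 n in 𝓝 (y₀, y₀), ‖fderiv ℝ φ w.1 - fderiv ℝ φ y₀‖ < ε := by
    have : Tendsto (fun w : 𝔼 n × 𝔼 n => fderiv ℝ φ w.1) (𝓝 (y₀, y₀)) (𝓝 (fderiv ℝ φ y₀)) :=
      hc.tendsto.comp continuousAt_fst.tendsto
    filter_upwards [this (Metric.ball_mem_nhds _ hε0)] with w hw
    exact mem_ball_iff_norm.1 hw
  filter_upwards [h1, h2] with ⟨x, q⟩ h1 h2 hx hq hν
  simp only at h1 h2 hx hq hν ⊢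
  set ν := q - x with hνdef
  have e1 : |fderiv ℝ φ y₀ ν| ≤ ε * ‖ν‖ := by
    rwa [hx, hq, ← neg_sub q x, map_neg, norm_neg, sub_self, zero_sub, neg_neg,
      Real.norm_eq_abs] at h1
  have e2 : ∀ v, |fderiv ℝ φ x v - fderiv ℝ φ y₀ v| ≤ ε * ‖v‖ := fun v =>
    ((fderiv ℝ φ x - fderiv ℝ φ y₀).le_opNorm v).trans (by gcongr)
  -- Normality of `ν` is tested on the combination of `v₀` and `ν` that lies in the kernel of
  -- `dφ_x`.
  have e3 : fderiv ℝ φ x ν * inner ℝ v₀ ν = fderiv ℝ φ x v₀ * ‖ν‖ ^ 2 := by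
    have := hν (fderiv ℝ φ x ν • v₀ - fderiv ℝ φ x v₀ • ν) (by
      rw [map_sub, map_smul, map_smul, smul_eq_mul, smul_eq_mul]; ring)
    rw [inner_sub_left, real_inner_smul_left, real_inner_smul_left,
      real_inner_self_eq_norm_sq] at this
    linarith
  have e4 : |fderiv ℝ φ x ν| ≤ 2 * ε * ‖ν‖ := by
    have := e2 ν
    have h := abs_add_le (fderiv ℝ φ x ν - fderiv ℝ φ y₀ ν) (fderiv ℝ φ y₀ ν)
    rw [sub_add_cancel] at h
    linarith
  have e5 : 1 / 2 ≤ fderiv ℝ φ x v₀ := by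
    have h := (abs_le.1 (e2 v₀)).1
    rw [hv₀] at h
    nlinarith
  have e6 : fderiv ℝ φ x ν * inner ℝ v₀ ν ≤ 2 * ε * ‖ν‖ * (‖v₀‖ * ‖ν‖) := by
    refine (le_abs_self _).trans ?_
    rw [abs_mul]
    exact mul_le_mul e4 (abs_real_inner_le_norm _ _) (abs_nonneg _) (by positivity)
  by_contra hne
  have hν0 : 0 < ‖ν‖ := norm_pos_iff.2 (sub_ne_zero.2 hne)
  have hsq : 0 < ‖ν‖ ^ 2 := by positivity
  have e7 : 2 * ε * ‖ν‖ * (‖v₀‖ * ‖ν‖) ≤ 1 / 4 * ‖ν‖ ^ 2 := by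
    have : 2 * ε * ‖ν‖ * (‖v₀‖ * ‖ν‖) = 2 * (ε * ‖v₀‖) * ‖ν‖ ^ 2 := by ring
    rw [this]
    gcongr
    nlinarith
  nlinarith

/-- If `φ ≤ ψ` touch to first order at a regular point and `ψ` vanishes on `φ = 0`, then `φ`
vanishes on `ψ = 0`. -/
theorem eventually_eq_zero_of_le {φ ψ : 𝔼 n → ℝ} {y₀ : 𝔼 n} {L : 𝔼 n →L[ℝ] ℝ}
    (hφ : HasStrictFDerivAt φ L y₀) (hψ : HasStrictFDerivAt ψ L y₀) (hL : L ≠ 0) (hφ0 : φ y₀ = 0)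
    (hφc : ∀ᶠ y in 𝓝 y₀, ContinuousAt φ y) (hle : ∀ᶠ y in 𝓝 y₀, φ y ≤ ψ y)
    (h0 : ∀ᶠ y in 𝓝 y₀, φ y = 0 → ψ y = 0) : ∀ᶠ y in 𝓝 y₀, ψ y = 0 → φ y = 0 := by
  obtain ⟨v, hv⟩ : ∃ v, L v = 1 := by
    obtain ⟨v, hv⟩ := DFunLike.ne_iff.1 hL
    exact ⟨(L v)⁻¹ • v, by
      rw [map_smul, smul_eq_mul, inv_mul_cancel₀ (by simpa using hv)]⟩
  set ε : ℝ := 1 / (2 * (‖v‖ + 1)) with hε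
  have hε0 : 0 < ε := by positivity
  have hεv : ε * ‖v‖ ≤ 1 / 2 := by
    have : ε * (‖v‖ + 1) = 1 / 2 := by rw [hε]; field_simp
    nlinarith
  have h1 := hφ.isLittleO.def hε0
  have h2 := hψ.isLittleO.def hε0
  rw [nhds_prod_eq] at h1 h2
  obtain ⟨s, hs, hsP⟩ := eventually_prod_self_iff'.1 (h1.and h2)
  obtain ⟨r, hr, hrs⟩ := Metric.eventually_nhds_iff_ball.1 (((hφc.and hle).and h0).and hs)
  set T : ℝ := r / (4 * (‖v‖ + 1)) with hT
  have hT0 : 0 < T := by positivity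
  have hTv : T * ‖v‖ < r / 2 := by
    have : T * (‖v‖ + 1) = r / 4 := by rw [hT]; field_simp
    nlinarith
  have hφT : ∀ᶠ q in 𝓝 y₀, -(T / 2) < φ q :=
    hφ.continuousAt.eventually (lt_mem_nhds (by rw [hφ0]; linarith))
  filter_upwards [hφT, Metric.ball_mem_nhds y₀ (half_pos hr)] with q hqT hqr hψq
  have hmem : ∀ t ∈ Icc 0 T, q + t • v ∈ Metric.ball y₀ r := fun t ht => by
    rw [Metric.mem_ball] at hqr ⊢
    have h3 := dist_triangle (q + t • v) q y₀
    rw [dist_self_add_left, norm_smul, Real.norm_of_nonneg ht.1] at h3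
    have h4 : t * ‖v‖ ≤ T * ‖v‖ := by gcongr; exact ht.2
    linarith
  have hq0 : q + (0 : ℝ) • v = q := by simp
  have hqm : q ∈ Metric.ball y₀ r := by simpa using hmem 0 ⟨le_rfl, hT0.le⟩
  -- Both functions grow at rate at least `1/2` along `v`. If `ψ q = 0`, then `φ q ≤ 0` and `φ`
  -- reaches `0` at some `q + t v`; there `ψ` vanishes too, yet `ψ ≥ t / 2`, so `t = 0`.
  have hinc : ∀ t ∈ Icc 0 T, φ q + t / 2 ≤ φ (q + t • v) ∧ ψ q + t / 2 ≤ ψ (q + t • v) := by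
    intro t ht
    have h3 := hsP _ (hrs _ (hmem t ht)).2 _ (hrs _ hqm).2
    simp only [add_sub_cancel_left, map_smul, hv, smul_eq_mul, mul_one, norm_smul,
      Real.norm_of_nonneg ht.1] at h3
    have h4 : ε * (t * ‖v‖) ≤ t / 2 := by nlinarith [ht.1]
    exact ⟨by linarith [(abs_le.1 h3.1).1], by linarith [(abs_le.1 h3.2).1]⟩
  have hcont : ContinuousOn (fun t : ℝ => φ (q + t • v)) (Icc 0 T) := fun t ht =>
    (ContinuousAt.comp (f := fun t : ℝ => q + t • v) (hrs _ (hmem t ht)).1.1.1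
      (by fun_prop)).continuousWithinAt
  have hivt := intermediate_value_Icc hT0.le hcont
  obtain ⟨t, ht, htφ⟩ := hivt (show (0 : ℝ) ∈ Icc _ _ from by
    refine ⟨?_, ?_⟩
    · beta_reduce
      rw [hq0, ← hψq]
      exact (hrs q hqm).1.1.2
    · linarith [(hinc T ⟨hT0.le, le_rfl⟩).1])
  beta_reduce at htφ
  have h5 := (hinc t ht).2
  rw [(hrs _ (hmem t ht)).1.2 htφ, hψq] at h5
  have ht0 : t = 0 := le_antisymm (by linarith) ht.1
  rwa [ht0, hq0] at htφ

end ContactSet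

/-! ### Propagation of the contact set -/

section Propagation

local notation "𝔼" d:max => EuclideanSpace ℝ (Fin d)

variable {m : ℕ} {M : Type*} [TopologicalSpace M] [ChartedSpace (EuclideanSpace ℝ (Fin (m + 1))) M]

theorem eventually_nhds_of_chart {x₀ : M} {P : M → Prop}
    (h : ∀ᶠ y in 𝓝 (extChartAt (𝓡 (m + 1)) x₀ x₀), P ((extChartAt (𝓡 (m + 1)) x₀).symm y)) :
    ∀ᶠ x in 𝓝 x₀, P x := by
  filter_upwards [(continuousAt_extChartAt x₀).eventually h,
    extChartAt_source_mem_nhds (I := 𝓡 (m + 1)) x₀]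
    with x hx hxs
  rwa [(extChartAt (𝓡 (m + 1)) x₀).left_inv hxs] at hx

theorem eventually_chart_symm_mem {x₀ : M} {U : Set M} (hU : IsOpen U) (hx₀ : x₀ ∈ U) :
    ∀ᶠ y in 𝓝 (extChartAt (𝓡 (m + 1)) x₀ x₀), y ∈ (extChartAt (𝓡 (m + 1)) x₀).target ∧
      (extChartAt (𝓡 (m + 1)) x₀).symm y ∈ U := by
  refine ((continuousOn_extChartAt_symm x₀).isOpen_inter_preimage (isOpen_extChartAt_target x₀)
    hU).mem_nhds ⟨mem_extChartAt_target x₀, ?_⟩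
  rwa [mem_preimage, extChartAt_to_inv]

theorem raiseInChart_comm (g : CoMetric m M) (x₀ : M) (y : 𝔼 (m + 1)) (θ η : 𝔼 (m + 1) →L[ℝ] ℝ) :
    θ (raiseInChart g x₀ y η) = η (raiseInChart g x₀ y θ) := by
  rw [apply_raiseInChart, apply_raiseInChart, g.symm]

theorem raiseInChart_nonneg (g : CoMetric m M) (x₀ : M) (y : 𝔼 (m + 1)) (θ : 𝔼 (m + 1) →L[ℝ] ℝ) :
    0 ≤ θ (raiseInChart g x₀ y θ) := by
  rw [apply_raiseInChart]
  exact g.nonneg _ _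

variable [IsManifold (𝓡 (m + 1)) ∞ M] {x₀ : M} {y : 𝔼 (m + 1)}

theorem exists_raiseInChart_eq (g : CoMetric m M) (hy : y ∈ (extChartAt (𝓡 (m + 1)) x₀).target)
    {v : TangentSpace (𝓡 (m + 1)) ((extChartAt (𝓡 (m + 1)) x₀).symm y)}
    (hv : v ∈ g.horizontal ((extChartAt (𝓡 (m + 1)) x₀).symm y)) :
    ∃ η, raiseInChart g x₀ y η = chartDeriv x₀ y v := by
  obtain ⟨θ, rfl⟩ := hv
  refine ⟨θ.comp (chartSymmDeriv x₀ y), ?_⟩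
  rw [← chartDeriv_G]
  congr 2
  ext w
  exact congrArg θ (chartSymmDeriv_chartDeriv hy w)

/-- If the zero set of `u` is tangent to all horizontal directions and these generate the tangent
space, then `u` vanishes. -/
theorem eventually_eq_zero_of_hasLieRankNear {g : CoMetric m M}
    (hrank : HasLieRankNear x₀ Set.univ g.horizontal (m + 1)) {u : 𝔼 (m + 1) → ℝ}
    (hu : ∀ᶠ y in 𝓝 (extChartAt (𝓡 (m + 1)) x₀ x₀), ContinuousAt u y)
    (hu0 : u (extChartAt (𝓡 (m + 1)) x₀ x₀) = 0)
    (hnormal : ∀ᶠ x in 𝓝 (extChartAt (𝓡 (m + 1)) x₀ x₀), u x = 0 →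
      ∀ z, (∀ᶠ y in 𝓝 x, u y = 0 → dist x z ≤ dist y z) →
        ∀ η, inner ℝ (raiseInChart g x₀ x η) (z - x) = 0) :
    ∀ᶠ y in 𝓝 (extChartAt (𝓡 (m + 1)) x₀ x₀), u y = 0 := by
  obtain ⟨U, r, X, hU, hx₀U, hX, hbasis, hrk⟩ := hrank
  set y₀ := extChartAt (𝓡 (m + 1)) x₀ x₀ with hy₀
  obtain ⟨R, hR, hball⟩ := Metric.nhds_basis_closedBall.mem_iff.1
    ((eventually_chart_symm_mem hU hx₀U).and (hu.and hnormal))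
  set F := Metric.closedBall y₀ R ∩ u ⁻¹' {0}
  set O := Metric.ball y₀ R
  have hOR : O ⊆ Metric.closedBall y₀ R := Metric.ball_subset_closedBall
  have hF : IsClosed F := ContinuousOn.preimage_isClosed_of_isClosed
    (fun y hy => (hball hy).2.1.continuousWithinAt) Metric.isClosed_closedBall isClosed_singleton
  have hgen : ∀ i, TangentTo F O (fieldInChart x₀ (X i)) := fun i x hx z hz => by
    obtain ⟨⟨hxt, hxU⟩, -, hn⟩ := hball (hOR hx.2)
    have hmem : X i ((extChartAt (𝓡 (m + 1)) x₀).symm x) ∈ g.horizontal _ := by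
      rw [← (hbasis _ ⟨hxU, mem_univ _⟩).2]
      exact Submodule.subset_span ⟨i, rfl⟩
    obtain ⟨η, hη⟩ := exists_raiseInChart_eq g hxt hmem
    rw [fieldInChart_apply hxt, ← hη]
    refine hn hx.1.2 z ?_ η
    filter_upwards [Metric.isOpen_ball.mem_nhds hx.2] with y hy huy using hz y ⟨hOR hy, huy⟩
  have hall : ∀ Z, LieSpan U X Z → TangentTo F O (fieldInChart x₀ Z) := fun Z hZ =>
    LieSpan.induction_inChart hU hX (fun y hy => (hball (hOR hy)).1.1)
      (fun y hy => (hball (hOR hy)).1.2) (fun V W hV h => hV.congr (h.mono inter_subset_right))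
      (fun x hx z hz => by simp) (fun V W hV hW => hV.add hW) (fun f V hV => hV.smul f)
      (fun V W hVs hWs hV hW => hV.lieBracket hF Metric.isOpen_ball hW hVs hWs) hgen hZ
  filter_upwards [Metric.ball_mem_nhds y₀ (half_pos hR)] with q hq
  obtain ⟨x, hx, hmin⟩ := exists_nearest hF ⟨Metric.mem_closedBall_self hR.le, hu0⟩ hq
  obtain ⟨⟨hxt, hxU⟩, -⟩ := hball (hOR hx.2)
  have htop : lieSpanInChart x₀ U X x = ⊤ := by
    apply Submodule.eq_top_of_finrank_eq
    rw [finrank_lieSpanInChart hxt, hrk _ ⟨hxU, mem_univ _⟩, finrank_euclideanSpace_fin]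
  have horth : ∀ v ∈ lieSpanInChart x₀ U X x, inner ℝ v (q - x) = 0 := fun v hv => by
    induction hv using Submodule.span_induction with
    | mem v hv =>
      obtain ⟨Z, hZ, rfl⟩ := hv
      exact hall Z hZ x hx q hmin
    | zero => exact inner_zero_left _
    | add v w _ _ hv hw => rw [inner_add_left, hv, hw, add_zero]
    | smul c v _ hv => rw [real_inner_smul_left, hv, mul_zero]
  -- Full rank makes the proximal normal `q - x` orthogonal to itself.
  have h0 : q - x = 0 := inner_self_eq_zero.1 (horth (q - x) (htop ▸ Submodule.mem_top))
  rw [sub_eq_zero.1 h0]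
  exact hx.1.2

/-- If the contact set of `φ` and `ψ` is tangent to the horizontal directions tangent to the
hypersurface `φ = 0`, and these generate its tangent space, then `ψ` vanishes on it. -/
theorem eventually_eq_zero_of_hasLieRankNear_level {g : CoMetric m M} {φ : M → ℝ} {U : Set M}
    (hU : IsOpen U) (hx₀ : x₀ ∈ U) (hφ : ContMDiffOn (𝓡 (m + 1)) 𝓘(ℝ, ℝ) ∞ φ U)
    (hφ0 : φ x₀ = 0) (hφn : g.norm (differential φ x₀) ≠ 0)
    (hrank : HasLieRankNear x₀ {x | φ x = 0}
      (fun x => g.horizontal x ⊓ LinearMap.ker (differential φ x).toLinearMap) m)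
    {φ' ψ' : 𝔼 (m + 1) → ℝ} (hφ' : φ' = fun y => φ ((extChartAt (𝓡 (m + 1)) x₀).symm y))
    (hψ : ∀ᶠ y in 𝓝 (extChartAt (𝓡 (m + 1)) x₀ x₀), ContinuousAt ψ' y)
    (hψ0 : ψ' (extChartAt (𝓡 (m + 1)) x₀ x₀) = 0)
    (hnormal : ∀ᶠ x in 𝓝 (extChartAt (𝓡 (m + 1)) x₀ x₀), ψ' x = φ' x →
      ∀ z, (∀ᶠ y in 𝓝 x, ψ' y = φ' y → dist x z ≤ dist y z) →
        ∀ η, fderiv ℝ φ' x (raiseInChart g x₀ x η) = 0 →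
          inner ℝ (raiseInChart g x₀ x η) (z - x) = 0) :
    ∀ᶠ y in 𝓝 (extChartAt (𝓡 (m + 1)) x₀ x₀), φ' y = 0 → ψ' y = 0 := by
  obtain ⟨U', r, X, hU', hx₀U', hX, hbasis, hrk⟩ := hrank
  set y₀ := extChartAt (𝓡 (m + 1)) x₀ x₀ with hy₀
  have hsm : ∀ y ∈ (extChartAt (𝓡 (m + 1)) x₀).target, (extChartAt (𝓡 (m + 1)) x₀).symm y ∈ U →
      ContDiffAt ℝ ∞ φ' y := fun y hy hyU => by
    rw [hφ']
    exact contDiffAt_comp_chart_symm hy (hφ.contMDiffAt (hU.mem_nhds hyU))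
  have hmd : ∀ x ∈ U, MDifferentiableAt (𝓡 (m + 1)) 𝓘(ℝ, ℝ) φ x := fun x hx =>
    (hφ.contMDiffAt (hU.mem_nhds hx)).mdifferentiableAt (by simp)
  have hxx : (extChartAt (𝓡 (m + 1)) x₀).symm y₀ = x₀ := extChartAt_to_inv x₀
  have hy₀t : y₀ ∈ (extChartAt (𝓡 (m + 1)) x₀).target := mem_extChartAt_target x₀
  have hφy : ContDiffAt ℝ ∞ φ' y₀ := hsm y₀ hy₀t (by rwa [hxx])
  have hφ'y : ContinuousAt (fderiv ℝ φ') y₀ := (hφy.fderiv_right (m := ∞) (by simp)).continuousAt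
  have hqpos : 0 < fderiv ℝ φ' y₀ (raiseInChart g x₀ y₀ (fderiv ℝ φ' y₀)) := by
    have h := norm_differential g hy₀t (φ := φ) (by rw [hxx]; exact hmd x₀ hx₀)
    rw [hxx, ← hφ'] at h
    rw [h] at hφn
    exact Real.sqrt_ne_zero'.1 hφn
  have hqev : ∀ᶠ y in 𝓝 y₀, 0 < fderiv ℝ φ' y (raiseInChart g x₀ y (fderiv ℝ φ' y)) :=
    (hφ'y.clm_apply ((contDiffAt_raiseInChart g hy₀t).continuousAt.clm_apply hφ'y)).eventually
      (lt_mem_nhds hqpos)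
  have hd0 : fderiv ℝ φ' y₀ ≠ 0 := fun h => by simp [h] at hqpos
  have hφy0 : φ' y₀ = 0 := by rw [hφ']; exact (congrArg φ hxx).trans hφ0
  have hpair := eventually_eq_of_normal (hφy.of_le (by simp)) hd0
  rw [nhds_prod_eq] at hpair
  obtain ⟨s, hs, hsP⟩ := eventually_prod_self_iff'.1 hpair
  obtain ⟨R, hR, hball⟩ := Metric.nhds_basis_closedBall.mem_iff.1
    ((eventually_chart_symm_mem hU hx₀).and ((eventually_chart_symm_mem hU' hx₀U').and
      (hψ.and (hnormal.and (hqev.and hs)))))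
  set O := Metric.ball y₀ R
  have hOR : O ⊆ Metric.closedBall y₀ R := Metric.ball_subset_closedBall
  have hO : IsOpen O := Metric.isOpen_ball
  have hφc : ∀ y ∈ Metric.closedBall y₀ R, ContDiffAt ℝ ∞ φ' y := fun y hy =>
    hsm y (hball hy).1.1 (hball hy).1.2
  set F := Metric.closedBall y₀ R ∩ (fun y => ψ' y - φ' y) ⁻¹' {0}
  have hF : IsClosed F := ContinuousOn.preimage_isClosed_of_isClosed
    (fun y hy => ((hball hy).2.2.1.sub (hφc y hy).continuousAt).continuousWithinAt)
    Metric.isClosed_closedBall isClosed_singleton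
  set F₁ := F ∩ (Metric.closedBall y₀ R ∩ φ' ⁻¹' {0})
  have hF₁ : IsClosed F₁ := hF.inter (ContinuousOn.preimage_isClosed_of_isClosed
    (fun y hy => (hφc y hy).continuousAt.continuousWithinAt)
    Metric.isClosed_closedBall isClosed_singleton)
  have hraise : ∀ i, ∀ y ∈ O, φ' y = 0 → fderiv ℝ φ' y (fieldInChart x₀ (X i) y) = 0 ∧
      ∃ η, raiseInChart g x₀ y η = fieldInChart x₀ (X i) y := fun i y hy hy0 => by
    obtain ⟨⟨hyt, hyU⟩, ⟨-, hyU'⟩, -⟩ := hball (hOR hy)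
    have hmem : X i ((extChartAt (𝓡 (m + 1)) x₀).symm y) ∈ g.horizontal _ ⊓
        LinearMap.ker (differential φ ((extChartAt (𝓡 (m + 1)) x₀).symm y)).toLinearMap := by
      have h := (hbasis _ ⟨hyU', by rw [hφ'] at hy0; exact hy0⟩).2
      beta_reduce at h
      rw [← h]
      exact Submodule.subset_span ⟨i, rfl⟩
    rw [fieldInChart_apply hyt]
    refine ⟨?_, exists_raiseInChart_eq g hyt hmem.1⟩
    have h := hmem.2
    rw [differential_eq_comp hyt (hmd _ hyU), ← hφ'] at h
    exact h
  have hgen : ∀ i, TangentTo F₁ O (fieldInChart x₀ (X i)) := fun i x hx z hz => by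
    obtain ⟨hk, η, hη⟩ := hraise i x hx.2 hx.1.2.2
    rw [← hη] at hk ⊢
    -- `X i` is known to be horizontal and tangent to the levels only on `φ = 0`, whereas `F` may
    -- leave this hypersurface. Projecting `η` off `dφ` gives a horizontal field tangent to all
    -- levels near `x`, hence tangent to `F`, with the same value at `x`.
    set ζ : 𝔼 (m + 1) → 𝔼 (m + 1) →L[ℝ] ℝ := fun y => η -
      (fderiv ℝ φ' y (raiseInChart g x₀ y η) /
        fderiv ℝ φ' y (raiseInChart g x₀ y (fderiv ℝ φ' y))) • fderiv ℝ φ' y with hζ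
    have hker : ∀ y ∈ O, fderiv ℝ φ' y (raiseInChart g x₀ y (ζ y)) = 0 := fun y hy => by
      have hpos := (hball (hOR hy)).2.2.2.2.1
      rw [hζ]
      simp only [map_sub, map_smul, smul_eq_mul]
      rw [div_mul_cancel₀ _ hpos.ne', sub_self]
    have htan : TangentTo F O fun y => raiseInChart g x₀ y (ζ y) := fun y hy z hz => by
      refine (hball (hOR hy.2)).2.2.2.1 (sub_eq_zero.1 hy.1.2) z ?_ _ (hker y hy.2)
      filter_upwards [hO.mem_nhds hy.2] with y' hy' h using hz y' ⟨hOR hy', sub_eq_zero.2 h⟩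
    have hxt := (hball (hOR hx.2)).1.1
    have hA : ContDiffAt ℝ ∞ (raiseInChart g x₀) x := contDiffAt_raiseInChart g hxt
    have hdφ : ContDiffAt ℝ ∞ (fderiv ℝ φ') x :=
      (hφc x (hOR hx.2)).fderiv_right (m := ∞) (by simp)
    have hsmooth : ContDiffAt ℝ 1 (fun y => raiseInChart g x₀ y (ζ y)) x := by
      refine ContDiffAt.of_le (hA.clm_apply ?_) (by simp : (1 : WithTop ℕ∞) ≤ ∞)
      exact contDiffAt_const.sub (((hdφ.clm_apply (hA.clm_apply contDiffAt_const)).div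
        (hdφ.clm_apply (hA.clm_apply hdφ)) (hball (hOR hx.2)).2.2.2.2.1.ne').smul hdφ)
    have h := htan.inner_eq_zero_of_level hF hO
      (fun y hy => (hφc y (hOR hy)).differentiableAt (by simp)) hker ⟨hx.1.1, hx.2⟩ hsmooth
      (z := z) fun y hy h => hz y ⟨hy, hy.1, h.trans hx.1.2.2⟩
    have hζx : ζ x = η := by simp [hζ, hk]
    rwa [hζx] at h
  have hne : ∀ y ∈ O, fderiv ℝ φ' y ≠ 0 := fun y hy h => by
    have := (hball (hOR hy)).2.2.2.2.1
    simp [h] at this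
  -- Tangency to the hypersurface is carried along at all its points: it is needed to bound the span
  -- of `£` from above by `ker dφ`.
  have hall : ∀ Z, LieSpan U' X Z → TangentTo F₁ O (fieldInChart x₀ Z) ∧
      ∀ y ∈ O, φ' y = 0 → fderiv ℝ φ' y (fieldInChart x₀ Z y) = 0 := fun Z hZ => by
    refine LieSpan.induction_inChart (P := fun V => TangentTo F₁ O V ∧
      ∀ y ∈ O, φ' y = 0 → fderiv ℝ φ' y (V y) = 0) hU' hX (fun y hy => (hball (hOR hy)).1.1)
      (fun y hy => (hball (hOR hy)).2.1.2)
      (fun V W hV h => ⟨hV.1.congr (h.mono inter_subset_right), fun y hy h0 => ?_⟩)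
      ⟨fun x hx z hz => by simp, fun y _ _ => by simp⟩
      (fun V W hV hW => ⟨hV.1.add hW.1, fun y hy h0 => ?_⟩)
      (fun f V hV => ⟨hV.1.smul f, fun y hy h0 => ?_⟩)
      (fun V W hVs hWs hV hW => ⟨hV.1.lieBracket hF₁ hO hW.1 hVs hWs, fun y hy h0 => ?_⟩)
      (fun i => ⟨hgen i, fun y hy h0 => (hraise i y hy h0).1⟩) hZ
    · rw [← h hy]
      exact hV.2 y hy h0
    · rw [Pi.add_apply, map_add, hV.2 y hy h0, hW.2 y hy h0, add_zero]
    · rw [map_smul, hV.2 y hy h0, smul_zero]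
    · refine fderiv_lieBracket_eq_zero ((hφc y (hOR hy)).of_le two_le_smooth)
        ((hVs.contDiffAt (hO.mem_nhds hy)).of_le (by simp))
        ((hWs.contDiffAt (hO.mem_nhds hy)).of_le (by simp)) h0 (hne y hy) ?_ ?_
      · filter_upwards [hO.mem_nhds hy] with y' hy' using hV.2 y' hy'
      · filter_upwards [hO.mem_nhds hy] with y' hy' using hW.2 y' hy'
  filter_upwards [Metric.ball_mem_nhds y₀ (half_pos hR)] with q hq hq0
  have hy₀c : y₀ ∈ Metric.closedBall y₀ R := Metric.mem_closedBall_self hR.le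
  have hy₀F : y₀ ∈ F₁ := ⟨⟨hy₀c, by simp [hψ0, hφy0]⟩, hy₀c, hφy0⟩
  obtain ⟨x, hx, hmin⟩ := exists_nearest hF₁ hy₀F hq
  obtain ⟨⟨hxt, hxU⟩, ⟨-, hxU'⟩, -, -, -, hxs⟩ := hball (hOR hx.2)
  have hle : lieSpanInChart x₀ U' X x ≤ LinearMap.ker (fderiv ℝ φ' x).toLinearMap := by
    refine Submodule.span_le.2 ?_
    rintro _ ⟨Z, hZ, rfl⟩
    exact (hall Z hZ).2 x hx.2 hx.1.2.2
  -- Both spaces have dimension `m`, the kernel because `dφ ≠ 0`.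
  have heq : lieSpanInChart x₀ U' X x = LinearMap.ker (fderiv ℝ φ' x).toLinearMap := by
    apply Submodule.eq_of_le_of_finrank_eq hle
    have hx0 : φ ((extChartAt (𝓡 (m + 1)) x₀).symm x) = 0 := by
      have := hx.1.2.2
      rw [hφ'] at this
      exact this
    rw [finrank_lieSpanInChart hxt, hrk _ ⟨hxU', hx0⟩]
    have hnz : (fderiv ℝ φ' x).toLinearMap ≠ 0 := fun h =>
      hne x hx.2 (ContinuousLinearMap.coe_injective h)
    have h1 := Module.Dual.finrank_ker_add_one_of_ne_zero hnz
    rw [finrank_euclideanSpace_fin] at h1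
    exact (Nat.succ_injective h1).symm
  have horth : ∀ v ∈ lieSpanInChart x₀ U' X x, inner ℝ v (q - x) = 0 := fun v hv => by
    induction hv using Submodule.span_induction with
    | mem v hv =>
      obtain ⟨Z, hZ, rfl⟩ := hv
      exact (hall Z hZ).1 x hx q hmin
    | zero => exact inner_zero_left _
    | add v w _ _ hv hw => rw [inner_add_left, hv, hw, add_zero]
    | smul c v _ hv => rw [real_inner_smul_left, hv, mul_zero]
  have hqs : q ∈ s := (hball (Metric.ball_subset_closedBall
    (Metric.ball_subset_ball (half_le_self hR.le) hq))).2.2.2.2.2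
  have hqx : q = x := hsP x hxs q hqs hx.1.2.2 hq0 fun v hv => horth v (heq ▸ hv)
  rw [hqx, sub_eq_zero.1 hx.1.1.2]
  exact hx.1.2.2

end Propagation

/-! ### Assembly of both conclusions in the chart at `p₀`. -/

theorem theoremB {m l : ℕ} (hm : 1 ≤ m) {M : Type*} [TopologicalSpace M] [T2Space M]
    [ChartedSpace (EuclideanSpace ℝ (Fin (m + 1))) M] [IsManifold (𝓡 (m + 1)) ∞ M]
    (g : CoMetric m M) (dv : VolumeForm m M)
    (U : Set M) (hU : IsOpen U) (p₀ : M) (hp₀ : p₀ ∈ U)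
    (hl : ∀ x ∈ U, Module.finrank ℝ (g.horizontal x) + l = m + 1)
    (φ ψ : M → ℝ)
    (hφ : ContMDiffOn (𝓡 (m + 1)) 𝓘(ℝ, ℝ) ∞ φ U)
    (hψ : ContMDiffOn (𝓡 (m + 1)) 𝓘(ℝ, ℝ) ∞ ψ U)
    (hφ₀ : g.norm (differential φ p₀) ≠ 0) (hψ₀ : g.norm (differential ψ p₀) ≠ 0)
    (p : ℝ) (hp : 0 ≤ p)
    (b : Π x : M, ℝ → (TangentSpace (𝓡 (m + 1)) x →L[ℝ] ℝ) → ℝ)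
    (hb : SmoothLowerOrderOn U b)
    (hbz : ∀ x ∈ U, ∀ (z : ℝ) (q : TangentSpace (𝓡 (m + 1)) x →L[ℝ] ℝ),
      deriv (fun t => b x t q) z ≤ 0)
    (hH : ∀ x ∈ U, g.norm (differential φ x) ≠ 0 → g.norm (differential ψ x) ≠ 0 →
      g.meanCurvature dv p ψ x + b x (ψ x) (differential ψ x) ≤
        g.meanCurvature dv p φ x + b x (φ x) (differential φ x))
    (hle : ∀ x ∈ U, φ x ≤ ψ x) (hφp : φ p₀ = 0) (hψp : ψ p₀ = 0) :
    (HasLieRankNear p₀ {x | φ x = 0}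
        (fun x => g.horizontal x ⊓ LinearMap.ker (differential φ x).toLinearMap) m →
      ∀ᶠ x in 𝓝 p₀, φ x = 0 ↔ ψ x = 0) ∧
    (0 < p → HasLieRankNear p₀ Set.univ g.horizontal (m + 1) →
      ∀ᶠ x in 𝓝 p₀, ψ x = φ x) := by

  set χ := extChartAt (𝓡 (m + 1)) p₀ with hχ
  set y₀ := χ p₀ with hy₀
  set φ' : EuclideanSpace ℝ (Fin (m + 1)) → ℝ := fun y => φ (χ.symm y) with hφ'
  set ψ' : EuclideanSpace ℝ (Fin (m + 1)) → ℝ := fun y => ψ (χ.symm y) with hψ'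
  have hxx : χ.symm y₀ = p₀ := extChartAt_to_inv p₀
  have hy₀t : y₀ ∈ χ.target := mem_extChartAt_target p₀
  have hev : ∀ᶠ y in 𝓝 y₀, y ∈ χ.target ∧ χ.symm y ∈ U := eventually_chart_symm_mem hU hp₀
  have hsm : ∀ {f : M → ℝ}, ContMDiffOn (𝓡 (m + 1)) 𝓘(ℝ, ℝ) ∞ f U → ∀ y ∈ χ.target,
      χ.symm y ∈ U → ContDiffAt ℝ ∞ (fun y => f (χ.symm y)) y := fun hf y hy hyU =>
    contDiffAt_comp_chart_symm hy (hf.contMDiffAt (hU.mem_nhds hyU))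
  have hmd : ∀ {f : M → ℝ}, ContMDiffOn (𝓡 (m + 1)) 𝓘(ℝ, ℝ) ∞ f U → ∀ x ∈ U,
      MDifferentiableAt (𝓡 (m + 1)) 𝓘(ℝ, ℝ) f x := fun hf x hx =>
    (hf.contMDiffAt (hU.mem_nhds hx)).mdifferentiableAt (by simp)
  have hφ's : ContDiffAt ℝ ∞ φ' y₀ := hsm hφ y₀ hy₀t (by rwa [hxx])
  have hψ's : ContDiffAt ℝ ∞ ψ' y₀ := hsm hψ y₀ hy₀t (by rwa [hxx])
  have hφ'0 : φ' y₀ = 0 := (congrArg φ hxx).trans hφp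
  have hψ'0 : ψ' y₀ = 0 := (congrArg ψ hxx).trans hψp
  have hle' : ∀ᶠ y in 𝓝 y₀, φ' y ≤ ψ' y := hev.mono fun y hy => hle _ hy.2
  have hGs : ContDiffAt ℝ ∞ (raiseInChart g p₀) y₀ := contDiffAt_raiseInChart g hy₀t
  have hpos : ∀ {f : M → ℝ}, ContMDiffOn (𝓡 (m + 1)) 𝓘(ℝ, ℝ) ∞ f U →
      g.norm (differential f p₀) ≠ 0 →
      0 < fderiv ℝ (fun y => f (χ.symm y)) y₀
        (raiseInChart g p₀ y₀ (fderiv ℝ (fun y => f (χ.symm y)) y₀)) := fun {f} hf hf0 => by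
    have h := norm_differential g hy₀t (φ := f) (by rw [hxx]; exact hmd hf p₀ hp₀)
    rw [hxx] at h
    rw [h] at hf0
    exact Real.sqrt_ne_zero'.1 hf0
  have hnorm : ∀ {f : M → ℝ}, ContMDiffOn (𝓡 (m + 1)) 𝓘(ℝ, ℝ) ∞ f U →
      g.norm (differential f p₀) ≠ 0 →
      ∀ᶠ y in 𝓝 y₀, g.norm (differential f (χ.symm y)) ≠ 0 := fun {f} hf hf0 => by
    have hc : ContinuousAt (fderiv ℝ (fun y => f (χ.symm y))) y₀ :=
      ((hsm hf y₀ hy₀t (by rwa [hxx])).fderiv_right (m := ∞) (by simp)).continuousAt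
    filter_upwards [hev, (hc.clm_apply (hGs.continuousAt.clm_apply hc)).eventually
      (lt_mem_nhds (hpos hf hf0))] with y hy hy0
    rw [norm_differential g hy.1 (hmd hf _ hy.2)]
    exact (Real.sqrt_pos.2 hy0).ne'
  set b' : EuclideanSpace ℝ (Fin (m + 1)) × ℝ × (EuclideanSpace ℝ (Fin (m + 1)) →L[ℝ] ℝ) → ℝ :=
    fun w => b (χ.symm w.1) w.2.1 (w.2.2.comp (chartDeriv p₀ w.1)) with hb'
  have hb's : ContDiffAt ℝ 1 b' (y₀, φ' y₀, fderiv ℝ φ' y₀) := by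
    refine ((hb p₀).contDiffAt ?_).of_le (by simp)
    rw [nhds_prod_eq]
    exact prod_mem_prod hev univ_mem
  have hbeq : ∀ {f : M → ℝ}, ContMDiffOn (𝓡 (m + 1)) 𝓘(ℝ, ℝ) ∞ f U → ∀ y ∈ χ.target,
      χ.symm y ∈ U → b (χ.symm y) (f (χ.symm y)) (differential f (χ.symm y)) =
        b' (y, f (χ.symm y), fderiv ℝ (fun y => f (χ.symm y)) y) := fun hf y hy hyU => by
    rw [differential_eq_comp hy (hmd hf _ hyU)]
  have hnormal := eventually_inner_eq_zero_of_normal (ρ := density dv p₀) hp hGs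
    (contDiffAt_density dv hy₀t) (density_ne_zero dv hy₀t)
    (Eventually.of_forall fun y => raiseInChart_comm g p₀ y)
    (Eventually.of_forall fun y => raiseInChart_nonneg g p₀ y) hφ's hψ's (hψ'0.trans hφ'0.symm)
    hle' hb's (hpos hφ hφ₀) (by
      filter_upwards [hev, hnorm hφ hφ₀, hnorm hψ hψ₀] with y hy h1 h2
      have h := hH (χ.symm y) hy.2 h1 h2
      rwa [meanCurvature_eq g dv p hy.1 (hφ.contMDiffAt (hU.mem_nhds hy.2)) h1,
        meanCurvature_eq g dv p hy.1 (hψ.contMDiffAt (hU.mem_nhds hy.2)) h2,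
        hbeq hφ y hy.1 hy.2, hbeq hψ y hy.1 hy.2] at h)
  have hφ'c : ∀ᶠ y in 𝓝 y₀, ContinuousAt φ' y :=
    hev.mono fun y hy => (hsm hφ y hy.1 hy.2).continuousAt
  have hψ'c : ∀ᶠ y in 𝓝 y₀, ContinuousAt ψ' y :=
    hev.mono fun y hy => (hsm hψ y hy.1 hy.2).continuousAt
  refine ⟨fun hrank => ?_, fun hp' hrank => ?_⟩
  -- For (a) only directions tangent to the levels of `φ` are used, which covers `p = 0`, where the
  -- symbol degenerates along `dφ`.
  · have h1 : ∀ᶠ y in 𝓝 y₀, φ' y = 0 → ψ' y = 0 :=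
      eventually_eq_zero_of_hasLieRankNear_level hU hp₀ hφ hφp hφ₀ hrank hφ' hψ'c hψ'0
        (hnormal.mono fun x hx h z hz η hη => hx h z hz η (Or.inr hη))
    have hd := fderiv_eq_of_le_of_eq (hφ's.differentiableAt (by simp))
      (hψ's.differentiableAt (by simp)) hle' (hψ'0.trans hφ'0.symm)
    have hd0 : fderiv ℝ φ' y₀ ≠ 0 := fun h => by
      have := hpos hφ hφ₀
      rw [← hφ', h] at this
      simp at this
    have h2 := eventually_eq_zero_of_le (hφ's.hasStrictFDerivAt (by simp))
      (hd ▸ hψ's.hasStrictFDerivAt (by simp)) hd0 hφ'0 hφ'c hle' h1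
    exact eventually_nhds_of_chart (h1.and h2 |>.mono fun y hy => ⟨hy.1, hy.2⟩)
  -- For `p > 0` all horizontal directions are orthogonal to the normals, so the contact set itself
  -- propagates.
  · have h1 : ∀ᶠ y in 𝓝 y₀, ψ' y - φ' y = 0 := by
      refine eventually_eq_zero_of_hasLieRankNear hrank
        (hψ'c.and hφ'c |>.mono fun y hy => hy.1.sub hy.2) (sub_eq_zero.2 (hψ'0.trans hφ'0.symm))
        (hnormal.mono fun x hx h z hz η => ?_)
      simp only [sub_eq_zero] at h hz
      exact hx h z hz η (Or.inl hp')
    exact eventually_nhds_of_chart (h1.mono fun y hy => sub_eq_zero.1 hy)
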